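/- **Conventions.** Fix $0<q<1$ and write $(a;q^2)_\infty=\prod_{n\ge0}(1-aq^{2n})$, $(a;q^2)_t=\prod_{n=0}^{t-1}(1-aq^{2n})$ for $t\ge0$, $(a;q^2)_t=1/(aq^{2t};q^2)_{-t}$ for $t<0$, $(a_1,\dots,a_m;q^2)_t=\prod_i(a_i;q^2)_t$, $\theta(x)=(x,q^2/x;q^2)_\infty$, $\theta(x_1,\dots,x_m)=\prod_i\theta(x_i)$; ${}_m\phi_{m-1}(\cdots)$ are basic hypergeometric series with base $q^2$ and argument $q^2$. Square roots of positive numbers are positive. Let $k,r,l\in\mathbb Z$. Write $x_i=q^{2\epsilon_i}$ ($i=1,\dots,4$), $s_i=q^{2\sigma_i}$ ($i=3,4$) for real parameters with $x_2/x_1=x_3/x_4$, put $\rho=x_2/x_1$, $\iota(s)=s/|s|$ and $S_l(A,B)=\sqrt{(-ABq^{2l+1},-AB^{-1}q^{2l+1};q^2)_\infty}$. Let $$R(s_4)=\kappa_r z^{-k-r}q^{l-k-r}\frac{S_{-k}(x_4^{-1},s_4)}{S_{-k-r}(x_3^{-1},s_3)}\frac{S_{l+r}(x_2,\alpha s_4)}{S_l(x_1,\alpha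 s_3)}\Bigl\{T_1+T_2\Bigr\},\qquad \kappa_r=\frac{z^r\alpha^rs_4^{-r}q^r}{(zq^{2-2r}\rho^{-1};q^2)_r},$$ $$T_1=\frac{(\alpha q^{2(l-k-r+1)}\frac{x_1}{x_3},zq^2\frac{s_4}{s_3},z^{-1}\frac{s_4}{s_3};q^2)_\infty}{(\alpha z^{-1}q^{2(l-k)}\frac{x_1}{x_4},\frac{q^2s_4}{\rho s_3},q^{2r}\rho\frac{s_4}{s_3};q^2)_\infty}\Bigl(\frac{q^{2-2r}s_3s_4}{\rho};q^2\Bigr)_r\,{}_4\phi_3\Bigl({-q^{1-2(k+r)}\frac{s_3}{x_3},\,-\alpha q^{2l+1}x_1s_3,\,\frac{zq^{2-2r}}{\rho},\,\frac{q^{-2r}}{z\rho}\atop \alpha q^{2(l-k-r+1)}\frac{x_1}{x_3},\,\frac{q^{2-2r}s_3}{\rho s_4},\,\frac{q^{2-2r}s_3s_4}{\rho}}\Bigr),$$ $$T_2=\frac{(\alpha q^{2(l-k+1)}\frac{x_1s_4}{x_4s_3},-q^{1-2(k+r)}\frac{s_3}{x_3},-\alpha q^{2l+1}x_1s_3;q^2)_\infty}{(\alpha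 z^{-1}q^{2(l-k)}\frac{x_1}{x_4},-q^{1-2k}\frac{s_4}{x_4},-\alpha q^{2(l+r)+1}x_2s_4;q^2)_\infty}\frac{(\frac{zq^{2-2r}}{\rho},\frac{q^{-2r}}{z\rho},s_4^2q^2;q^2)_\infty}{(\frac{q^2s_4}{\rho s_3},\frac{q^2s_3s_4}{\rho},\frac{q^{-2r}s_3}{\rho s_4};q^2)_\infty}\,{}_4\phi_3\Bigl({-q^{1-2k}\frac{s_4}{x_4},\,-\alpha q^{2(l+r)+1}x_2s_4,\,zq^2\frac{s_4}{s_3},\,\frac{s_4}{zs_3}\atop \alpha q^{2(l-k+1)}\frac{x_1s_4}{x_4s_3},\,s_4^2q^2,\,q^{2(r+1)}\rho\frac{s_4}{s_3}}\Bigr).$$ With $$c(s_4)=\sqrt{\frac{\theta(-qx_4/s_4)}{\theta(-qx_4s_4)}}\,\frac{(\frac{q^2s_4}{\rho s_3},\frac{q^2s_3s_4}{\rho};q^2)_\infty}{(zq^2s_3s_4,zq^2s_4/s_3;q^2)_\infty}$$ the solution $r(z,\alpha;\beta,Z;x_1,x_2;x_3,x_4;s_3,s_4)=r^{k,k+r^*}_{l,l+r^*}$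 is $$r=\iota(s_3)\sqrt{\theta(-qx_3s_3,-qx_3/s_3)}\Bigl\{c(s_4)\,\theta\bigl(-\alpha qx_2s_4,-\tfrac{\beta qZs_4}{\alpha x_2},-\tfrac{\beta qZ}{zx_3s_4}\bigr)R(s_4)-c(s_4^{-1})\,\theta\bigl(-\tfrac{\alpha qx_2}{s_4},-\tfrac{\beta qZ}{\alpha x_2s_4},-\tfrac{\beta qZs_4}{zx_3}\bigr)R(s_4^{-1})\Bigr\}.$$ For $z=\varepsilon=\pm1$, $s_3=s$, $s_4=\varepsilon s$, a point $(x_1,x_2,x_3,x_4,s)$ with $x_2x_4=x_1x_3$ is *regular* if for all integers $n\ge0$ the numbers $\varepsilon\alpha q^{2(l-k+n)}x_1/x_4$, $\alpha q^{2(l-k-r+1+n)}x_1/x_3$ and $\varepsilon\alpha q^{2(l-k+1+n)}x_1/(x_4s^2)$ differ from $1$; at other points $r$ means the continuous extension of $r$ (as a function of $(x_1,\dots,x_4,s)$) from the regular points. Further let $$v_{k,r,l}(\varepsilon,\alpha;x_1,x_2;x_3,x_4;s)=\frac{(1+\varepsilon q^{2k+1}x_4s)(1+q^{2(k+r)+1}\frac{x_3}{s})}{(1+\varepsilon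 q^{2k+3}\frac{x_4}{s})(1+q^{2(k+r)-1}x_3s)}\,{}_4\phi_3\Bigl({\varepsilon\alpha q^{2(l-k+1)}\frac{x_1}{x_4},\,\varepsilon q^{2-2r}\frac{x_1}{x_2},\,\frac{q^2}{s^2},\,q^2\atop -\frac{q^{3-2(k+r)}}{x_3s},\,-\alpha q^{2l+3}\frac{x_1}{s},\,q^4}\Bigr)$$ $$+\frac{(\varepsilon\alpha q^{2(l-k+1)}\frac{x_1}{x_4},\alpha q^{2(k+l+r+1)}x_1x_3,-q^{2(k+r)+3}x_3s,\varepsilon q^{2-2r}\frac{x_1}{x_2},\frac{q^2}{s^2};q^2)_\infty}{(-\varepsilon q^{2k+3}x_4s,-q^{2(k+r)+3}\frac{x_3}{s},-\frac{q^{1-2(k+r)}}{x_3s},-\alpha q^{2l+3}\frac{x_1}{s},-\varepsilon\alpha q^{2(l+r)+1}x_2s;q^2)_\infty}\,\frac{1-q^2}{1+\varepsilon q^{2k+3}\frac{x_4}{s}}\;{}_3\phi_2\Bigl({-\varepsilon q^{2k+1}x_4s,\,-q^{2(k+r)+1}\frac{x_3}{s},\,-\varepsilon\alpha q^{2(l+r)+1}x_2s\atop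 \alpha q^{2(k+l+r+1)}x_1x_3,\,-q^{2(k+r)+3}x_3s}\Bigr),$$ $$t_{k,r,l}(\varepsilon;x_1,x_2;s)=\frac1{(1+q^{2(k+r)-1}x_2s)(1+\varepsilon q^{2l+1}\frac{x_1}{s})}\,{}_4\phi_3\Bigl({q^{-2(k-l-1)},\,\varepsilon q^{2-2r}\frac{x_1}{x_2},\,\frac{q^2}{s^2},\,q^2\atop -\frac{q^{3-2(k+r)}}{x_2s},\,-\varepsilon q^{2l+3}\frac{x_1}{s},\,q^4}\Bigr),$$ $$V_{k,r,l}=\begin{cases}t_{k,r,l}(\varepsilon;x_1,x_2;s)&k>l,\\ t_{l+r,-r,k+r}(\varepsilon;\varepsilon x_2,\varepsilon x_1;s)&l>k,\\ \dfrac{(1+\varepsilon q^{2k+3}x_1/s)\,v_{k,r,k}(\varepsilon,\varepsilon;x_1,x_2;x_2,x_1;s)}{(1+\varepsilon q^{2k+1}x_1s)(1+q^{2(k+r)+1}x_2/s)(1+\varepsilon q^{2k+1}x_1/s)}&k=l.\end{cases}$$ **Proposition.** Let $\varepsilon,\alpha'\in\{1,-1\}$, $Z\ne0$ real, $x_1,x_2>0$,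 $s\ne0$ real, and assume $s^2\notin q^{2\mathbb Z}$, $\varepsilon\rho\notin q^{2\mathbb Z}$, $\varepsilon\rho s^{-2}\notin q^{2\mathbb Z}$, $\varepsilon\rho s^2\ne q^{2n}$ for all integers $n>0$. Write $x_2'=Z/x_2$. For reals $A,B$ say that $P(A,B)$ holds if $(1+q^{2j+1}AB)(1+q^{2j+1}A/B)>0$ for all $j\in\mathbb Z$. (1) Let $\alpha\in\{1,-1\}$, $x_3,x_4>0$, $x_2x_4=x_1x_3$, assume $P(x_1,\alpha s)$, $P(x_2,\alpha\varepsilon s)$, $P(x_3,s)$, $P(x_4,\varepsilon s)$, and that the ${}_3\phi_2$-series in $v_{k,r,l}$ is defined, i.e. $\alpha q^{2(k+l+r+1+n)}x_1x_3\ne1$ for all integers $n\ge0$. Put $y_2=\varepsilon x_2$, $y_4=\varepsilon x_4$, $y_2'=Z/y_2$, $\beta=\alpha\alpha'$. Then $$r(1,\alpha;\beta,Z;x_1,y_2;x_3,y_4;s,s)=\varepsilon^k\alpha^r\varsigma\; q\frac{x_3}{s}\iota(s)\frac{(q^2x_1/y_2;q^2)_\infty}{(q^2;q^2)_\infty}\sqrt{\frac{(-q^{2k+1}y_4s,-q^{2(k+r)+1}\frac{x_3}{s},-\alpha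 q^{2l+1}\frac{x_1}{s},-\alpha q^{2(l+r)+1}y_2s;q^2)_\infty}{(-q^{2k+1}\frac{y_4}{s},-q^{2(k+r)+1}x_3s,-\alpha q^{2l+1}x_1s,-\alpha q^{2(l+r)+1}\frac{y_2}{s};q^2)_\infty}}$$ $$\cdot\Bigl\{(-\alpha)^{l-k}q^{(l-k)^2}\bigl(\tfrac{x_1}{y_4}\bigr)^{l-k}\bigl(\alpha q^{2(l-k+1)}\tfrac{x_1}{y_4},\alpha q^{2(k-l+1)}\tfrac{y_4}{x_1};q^2\bigr)_\infty\theta\bigl(\alpha\alpha'q^2Z,\alpha'\tfrac{y_2'}{x_3},s^2\bigr)$$ $$+q^{l+k}\frac{x_1}{y_2}\,v_{k,r,l}(1,\alpha;x_1,y_2;x_3,y_4;s)\,\theta\bigl(-\alpha qy_2s,-\alpha'qy_2's,-q\tfrac{x_3}{s},-\alpha\alpha'q\tfrac{Z}{x_3s}\bigr)\frac{(1+q^{2k+3}\frac{y_4}{s})(1-q^{2r}\frac{y_2}{x_1})(1-s^2)}{(1+q^{2k+1}y_4s)(1+q^{2(k+r)+1}\frac{x_3}{s})(1+\alpha q^{2l+1}\frac{x_1}{s})(1-q^2)}\Bigr\},$$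 where $\varsigma=\pm1$ is the sign of $\theta(-q\frac{y_4}{s})\,(-q^{2k+1}\frac{y_4}{s},-q^{2(k+r)+1}x_3s,-\alpha q^{2l+1}x_1s,-\alpha q^{2(l+r)+1}\frac{y_2}{s};q^2)_\infty$, and $$r(\varepsilon,\alpha;\beta,Z;x_1,x_2;x_3,x_4;s,\varepsilon s)=\varepsilon^{k+r}\,r(1,\alpha;\beta,Z;x_1,\varepsilon x_2;x_3,\varepsilon x_4;s,s).$$ (2) Assume $P(x_1,\varepsilon s)$, $P(x_2,s)$ and, if $k=l$, $\varepsilon q^{2(2k+r+1+n)}x_1x_2\ne1$ for all integers $n\ge0$. Then, for $z=\alpha=\varepsilon$, $x_4=x_1$, $x_3=x_2$, $$r(\varepsilon,\varepsilon;\varepsilon\alpha',Z;x_1,x_2;x_2,x_1;s,\varepsilon s)=\varsigma'\Bigl\{\delta_{k,l}\,q\frac{x_2}{s}\iota(s)\,\theta\bigl(\varepsilon\alpha'q^2x_2x_2',\varepsilon\alpha'q^2\tfrac{x_2}{x_2'},s^2\bigr)\bigl(\varepsilon q^2\tfrac{x_1}{x_2},q^2;q^2\bigr)_\infty$$ $$+V_{k,r,l}\,\varepsilon\,\theta\bigl(-qx_2s,-\varepsilon\alpha'qx_2's,-q\tfrac{x_2}{s},-\varepsilon\alpha'q\tfrac{x_2'}{s}\bigr)q\frac{x_1}{s}\iota(s)\frac{(\varepsilon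 q^2\frac{x_1}{x_2};q^2)_\infty(1-\varepsilon q^{2r}\frac{x_2}{x_1})(1-s^2)}{(q^2;q^2)_\infty(1-q^2)}$$ $$\cdot q^{k+l}\sqrt{\frac{(-\varepsilon q\frac{x_1}{s},-q^{2r+1}x_2s;q^2)_k\,(-\varepsilon qx_1s,-q^{2r+1}\frac{x_2}{s};q^2)_l}{(-\varepsilon qx_1s,-q^{2r+1}\frac{x_2}{s};q^2)_k\,(-\varepsilon q\frac{x_1}{s},-q^{2r+1}x_2s;q^2)_l}}\Bigr\},$$ where $\varsigma'=\pm1$ is the sign of $\theta(-\varepsilon q\frac{x_1}{s})\,(-\varepsilon q\frac{x_1}{s},-q^{2r+1}x_2s;q^2)_k\,(-\varepsilon q\frac{x_1}{s},-q^{2r+1}x_2s;q^2)_l$. (3) For $k\ne l$ the ${}_4\phi_3$-series in $V_{k,r,l}$ terminates: its terms of index $n\ge|k-l|$ vanish. -/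

import Mathlib

open Filter Topology

namespace QIntertwiner

/-- The infinite shifted factorial `(a; p)_∞ = ∏_{n ≥ 0} (1 - a p ^ n)`. -/
noncomputable def qInf1 (p a : ℝ) : ℝ := ∏' n : ℕ, (1 - a * p ^ n)

/-- `(a₁, …, a_m; p)_∞`. -/
noncomputable def qInf (p : ℝ) (as : List ℝ) : ℝ := (as.map (qInf1 p)).prod

/-- The shifted factorial `(a; p)_t` for `t : ℤ`; for `t < 0` it is `1 / (a p ^ t; p)_{-t}`. -/
noncomputable def qFin1 (p a : ℝ) (t : ℤ) : ℝ :=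
  if 0 ≤ t then ∏ n ∈ Finset.range t.toNat, (1 - a * p ^ n)
  else 1 / ∏ n ∈ Finset.range (-t).toNat, (1 - a * p ^ t * p ^ n)

/-- `(a₁, …, a_m; p)_t`. -/
noncomputable def qFin (p : ℝ) (as : List ℝ) (t : ℤ) : ℝ := (as.map (fun a => qFin1 p a t)).prod

/-- The `t`-th term of the basic hypergeometric series with numerator parameters `as`,
denominator parameters `bs`, base `p` and argument `w`. -/
noncomputable def phiTerm (as bs : List ℝ) (p w : ℝ) (t : ℕ) : ℝ :=
  qFin p as t * w ^ t / qFin p (p :: bs) t *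
    ((-1) ^ t * p ^ (t * (t - 1) / 2)) ^ (bs.length + 1 - as.length)

/-- The basic hypergeometric series `_mφ_n` (for `m ≤ n + 1`). -/
noncomputable def phi (as bs : List ℝ) (p w : ℝ) : ℝ := ∑' t : ℕ, phiTerm as bs p w t

/-- The product `θ_p(x₁, …, x_m)` of theta functions `θ_p(x) = (x, p / x; p)_∞`. -/
noncomputable def theta (p : ℝ) (xs : List ℝ) : ℝ := (xs.map (fun x => qInf p [x, x⁻¹ * p])).prod

/-- `S_l(A, B)`. -/
noncomputable def S (q : ℝ) (l : ℤ) (A B : ℝ) : ℝ :=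
  √ (qInf (q ^ 2) [-(A * B * q ^ (2 * l + 1)), -(A * B⁻¹ * q ^ (2 * l + 1))])

/-- All the numbers `s_l(A, B) ^ 2 = (1 + q ^ (2 l + 1) A B) (1 + q ^ (2 l + 1) A / B)`, `l : ℤ`,
are positive, so that the square roots `s_l(A, B)` in the module with parameters
`A = q ^ (2 ε)`, `B = q ^ (2 σ)` and the `S_l(A, B)` are roots of positive numbers. -/
def RootsPos (q A B : ℝ) : Prop :=
  ∀ l : ℤ, 0 < (1 + q ^ (2 * l + 1) * A * B) * (1 + q ^ (2 * l + 1) * A * B⁻¹)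

/-- `ι(s) = |s|⁻¹ s`. -/
noncomputable def iota (s : ℝ) : ℝ := |s|⁻¹ * s

/-- `κ_r`; here and below `xᵢ` stands for `q ^ (2 εᵢ)` and `sᵢ` for `q ^ (2 σᵢ)`. -/
noncomputable def kappa (q : ℝ) (r : ℤ) (z α x₁ x₂ s₄ : ℝ) : ℝ :=
  z ^ r * α ^ r * s₄ ^ (-r) * q ^ r / qFin (q ^ 2) [z * q ^ (2 - 2 * r) * (x₁ / x₂)] r

/-- The matrix element `R^{k, k + r*}_{l, l + r*}(z, α; x₁, x₂; x₃, x₄; s₃, s₄)`. -/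
noncomputable def R (q : ℝ) (k r l : ℤ) (z α x₁ x₂ x₃ x₄ s₃ s₄ : ℝ) : ℝ :=
  kappa q r z α x₁ x₂ s₄ * z ^ (-k - r) * q ^ (l - k - r) *
    (S q (-k) x₄⁻¹ s₄ / S q (-k - r) x₃⁻¹ s₃) *
    (S q (l + r) x₂ (α * s₄) / S q l x₁ (α * s₃)) *
  (qInf (q ^ 2) [α * q ^ (2 * (l - k - r + 1)) * (x₁ / x₃), z * q ^ 2 * (s₄ / s₃),
        z⁻¹ * (s₄ / s₃)] /
      qInf (q ^ 2) [α * z⁻¹ * q ^ (2 * (l - k)) * (x₁ / x₄), q ^ 2 * (x₁ / x₂) * (s₄ / s₃),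
        q ^ (2 * r) * (x₂ / x₁) * (s₄ / s₃)] *
      qFin (q ^ 2) [q ^ (2 - 2 * r) * (x₁ / x₂) * (s₃ * s₄)] r *
      phi [-(q ^ (1 - 2 * (k + r)) * (s₃ / x₃)), -(α * q ^ (2 * l + 1) * (x₁ * s₃)),
          z * q ^ (2 - 2 * r) * (x₁ / x₂), z⁻¹ * q ^ (-2 * r) * (x₁ / x₂)]
        [α * q ^ (2 * (l - k - r + 1)) * (x₁ / x₃),
          q ^ (2 - 2 * r) * (x₁ / x₂) * (s₃ / s₄),
          q ^ (2 - 2 * r) * (x₁ / x₂) * (s₃ * s₄)] (q ^ 2) (q ^ 2) +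
    qInf (q ^ 2) [α * q ^ (2 * (l - k + 1)) * (x₁ / x₄) * (s₄ / s₃),
        -(q ^ (1 - 2 * (k + r)) * (s₃ / x₃)), -(α * q ^ (2 * l + 1) * (x₁ * s₃))] /
      qInf (q ^ 2) [α * z⁻¹ * q ^ (2 * (l - k)) * (x₁ / x₄),
        -(q ^ (1 - 2 * k) * (s₄ / x₄)), -(α * q ^ (2 * (l + r) + 1) * (x₂ * s₄))] *
      (qInf (q ^ 2) [z * q ^ (2 - 2 * r) * (x₁ / x₂), z⁻¹ * q ^ (-2 * r) * (x₁ / x₂),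
          s₄ ^ 2 * q ^ 2] /
        qInf (q ^ 2) [q ^ 2 * (x₁ / x₂) * (s₄ / s₃), q ^ 2 * (x₁ / x₂) * (s₃ * s₄),
          q ^ (-2 * r) * (x₁ / x₂) * (s₃ / s₄)]) *
      phi [-(q ^ (1 - 2 * k) * (s₄ / x₄)), -(α * q ^ (2 * (l + r) + 1) * (x₂ * s₄)),
          z * q ^ 2 * (s₄ / s₃), z⁻¹ * (s₄ / s₃)]
        [α * q ^ (2 * (l - k + 1)) * (x₁ / x₄) * (s₄ / s₃), s₄ ^ 2 * q ^ 2,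
          q ^ (2 * (r + 1)) * (x₂ / x₁) * (s₄ / s₃)] (q ^ 2) (q ^ 2))

/-- The coefficient `c(s₄)`. -/
noncomputable def c (q z x₁ x₂ x₄ s₃ s₄ : ℝ) : ℝ :=
  √ (theta (q ^ 2) [-(x₄ / s₄ * q)] / theta (q ^ 2) [-(x₄ * s₄ * q)]) *
    (qInf (q ^ 2) [q ^ 2 * (x₁ / x₂) * (s₄ / s₃), q ^ 2 * (x₁ / x₂) * (s₃ * s₄)] /
      qInf (q ^ 2) [z * q ^ 2 * (s₃ * s₄), z * q ^ 2 * (s₄ / s₃)])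

/-- The element `r^{k, k + r*}_{l, l + r*}(z, α; β, Z; x₁, x₂; x₃, x₄; s₃, s₄)`, `Z = q ^ (2 ζ)`.
The second matrix element `Ř` is `R` with `s₄` replaced by `s₄⁻¹`. -/
noncomputable def rElt (q : ℝ) (k r l : ℤ) (z α β Z x₁ x₂ x₃ x₄ s₃ s₄ : ℝ) : ℝ :=
  iota s₃ * √ (theta (q ^ 2) [-(x₃ * s₃ * q), -(x₃ / s₃ * q)]) *
  (c q z x₁ x₂ x₄ s₃ s₄ *
      theta (q ^ 2) [-(α * x₂ * s₄ * q), -(β * α⁻¹ * (Z / x₂) * s₄ * q),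
        -(β * z⁻¹ * (Z / x₃) / s₄ * q)] *
      R q k r l z α x₁ x₂ x₃ x₄ s₃ s₄ -
    c q z x₁ x₂ x₄ s₃ s₄⁻¹ *
      theta (q ^ 2) [-(α * x₂ / s₄ * q), -(β * α⁻¹ * (Z / x₂) / s₄ * q),
        -(β * z⁻¹ * (Z / x₃) * s₄ * q)] *
      R q k r l z α x₁ x₂ x₃ x₄ s₃ s₄⁻¹)

/-- For `z = ε` and `s₄ = ε s` with `ε = ±1`: none of the `k`, `l`-dependent denominators
`(α z⁻¹ q^(2(l-k)) x₁/x₄)_∞`, `(α q^(2(l-k-r+1)) x₁/x₃)_t`, `(α q^(2(l-k+1)) x₁ s₄^(±1)/(x₄ s))_t`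
in the expressions for `R` and `Ř` vanishes. -/
def Regular (q : ℝ) (k r l : ℤ) (ε α x₁ x₃ x₄ s : ℝ) : Prop :=
  ∀ n : ℕ, ε * α * q ^ (2 * (l - k + n)) * (x₁ / x₄) ≠ 1 ∧
    α * q ^ (2 * (l - k - r + 1 + n)) * (x₁ / x₃) ≠ 1 ∧
    ε * α * q ^ (2 * (l - k + 1 + n)) * (x₁ / (x₄ * s ^ 2)) ≠ 1

/-- The regular points of the parameter space `(x₁, x₂, x₃, x₄, s)` with `x₂ / x₁ = x₃ / x₄`. -/
def regularSet (q : ℝ) (k r l : ℤ) (ε α : ℝ) : Set (ℝ × ℝ × ℝ × ℝ × ℝ) :=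
  {y | y.2.1 * y.2.2.2.1 = y.1 * y.2.2.1 ∧
    Regular q k r l ε α y.1 y.2.2.1 y.2.2.2.1 y.2.2.2.2}

/-- Every admissible point is a limit of regular points, so the value is unique. -/
theorem regularSet_neBot (q : ℝ) (k r l : ℤ) (ε α x₁ x₂ x₃ x₄ s : ℝ) (hx : x₂ * x₄ = x₁ * x₃) :
    (𝓝[regularSet q k r l ε α] (x₁, x₂, x₃, x₄, s)).NeBot := by
  have key : ∀ K y c : ℝ, K * (x₁ / (c * y)) = 1 → c = K * (x₁ / y) := by
    intro K y c h
    have hc : c ≠ 0 := by rintro rfl; simp at h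
    have h2 : K * (x₁ / (c * y)) = K * (x₁ / y) / c := by
      rw [mul_comm c y, ← div_div, mul_div_assoc]
    rw [h2, div_eq_iff hc] at h
    linarith
  let B : Set ℝ := Set.range (fun n : ℕ => ε * α * q ^ (2 * (l - k + n)) * (x₁ / x₄)) ∪
    Set.range (fun n : ℕ => α * q ^ (2 * (l - k - r + 1 + n)) * (x₁ / x₃)) ∪
    Set.range (fun n : ℕ => ε * α * q ^ (2 * (l - k + 1 + n)) * (x₁ / (x₄ * s ^ 2)))
  have hB : B.Countable :=
    ((Set.countable_range _).union (Set.countable_range _)).union (Set.countable_range _)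
  have hd : Dense Bᶜ := hB.dense_compl ℝ
  have h1 : (𝓝[Bᶜ] (1 : ℝ)).NeBot := mem_closure_iff_nhdsWithin_neBot.1 (hd 1)
  have hf : Tendsto (fun c : ℝ => (x₁, x₂, c * x₃, c * x₄, s)) (𝓝[Bᶜ] (1 : ℝ))
      (𝓝[regularSet q k r l ε α] (x₁, x₂, x₃, x₄, s)) := by
    refine tendsto_nhdsWithin_iff.2 ⟨?_, ?_⟩
    · have hc : Continuous (fun c : ℝ => (x₁, x₂, c * x₃, c * x₄, s)) := by fun_prop
      have := hc.tendsto 1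
      simp only [one_mul] at this
      exact this.mono_left nhdsWithin_le_nhds
    · filter_upwards [self_mem_nhdsWithin] with c hc
      refine ⟨?_, fun n => ⟨fun h => hc ?_, fun h => hc ?_, fun h => hc ?_⟩⟩
      · change x₂ * (c * x₄) = x₁ * (c * x₃)
        linear_combination c * hx
      · exact Or.inl (Or.inl ⟨n, (key _ _ _ h).symm⟩)
      · exact Or.inl (Or.inr ⟨n, (key _ _ _ h).symm⟩)
      · refine Or.inr ⟨n, (key _ _ _ ?_).symm⟩
        rw [← mul_assoc]
        exact h
  exact hf.neBot

/-- `w` is the value at `(x₁, x₂, x₃, x₄, s)` of the function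
`r^{k, k + r*}_{l, l + r*}(ε, α; β, Z; x₁, x₂; x₃, x₄; s, ε s)`, extended by continuity from the
set of regular points. At a regular point it is the plain value, see `HasValue.eq`. -/
def HasValue (q : ℝ) (k r l : ℤ) (ε α β Z x₁ x₂ x₃ x₄ s w : ℝ) : Prop :=
  Tendsto (fun y : ℝ × ℝ × ℝ × ℝ × ℝ =>
      rElt q k r l ε α β Z y.1 y.2.1 y.2.2.1 y.2.2.2.1 y.2.2.2.2 (ε * y.2.2.2.2))
    (𝓝[regularSet q k r l ε α] (x₁, x₂, x₃, x₄, s)) (𝓝 w)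

/-- At a regular point the value is the one given by the defining expression. -/
theorem HasValue.eq {q : ℝ} {k r l : ℤ} {ε α β Z x₁ x₂ x₃ x₄ s w : ℝ}
    (h : HasValue q k r l ε α β Z x₁ x₂ x₃ x₄ s w) (hx : x₂ * x₄ = x₁ * x₃)
    (hreg : Regular q k r l ε α x₁ x₃ x₄ s) :
    rElt q k r l ε α β Z x₁ x₂ x₃ x₄ s (ε * s) = w := by
  have hmem : (x₁, x₂, x₃, x₄, s) ∈ regularSet q k r l ε α := ⟨hx, hreg⟩
  have h1 := h.mono_left (pure_le_nhdsWithin hmem)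
  exact tendsto_nhds_unique (tendsto_pure_nhds _ _) h1

/-- The function `v_{k, r, l}(ε, α; x₁, x₂; x₃, x₄; s)`. -/
noncomputable def v (q : ℝ) (k r l : ℤ) (ε α x₁ x₂ x₃ x₄ s : ℝ) : ℝ :=
  (1 + ε * q ^ (2 * k + 1) * (x₄ * s)) * (1 + q ^ (2 * (k + r) + 1) * (x₃ / s)) /
      ((1 + ε * q ^ (2 * k + 3) * (x₄ / s)) * (1 + q ^ (2 * (k + r) - 1) * (x₃ * s))) *
    phi [ε * α * q ^ (2 * (l - k + 1)) * (x₁ / x₄), ε * q ^ (2 - 2 * r) * (x₁ / x₂),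
        q ^ 2 / s ^ 2, q ^ 2]
      [-(q ^ (3 - 2 * (k + r)) / (x₃ * s)), -(α * q ^ (2 * l + 3) * (x₁ / s)), q ^ 4]
      (q ^ 2) (q ^ 2) +
  qInf (q ^ 2) [ε * α * q ^ (2 * (l - k + 1)) * (x₁ / x₄),
        α * q ^ (2 * (k + l + r + 1)) * (x₁ * x₃), -(q ^ (2 * (k + r) + 3) * (x₃ * s))] /
      qInf (q ^ 2) [-(ε * q ^ (2 * k + 3) * (x₄ * s)), -(q ^ (2 * (k + r) + 3) * (x₃ / s)),
        -(q ^ (1 - 2 * (k + r)) / (x₃ * s))] *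
    (qInf (q ^ 2) [ε * q ^ (2 - 2 * r) * (x₁ / x₂), q ^ 2 / s ^ 2] /
      qInf (q ^ 2) [-(α * q ^ (2 * l + 3) * (x₁ / s)),
        -(ε * α * q ^ (2 * (l + r) + 1) * (x₂ * s))]) *
    ((1 - q ^ 2) / (1 + ε * q ^ (2 * k + 3) * (x₄ / s))) *
    phi [-(ε * q ^ (2 * k + 1) * (x₄ * s)), -(q ^ (2 * (k + r) + 1) * (x₃ / s)),
        -(ε * α * q ^ (2 * (l + r) + 1) * (x₂ * s))]
      [α * q ^ (2 * (k + l + r + 1)) * (x₁ * x₃), -(q ^ (2 * (k + r) + 3) * (x₃ * s))]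
      (q ^ 2) (q ^ 2)

/-- The sign of the roots in the formula for `r` at `z = 1`, `s₄ = s`. -/
noncomputable def rootSign (q : ℝ) (k r l : ℤ) (α x₁ x₂ x₃ x₄ s : ℝ) : ℝ :=
  Real.sign (theta (q ^ 2) [-(x₄ / s * q)] *
    qInf (q ^ 2) [-(q ^ (2 * k + 1) * (x₄ / s)), -(q ^ (2 * (k + r) + 1) * (x₃ * s)),
      -(α * q ^ (2 * l + 1) * (x₁ * s)), -(α * q ^ (2 * (l + r) + 1) * (x₂ / s))])

/-- The explicit expression for `r` at `z = 1`, `s₄ = s` up to sign, with `x₂' = Z / x₂`. -/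
noncomputable def rFormula (q : ℝ) (k r l : ℤ) (α α' Z x₁ x₂ x₃ x₄ s : ℝ) : ℝ :=
  q * (x₃ / s) * iota s * (qInf (q ^ 2) [q ^ 2 * (x₁ / x₂)] / qInf (q ^ 2) [q ^ 2]) *
    √ (qInf (q ^ 2) [-(q ^ (2 * k + 1) * (x₄ * s)), -(q ^ (2 * (k + r) + 1) * (x₃ / s)),
          -(α * q ^ (2 * l + 1) * (x₁ / s)), -(α * q ^ (2 * (l + r) + 1) * (x₂ * s))] /
        qInf (q ^ 2) [-(q ^ (2 * k + 1) * (x₄ / s)), -(q ^ (2 * (k + r) + 1) * (x₃ * s)),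
          -(α * q ^ (2 * l + 1) * (x₁ * s)), -(α * q ^ (2 * (l + r) + 1) * (x₂ / s))]) *
  ((-α) ^ (l - k) * q ^ ((l - k) ^ 2) * (x₁ / x₄) ^ (l - k) *
      qInf (q ^ 2) [α * q ^ (2 * (l - k + 1)) * (x₁ / x₄),
        α * q ^ (2 * (k - l + 1)) * (x₄ / x₁)] *
      theta (q ^ 2) [α * α' * q ^ 2 * Z, α' * (Z / x₂ / x₃), s ^ 2] +
    q ^ (l + k) * (x₁ / x₂) * v q k r l 1 α x₁ x₂ x₃ x₄ s *
      theta (q ^ 2) [-(α * q * (x₂ * s)), -(α' * q * (Z / x₂ * s)), -(q * (x₃ / s)),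
        -(α * α' * q * (Z / x₃ / s))] *
      ((1 + q ^ (2 * k + 3) * (x₄ / s)) * (1 - q ^ (2 * r) * (x₂ / x₁)) * (1 - s ^ 2) /
        ((1 + q ^ (2 * k + 1) * (x₄ * s)) * (1 + q ^ (2 * (k + r) + 1) * (x₃ / s)) *
          (1 + α * q ^ (2 * l + 1) * (x₁ / s)) * (1 - q ^ 2))))

/-- The terms of the `_4φ_3` series in `t_{k, r, l}(ε; x₁, x₂; s)`. -/
noncomputable def tTerm (q : ℝ) (k r l : ℤ) (ε x₁ x₂ s : ℝ) : ℕ → ℝ :=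
  phiTerm [q ^ (-2 * (k - l - 1)), ε * q ^ (2 - 2 * r) * (x₁ / x₂), q ^ 2 / s ^ 2, q ^ 2]
    [-(q ^ (3 - 2 * (k + r)) / (x₂ * s)), -(ε * q ^ (2 * l + 3) * (x₁ / s)), q ^ 4]
    (q ^ 2) (q ^ 2)

/-- The function `t_{k, r, l}(ε; x₁, x₂; s)`. -/
noncomputable def t (q : ℝ) (k r l : ℤ) (ε x₁ x₂ s : ℝ) : ℝ :=
  1 / ((1 + q ^ (2 * (k + r) - 1) * (x₂ * s)) * (1 + ε * q ^ (2 * l + 1) * (x₁ / s))) *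
    ∑' n : ℕ, tTerm q k r l ε x₁ x₂ s n

/-- The function `V_{k, r, l}`. -/
noncomputable def V (q : ℝ) (k r l : ℤ) (ε x₁ x₂ s : ℝ) : ℝ :=
  if l < k then t q k r l ε x₁ x₂ s
  else if k < l then t q (l + r) (-r) (k + r) ε (ε * x₂) (ε * x₁) s
  else v q k r l ε ε x₁ x₂ x₂ x₁ s * (1 + ε * q ^ (2 * k + 3) * (x₁ / s)) /
    ((1 + ε * q ^ (2 * k + 1) * (x₁ * s)) * (1 + q ^ (2 * (k + r) + 1) * (x₂ / s)) *
      (1 + ε * q ^ (2 * k + 1) * (x₁ / s)))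

/-- The sign of the roots in the formula for `r` at `z = α = ε`, `x₄ = x₁`, `x₃ = x₂`,
`s₄ = ε s`. -/
noncomputable def rootSignSpecial (q : ℝ) (k r l : ℤ) (ε x₁ x₂ s : ℝ) : ℝ :=
  Real.sign (theta (q ^ 2) [-(ε * q * (x₁ / s))] *
    qFin (q ^ 2) [-(ε * q * (x₁ / s)), -(q ^ (2 * r + 1) * (x₂ * s))] k *
    qFin (q ^ 2) [-(ε * q * (x₁ / s)), -(q ^ (2 * r + 1) * (x₂ * s))] l)

/-- The explicit expression for `r` at `z = α = ε`, `x₄ = x₁`, `x₃ = x₂`, `s₄ = ε s` up to sign,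
with `x₂' = Z / x₂`. -/
noncomputable def rFormulaSpecial (q : ℝ) (k r l : ℤ) (ε α' Z x₁ x₂ s : ℝ) : ℝ :=
  (if k = l then
      q * (x₂ / s) * iota s *
        theta (q ^ 2) [ε * α' * q ^ 2 * Z, ε * α' * q ^ 2 * (x₂ / (Z / x₂)), s ^ 2] *
        qInf (q ^ 2) [ε * q ^ 2 * (x₁ / x₂), q ^ 2]
    else 0) +
  V q k r l ε x₁ x₂ s * ε *
    theta (q ^ 2) [-(q * (x₂ * s)), -(ε * α' * q * (Z / x₂ * s)), -(q * (x₂ / s)),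
      -(ε * α' * q * (Z / x₂ / s))] *
    (q * (x₁ / s)) * iota s *
    (qInf (q ^ 2) [ε * q ^ 2 * (x₁ / x₂)] * (1 - ε * q ^ (2 * r) * (x₂ / x₁)) * (1 - s ^ 2) /
      (qInf (q ^ 2) [q ^ 2] * (1 - q ^ 2))) *
    q ^ (k + l) *
    √ (qFin (q ^ 2) [-(ε * q * (x₁ / s)), -(q ^ (2 * r + 1) * (x₂ * s))] k *
          qFin (q ^ 2) [-(ε * q * (x₁ * s)), -(q ^ (2 * r + 1) * (x₂ / s))] l /
        (qFin (q ^ 2) [-(ε * q * (x₁ * s)), -(q ^ (2 * r + 1) * (x₂ / s))] k *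
          qFin (q ^ 2) [-(ε * q * (x₁ / s)), -(q ^ (2 * r + 1) * (x₂ * s))] l))

end QIntertwiner

open QIntertwiner

/-! The sign ε enters only through εx₂, εx₄ and εs₄, apart from an overall factor ε^(k+r)
(`rElt_sign`), so it suffices to treat z = 1 with x₂, x₄ allowed to be negative. Put u₁ =
αq^(2l+1)x₁, u₂ = αq^(2(l+r)+1)x₂, u₃ = q^(2(k+r)+1)x₃, u₄ = q^(2k+1)x₄; then u₂u₄ = u₁u₃, and the
base is p = q².

The solution r is a difference of two terms, containing R at s₄ = s and at s₄ = 1/s. At s₄ = s the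
factor (s₄/s₃)_∞ kills T₁ and the series in T₂ collapses to 1. At s₄ = 1/s each ₄φ₃ loses a pair of
equal parameters, and the two remaining balanced ₃φ₂ are exactly those combined in the
nonterminating q-Saalschütz formula. So both values of R are products of the same shape (`R_diag`,
`R_antidiag`).

After the square roots are collected (`sqrt_combination_left`, `sqrt_combination_right`), r is a
common factor containing 1/(1 − u₁/u₄) times X/W − Y, where X and Y are theta products and W is
`wSq`. Write X/W − Y = (X − Y) + X(1/W − 1). The addition formula turns X − Y into one theta product
containing θ(αx₁/x₄). The Saalschütz formula with the term of index 0 split off writes 1/W − 1 as an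
elementary multiple of (1 − u₁/u₄)(1 − u₁/u₂)(1 − s⁻²) times `vReg`. In both parts the pole at u₁ =
u₄ cancels. The resulting expression `rReg` is continuous at every admissible point, so it is the
continuous extension of r (`hasValue_rReg`).

The Saalschütz formula (`saalPair_eq`) is proved in a form without denominators: a telescoping
contiguous relation multiplies the first parameter by p, iteration sends it to 0, and symmetry in
the three parameters reduces everything to an elementary case. The theta addition formula follows by
eliminating the series from three instances of it.

Up to an elementary factor, v is `vReg` (`Adm.v_eq_vReg`), which gives (1). In (2) one has u₁/u₄ =
q^(2(l−k)). For k > l the factor (q²u₁/u₄)_∞ = 0 removes one of the two series in `vReg` and the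
other terminates; k < l is reduced to this by `vReg_inv`; for k = l the function is v itself. -/

namespace QIntertwiner

/-! ### Shifted factorials -/

/-- The shifted factorial `(a; p)_n` for `n : ℕ`. -/
noncomputable def qFac (p a : ℝ) (n : ℕ) : ℝ := ∏ i ∈ Finset.range n, (1 - a * p ^ i)

section Basic

variable {p : ℝ}

theorem summable_mul_pow (hp0 : 0 < p) (hp1 : p < 1) (a : ℝ) :
    Summable fun n : ℕ => a * p ^ n :=
  (summable_geometric_of_lt_one hp0.le hp1).mul_left a

theorem summable_norm_neg_mul_pow (hp0 : 0 < p) (hp1 : p < 1) (a : ℝ) :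
    Summable fun n : ℕ => ‖-(a * p ^ n)‖ :=
  (summable_mul_pow hp0 hp1 a).neg.norm

theorem multipliable_qInf1 (hp0 : 0 < p) (hp1 : p < 1) (a : ℝ) :
    Multipliable fun n : ℕ => 1 - a * p ^ n := by
  have := multipliable_one_add_of_summable (summable_norm_neg_mul_pow hp0 hp1 a)
  simpa only [sub_eq_add_neg] using this

theorem qFac_zero (a : ℝ) : qFac p a 0 = 1 := by simp [qFac]

theorem qFac_succ (a : ℝ) (n : ℕ) : qFac p a (n + 1) = qFac p a n * (1 - a * p ^ n) := by
  simp [qFac, Finset.prod_range_succ]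

theorem qFac_succ' (a : ℝ) (n : ℕ) : qFac p a (n + 1) = (1 - a) * qFac p (a * p) n := by
  simp only [qFac, Finset.prod_range_succ', pow_zero, mul_one]
  rw [mul_comm]
  congr 1
  exact Finset.prod_congr rfl fun i _ => by rw [pow_succ]; ring

theorem qFac_mul_qInf1 (hp0 : 0 < p) (hp1 : p < 1) (a : ℝ) (n : ℕ) :
    qFac p a n * qInf1 p (a * p ^ n) = qInf1 p a := by
  have h : (fun i : ℕ => 1 - a * p ^ n * p ^ i) = fun i => 1 - a * p ^ (i + n) := by
    ext i; rw [pow_add]; ring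
  have hm := multipliable_qInf1 hp0 hp1 (a * p ^ n)
  rw [h] at hm
  unfold qFac qInf1
  rw [h]
  exact Multipliable.prod_mul_tprod_nat_mul' (f := fun i => 1 - a * p ^ i) hm

theorem qInf1_succ (hp0 : 0 < p) (hp1 : p < 1) (a : ℝ) :
    qInf1 p a = (1 - a) * qInf1 p (a * p) := by
  rw [← qFac_mul_qInf1 hp0 hp1 a 1]
  simp [qFac]

theorem qInf1_zero : qInf1 p 0 = 1 := by simp [qInf1]

theorem qInf1_one (hp0 : 0 < p) (hp1 : p < 1) : qInf1 p 1 = 0 := by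
  rw [qInf1_succ hp0 hp1]; simp

theorem qInf1_ne_zero (hp0 : 0 < p) (hp1 : p < 1) {a : ℝ} (h : ∀ n : ℕ, a * p ^ n ≠ 1) :
    qInf1 p a ≠ 0 := by
  have := tprod_one_add_ne_zero_of_summable (f := fun n : ℕ => -(a * p ^ n))
    (fun n hn => h n (by linarith)) (summable_norm_neg_mul_pow hp0 hp1 a)
  simpa only [qInf1, sub_eq_add_neg] using this

theorem qInf1_eq_zero (hp0 : 0 < p) (hp1 : p < 1) {a : ℝ} (n : ℕ) (h : a * p ^ n = 1) :
    qInf1 p a = 0 := by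
  rw [← qFac_mul_qInf1 hp0 hp1 a n, h, qInf1_one hp0 hp1, mul_zero]

theorem qInf1_self_ne_zero (hp0 : 0 < p) (hp1 : p < 1) : qInf1 p p ≠ 0 :=
  qInf1_ne_zero hp0 hp1 fun n => by
    rw [← pow_succ']; exact (pow_lt_one₀ hp0.le hp1 (by simp)).ne

theorem tendsto_qFac (hp0 : 0 < p) (hp1 : p < 1) (a : ℝ) :
    Tendsto (qFac p a) atTop (𝓝 (qInf1 p a)) :=
  (multipliable_qInf1 hp0 hp1 a).hasProd.tendsto_prod_nat

theorem continuous_qInf1 (hp0 : 0 < p) (hp1 : p < 1) : Continuous (qInf1 p) := by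
  rw [continuous_iff_continuousAt]
  intro a
  have key := tendsto_tprod_one_add_of_dominated_convergence (𝓕 := 𝓝 a)
    (f := fun x (n : ℕ) => -(x * p ^ n)) (g := fun n => -(a * p ^ n))
    (bound := fun n => (|a| + 1) * p ^ n) (summable_mul_pow hp0 hp1 _)
    (fun n => by
      have : Continuous fun x : ℝ => -(x * p ^ n) := by fun_prop
      exact this.tendsto a)
    (by
      have hc : Continuous fun x : ℝ => |x| := continuous_abs
      filter_upwards [(hc.tendsto a).eventually_le_const (by linarith : |a| < |a| + 1)]
        with x hx n
      rw [norm_neg, norm_mul, Real.norm_eq_abs, norm_pow, Real.norm_of_nonneg hp0.le]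
      gcongr)
  simp only [← sub_eq_add_neg] at key
  exact key

/-- Each factor is at most 1 + M pⁱ ≤ exp(M pⁱ), and the exponents sum to a geometric series. The
bound does not depend on n, which makes dominated convergence possible below. -/
theorem abs_qFac_le (hp0 : 0 < p) (hp1 : p < 1) {a M : ℝ} (h : |a| ≤ M) (n : ℕ) :
    |qFac p a n| ≤ Real.exp (M / (1 - p)) := by
  have hM : 0 ≤ M := (abs_nonneg a).trans h
  have h1 : |qFac p a n| ≤ ∏ i ∈ Finset.range n, (1 + M * p ^ i) := by
    rw [qFac, Finset.abs_prod]
    refine Finset.prod_le_prod (fun i _ => abs_nonneg _) fun i _ => ?_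
    refine (abs_sub _ _).trans ?_
    rw [abs_one, abs_mul, abs_pow, abs_of_pos hp0]
    gcongr
  refine h1.trans ((Real.prod_one_add_le_exp_sum _ fun i => by positivity).trans ?_)
  refine Real.exp_le_exp.2 ?_
  rw [div_eq_mul_inv, ← tsum_geometric_of_lt_one hp0.le hp1, ← tsum_mul_left]
  exact (summable_mul_pow hp0 hp1 M).sum_le_tsum _ fun i _ => by positivity

theorem abs_qInf1_le (hp0 : 0 < p) (hp1 : p < 1) {a M : ℝ} (h : |a| ≤ M) :
    |qInf1 p a| ≤ Real.exp (M / (1 - p)) :=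
  le_of_tendsto (tendsto_qFac hp0 hp1 a).abs (Eventually.of_forall (abs_qFac_le hp0 hp1 h))

theorem tendsto_mul_pow_zero (hp0 : 0 < p) (hp1 : p < 1) (a : ℝ) :
    Tendsto (fun n : ℕ => a * p ^ n) atTop (𝓝 0) := by
  simpa using (tendsto_pow_atTop_nhds_zero_of_lt_one hp0.le hp1).const_mul a

theorem tendsto_qInf1_mul_pow (hp0 : 0 < p) (hp1 : p < 1) (a : ℝ) :
    Tendsto (fun n : ℕ => qInf1 p (a * p ^ n)) atTop (𝓝 1) := by
  have := ((continuous_qInf1 hp0 hp1).tendsto 0).comp (tendsto_mul_pow_zero hp0 hp1 a)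
  rwa [qInf1_zero] at this

/-! ### Regularized balanced series -/

/-- The terms of `balSeries`. -/
noncomputable def balTerm (p A B C D E F : ℝ) (n : ℕ) : ℝ :=
  p ^ n * (qFac p A n * qFac p B n * qFac p C n) *
    (qInf1 p (D * p ^ n) * qInf1 p (E * p ^ n) * qInf1 p (F * p ^ n))

/-- The series `∑ (A, B, C; p)_n (D pⁿ, E pⁿ, F pⁿ; p)_∞ pⁿ`; for `F = p` it is
`(D, E, p; p)_∞` times the `₃φ₂`-series with argument `p`. -/
noncomputable def balSeries (p A B C D E F : ℝ) : ℝ := ∑' n, balTerm p A B C D E F n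

/-- The six shifted factorials are bounded by the same exponential, uniformly for parameters in a
box; the factor pⁿ is left as geometric majorant. -/
theorem norm_balTerm_le (hp0 : 0 < p) (hp1 : p < 1) {A B C D E F M : ℝ} (hA : |A| ≤ M)
    (hB : |B| ≤ M) (hC : |C| ≤ M) (hD : |D| ≤ M) (hE : |E| ≤ M) (hF : |F| ≤ M) (n : ℕ) :
    ‖balTerm p A B C D E F n‖ ≤ Real.exp (M / (1 - p)) ^ 6 * p ^ n := by
  have hp : ∀ x : ℝ, |x| ≤ M → |x * p ^ n| ≤ M := fun x hx => by
    rw [abs_mul, abs_pow, abs_of_pos hp0]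
    exact (mul_le_of_le_one_right (abs_nonneg x) (pow_le_one₀ hp0.le hp1.le)).trans hx
  have hK : 0 ≤ Real.exp (M / (1 - p)) := (Real.exp_pos _).le
  rw [Real.norm_eq_abs, balTerm]
  simp only [abs_mul, abs_pow, abs_of_pos hp0]
  calc p ^ n * (|qFac p A n| * |qFac p B n| * |qFac p C n|) *
        (|qInf1 p (D * p ^ n)| * |qInf1 p (E * p ^ n)| * |qInf1 p (F * p ^ n)|)
      ≤ p ^ n * (Real.exp (M / (1 - p)) * Real.exp (M / (1 - p)) * Real.exp (M / (1 - p))) *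
        (Real.exp (M / (1 - p)) * Real.exp (M / (1 - p)) * Real.exp (M / (1 - p))) := by
        gcongr
        · exact abs_qFac_le hp0 hp1 hA n
        · exact abs_qFac_le hp0 hp1 hB n
        · exact abs_qFac_le hp0 hp1 hC n
        · exact abs_qInf1_le hp0 hp1 (hp D hD)
        · exact abs_qInf1_le hp0 hp1 (hp E hE)
        · exact abs_qInf1_le hp0 hp1 (hp F hF)
    _ = _ := by ring

theorem summable_balTerm (hp0 : 0 < p) (hp1 : p < 1) (A B C D E F : ℝ) :
    Summable (balTerm p A B C D E F) := by
  set M := |A| + |B| + |C| + |D| + |E| + |F|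
  have := abs_nonneg A
  have := abs_nonneg B
  have := abs_nonneg C
  have := abs_nonneg D
  have := abs_nonneg E
  have := abs_nonneg F
  exact (summable_mul_pow hp0 hp1 (Real.exp (M / (1 - p)) ^ 6)).of_norm_bounded
    (norm_balTerm_le hp0 hp1 (by simp only [M]; linarith) (by simp only [M]; linarith)
      (by simp only [M]; linarith) (by simp only [M]; linarith) (by simp only [M]; linarith)
      (by simp only [M]; linarith))

theorem tendsto_qFac_param {X : Type*} {l : Filter X} {f : X → ℝ} {a : ℝ}
    (h : Tendsto f l (𝓝 a)) (n : ℕ) : Tendsto (fun x => qFac p (f x) n) l (𝓝 (qFac p a n)) := by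
  unfold qFac
  exact tendsto_finsetProd _ fun i _ => (h.mul_const _).const_sub 1

/-- Dominated convergence with the majorant from `norm_balTerm_le`. The series has no denominators,
so no parameter values need to be excluded. -/
theorem tendsto_balSeries (hp0 : 0 < p) (hp1 : p < 1) {X : Type*} {l : Filter X}
    {fA fB fC fD fE fF : X → ℝ} {A B C D E F : ℝ} (hA : Tendsto fA l (𝓝 A))
    (hB : Tendsto fB l (𝓝 B)) (hC : Tendsto fC l (𝓝 C)) (hD : Tendsto fD l (𝓝 D))
    (hE : Tendsto fE l (𝓝 E)) (hF : Tendsto fF l (𝓝 F)) :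
    Tendsto (fun x => balSeries p (fA x) (fB x) (fC x) (fD x) (fE x) (fF x)) l
      (𝓝 (balSeries p A B C D E F)) := by
  set M := |A| + |B| + |C| + |D| + |E| + |F| + 1 with hM
  have := abs_nonneg A
  have := abs_nonneg B
  have := abs_nonneg C
  have := abs_nonneg D
  have := abs_nonneg E
  have := abs_nonneg F
  have hq := continuous_qInf1 hp0 hp1
  refine tendsto_tsum_of_dominated_convergence
    (bound := fun n => Real.exp (M / (1 - p)) ^ 6 * p ^ n) (summable_mul_pow hp0 hp1 _) ?_ ?_
  · intro n
    unfold balTerm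
    exact ((((tendsto_qFac_param hA n).mul (tendsto_qFac_param hB n)).mul
      (tendsto_qFac_param hC n)).const_mul _).mul
      ((((hq.tendsto _).comp (hD.mul_const _)).mul ((hq.tendsto _).comp (hE.mul_const _))).mul
        ((hq.tendsto _).comp (hF.mul_const _)))
  · filter_upwards [hA.abs.eventually_le_const (by linarith : |A| < M),
      hB.abs.eventually_le_const (by linarith : |B| < M),
      hC.abs.eventually_le_const (by linarith : |C| < M),
      hD.abs.eventually_le_const (by linarith : |D| < M),
      hE.abs.eventually_le_const (by linarith : |E| < M),
      hF.abs.eventually_le_const (by linarith : |F| < M)] with x h1 h2 h3 h4 h5 h6 n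
    exact norm_balTerm_le hp0 hp1 h1 h2 h3 h4 h5 h6 n

theorem balSeries_swap_numer₁₂ (A B C D E F : ℝ) :
    balSeries p A B C D E F = balSeries p B A C D E F :=
  tsum_congr fun n => by unfold balTerm; ring

theorem balSeries_swap_numer₁₃ (A B C D E F : ℝ) :
    balSeries p A B C D E F = balSeries p C B A D E F :=
  tsum_congr fun n => by unfold balTerm; ring

theorem balSeries_swap_denom (A B C D E F : ℝ) :
    balSeries p A B C D E F = balSeries p A B C E D F :=
  tsum_congr fun n => by unfold balTerm; ring

/-- Splitting off the term of index 0. For F = p the tail has last parameter p², the shape of the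
₄φ₃-series with parameters q², q⁴ in v and t. -/
theorem balSeries_eq_first_add (hp0 : 0 < p) (hp1 : p < 1) (A B C D E F : ℝ) :
    balSeries p A B C D E F = qInf1 p D * qInf1 p E * qInf1 p F +
      p * ((1 - A) * (1 - B) * (1 - C)) *
        balSeries p (A * p) (B * p) (C * p) (D * p) (E * p) (F * p) := by
  unfold balSeries
  rw [(summable_balTerm hp0 hp1 A B C D E F).tsum_eq_zero_add, ← tsum_mul_left]
  congr 1
  · simp [balTerm, qFac_zero]
  · refine tsum_congr fun n => ?_
    simp only [balTerm, qFac_succ', pow_succ', mul_assoc]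
    ring

/-! ### The nonterminating Saalschütz summation -/

/-- Contiguous relation for the balanced series, by telescoping. -/
theorem balSeries_contiguous (hp0 : 0 < p) (hp1 : p < 1) (A B C : ℝ) {D : ℝ} (hD : D ≠ 0) :
    (1 - A * p / D) * balSeries p A B C D (A * B * C * p / D) p -
      (1 - A * C * p / D) * (1 - A * B * p / D) *
        balSeries p (A * p) B C D (A * B * C * p / D * p) p =
      -(p * A / D) * (qInf1 p (A * p) * qInf1 p B * qInf1 p C) := by
  set E := A * B * C * p / D with hE
  -- Telescoping certificate: the partial sum of `w` through index N is −g N. As N → ∞ the factors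
  -- (x pᴺ)_∞ tend to 1, and −g N tends to the boundary term on the right.
  set g : ℕ → ℝ := fun m => p * A / D * (qFac p (A * p) m * qFac p B (m + 1) *
    qFac p C (m + 1)) * (qInf1 p (D * p ^ m) * qInf1 p (p * p ^ m) * qInf1 p (E * p * p ^ m))
    with hg
  set w : ℕ → ℝ := fun n => (1 - A * p / D) * balTerm p A B C D E p n -
    (1 - A * C * p / D) * (1 - A * B * p / D) * balTerm p (A * p) B C D (E * p) p n with hw
  have hs : Summable w := ((summable_balTerm hp0 hp1 A B C D E p).mul_left _).sub
    ((summable_balTerm hp0 hp1 (A * p) B C D (E * p) p).mul_left _)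
  have hsum : ∀ N, ∑ n ∈ Finset.range (N + 1), w n = -g N := by
    intro N
    induction N with
    | zero =>
      have h1 := qInf1_succ hp0 hp1 E
      simp only [hw, hg, balTerm, qFac_zero, qFac_succ, Finset.sum_range_one, pow_zero, mul_one,
        zero_add, h1, one_mul]
      rw [hE]
      field_simp
      ring
    | succ m ih =>
      rw [Finset.sum_range_succ, ih]
      have h1 : qInf1 p (E * p ^ (m + 1)) = (1 - E * p ^ (m + 1)) * qInf1 p (E * p * p ^ (m + 1)) := by
        rw [qInf1_succ hp0 hp1, mul_right_comm]
      have h2 : qInf1 p (D * p ^ m) = (1 - D * p ^ m) * qInf1 p (D * p ^ (m + 1)) := by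
        rw [qInf1_succ hp0 hp1 (D * p ^ m), pow_succ, mul_assoc]
      have h3 : qInf1 p (p * p ^ m) = (1 - p * p ^ m) * qInf1 p (p * p ^ (m + 1)) := by
        rw [qInf1_succ hp0 hp1 (p * p ^ m), pow_succ, mul_assoc p]
      have h4 : qInf1 p (E * p * p ^ m) = qInf1 p (E * p ^ (m + 1)) := by
        rw [pow_succ]; ring_nf
      have h5 : qFac p A (m + 1) = (1 - A) * qFac p (A * p) m := qFac_succ' A m
      simp only [hw, hg, balTerm, h5, h2, h3, h4, h1]
      simp only [qFac_succ, pow_succ]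
      have hE' : E * D = A * B * C * p := by rw [hE]; field_simp
      generalize qInf1 p (D * (p ^ m * p)) = Q1
      generalize qInf1 p (p * (p ^ m * p)) = Q2
      generalize qInf1 p (E * p * (p ^ m * p)) = Q3
      generalize qFac p (A * p) m = F1
      generalize qFac p B m = F2
      generalize qFac p C m = F3
      rw [hE]
      field_simp
      ring
  have hlim : Tendsto g atTop (𝓝 (p * A / D * (qInf1 p (A * p) * qInf1 p B * qInf1 p C) *
      (1 * 1 * 1))) := by
    have hB := (tendsto_qFac hp0 hp1 B).comp (tendsto_add_atTop_nat 1)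
    have hC := (tendsto_qFac hp0 hp1 C).comp (tendsto_add_atTop_nat 1)
    exact ((((tendsto_qFac hp0 hp1 (A * p)).mul hB).mul hC).const_mul _).mul
      (((tendsto_qInf1_mul_pow hp0 hp1 D).mul (tendsto_qInf1_mul_pow hp0 hp1 p)).mul
        (tendsto_qInf1_mul_pow hp0 hp1 (E * p)))
  have h1 : Tendsto (fun N => ∑ n ∈ Finset.range (N + 1), w n) atTop (𝓝 (∑' n, w n)) :=
    hs.hasSum.tendsto_sum_nat.comp (tendsto_add_atTop_nat 1)
  have h2 := tendsto_nhds_unique h1 ((hlim.neg).congr fun N => (hsum N).symm)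
  rw [hw, ((summable_balTerm hp0 hp1 A B C D E p).mul_left _).tsum_sub
    ((summable_balTerm hp0 hp1 (A * p) B C D (E * p) p).mul_left _), tsum_mul_left,
    tsum_mul_left] at h2
  unfold balSeries
  rw [h2]
  ring

/-- The combination of two balanced series that is summed by `saalPair_eq`. -/
noncomputable def saalPair (p A B C D : ℝ) : ℝ :=
  balSeries p A B C D (A * B * C * p / D) p *
      (qInf1 p (A * p / D) * qInf1 p (B * p / D) * qInf1 p (C * p / D)) -
    p / D * balSeries p (A * p / D) (B * p / D) (C * p / D) (p ^ 2 / D)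
        (A * B * C * p ^ 2 / D ^ 2) p *
      (qInf1 p A * qInf1 p B * qInf1 p C)

theorem saalPair_swap₁₂ (A B C D : ℝ) : saalPair p A B C D = saalPair p B A C D := by
  unfold saalPair
  rw [balSeries_swap_numer₁₂ A, balSeries_swap_numer₁₂ (A * p / D)]
  ring_nf

theorem saalPair_swap₁₃ (A B C D : ℝ) : saalPair p A B C D = saalPair p C B A D := by
  unfold saalPair
  rw [balSeries_swap_numer₁₃ A, balSeries_swap_numer₁₃ (A * p / D)]
  ring_nf

/-- The contiguous relation applies to both series, since the companion parameters (Ap/D, Bp/D,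
Cp/D, p²/D) have the same coefficient product (1 − ACp/D)(1 − ABp/D). The two boundary terms cancel
in the difference. -/
theorem saalPair_succ (hp0 : 0 < p) (hp1 : p < 1) (A B C : ℝ) {D : ℝ} (hD : D ≠ 0) :
    saalPair p A B C D =
      (1 - A * C * p / D) * (1 - A * B * p / D) * saalPair p (A * p) B C D := by
  have h1 := balSeries_contiguous hp0 hp1 A B C hD
  have h2 := balSeries_contiguous hp0 hp1 (A * p / D) (B * p / D) (C * p / D)
    (D := p ^ 2 / D) (by positivity)
  have e1 : A * p / D * p / (p ^ 2 / D) = A := by field_simp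
  have e2 : A * p / D * (B * p / D) * (C * p / D) * p / (p ^ 2 / D) =
    A * B * C * p ^ 2 / D ^ 2 := by field_simp
  have e3 : A * p / D * (C * p / D) * p / (p ^ 2 / D) = A * C * p / D := by field_simp
  have e4 : A * p / D * (B * p / D) * p / (p ^ 2 / D) = A * B * p / D := by field_simp
  have e5 : p * (A * p / D) / (p ^ 2 / D) = A := by field_simp
  rw [e1, e2, e3, e4, e5] at h2
  have e6 : A * p * B * C * p / D = A * B * C * p / D * p := by ring
  have e7 : A * p * B * C * p ^ 2 / D ^ 2 = A * B * C * p ^ 2 / D ^ 2 * p := by ring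
  have e8 : A * p * p / D = A * p / D * p := by ring
  unfold saalPair
  rw [qInf1_succ hp0 hp1 (A * p / D), qInf1_succ hp0 hp1 A, e6, e7, e8]
  linear_combination (qInf1 p (A * p / D * p) * qInf1 p (B * p / D) * qInf1 p (C * p / D)) * h1
    - (p / D) * (qInf1 p (A * p) * qInf1 p B * qInf1 p C) * h2

theorem saalPair_eq_mul_pow (hp0 : 0 < p) (hp1 : p < 1) (A B C : ℝ) {D : ℝ} (hD : D ≠ 0)
    (n : ℕ) : saalPair p A B C D =
      qFac p (A * C * p / D) n * qFac p (A * B * p / D) n * saalPair p (A * p ^ n) B C D := by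
  induction n with
  | zero => simp [qFac_zero]
  | succ n ih =>
    rw [ih, saalPair_succ hp0 hp1 (A * p ^ n) B C hD, qFac_succ, qFac_succ, pow_succ]
    ring_nf

/-- Iterate `saalPair_succ` and let n → ∞; continuity in the parameters allows A pⁿ to be replaced
by its limit 0. -/
theorem saalPair_eq_zero_param (hp0 : 0 < p) (hp1 : p < 1) (A B C : ℝ) {D : ℝ} (hD : D ≠ 0) :
    saalPair p A B C D =
      qInf1 p (A * C * p / D) * qInf1 p (A * B * p / D) * saalPair p 0 B C D := by
  have hA : Tendsto (fun n : ℕ => A * p ^ n) atTop (𝓝 0) := tendsto_mul_pow_zero hp0 hp1 A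
  have hc : ∀ x : ℝ, Tendsto (fun _ : ℕ => x) atTop (𝓝 x) := fun x => tendsto_const_nhds
  have hq := continuous_qInf1 hp0 hp1
  have h : Tendsto (fun n : ℕ => saalPair p (A * p ^ n) B C D) atTop
      (𝓝 (saalPair p 0 B C D)) := by
    have hA' := (hA.mul_const p).div_const D
    unfold saalPair
    exact ((tendsto_balSeries hp0 hp1 hA (hc B) (hc C) (hc D)
      ((((hA.mul_const B).mul_const C).mul_const p).div_const D) (hc p)).mul
        ((((hq.tendsto _).comp hA').mul_const _).mul_const _)).sub
      (((tendsto_balSeries hp0 hp1 hA' (hc _) (hc _) (hc _)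
        ((((hA.mul_const B).mul_const C).mul_const (p ^ 2)).div_const (D ^ 2)) (hc p)).const_mul
          _).mul ((((hq.tendsto _).comp hA).mul_const _).mul_const _))
  have h2 := ((tendsto_qFac hp0 hp1 (A * C * p / D)).mul
    (tendsto_qFac hp0 hp1 (A * B * p / D))).mul h
  exact tendsto_nhds_unique tendsto_const_nhds
    (h2.congr fun n => (saalPair_eq_mul_pow hp0 hp1 A B C hD n).symm)

/-- The sum telescopes, because y pⁿ (y pⁿ⁺¹)_∞ = (y pⁿ⁺¹)_∞ − (y pⁿ)_∞. -/
theorem tsum_pow_mul_qInf1 (hp0 : 0 < p) (hp1 : p < 1) (y : ℝ) :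
    y * ∑' n : ℕ, p ^ n * qInf1 p (y * p * p ^ n) = 1 - qInf1 p y := by
  have hs : Summable fun n : ℕ => p ^ n * qInf1 p (y * p * p ^ n) := by
    refine (summable_balTerm hp0 hp1 0 0 0 (y * p) 0 0).congr fun n => ?_
    simp [balTerm, qFac, qInf1_zero]
  have hsum : ∀ N, ∑ n ∈ Finset.range N, y * (p ^ n * qInf1 p (y * p * p ^ n)) =
      qInf1 p (y * p ^ N) - qInf1 p y := by
    intro N
    induction N with
    | zero => simp
    | succ N ih =>
      have h := qInf1_succ hp0 hp1 (y * p ^ N)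
      have e1 : y * p ^ N * p = y * p * p ^ N := by ring
      have e2 : y * p ^ (N + 1) = y * p * p ^ N := by ring
      rw [Finset.sum_range_succ, ih, h, e1, e2]
      ring
  rw [← tsum_mul_left]
  refine tendsto_nhds_unique (hs.mul_left y).hasSum.tendsto_sum_nat ?_
  simp only [hsum]
  exact (tendsto_qInf1_mul_pow hp0 hp1 y).sub_const _

/-- For A = B = 0 and C = D the products (D)_n (D pⁿ)_∞ recombine to the constant (D)_∞; the
companion series has (p)_n (pⁿ⁺¹)_∞ = (p)_∞ in the same way. Both sums are then of the telescoping
type above. -/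
theorem saalPair_base (hp0 : 0 < p) (hp1 : p < 1) {D : ℝ} (hD : D ≠ 0) :
    saalPair p 0 0 D D = qInf1 p p * qInf1 p D * qInf1 p (p / D) := by
  have h1 : balSeries p 0 0 D D 0 p = qInf1 p D := by
    have h := tsum_pow_mul_qInf1 hp0 hp1 1
    rw [qInf1_one hp0 hp1, sub_zero, one_mul] at h
    rw [← mul_one (qInf1 p D), ← h, ← tsum_mul_left]
    refine tsum_congr fun n => ?_
    rw [balTerm, ← qFac_mul_qInf1 hp0 hp1 D n]
    simp only [zero_mul, qInf1_zero, qFac, sub_zero, Finset.prod_const_one, one_mul]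
    ring
  have h2 : p / D * balSeries p 0 0 p (p ^ 2 / D) 0 p = qInf1 p p * (1 - qInf1 p (p / D)) := by
    rw [← tsum_pow_mul_qInf1 hp0 hp1 (p / D), mul_left_comm]
    congr 1
    unfold balSeries
    rw [← tsum_mul_left]
    refine tsum_congr fun n => ?_
    have e : p / D * p = p ^ 2 / D := by ring
    rw [balTerm, ← qFac_mul_qInf1 hp0 hp1 p n, e]
    simp only [zero_mul, qInf1_zero, qFac, sub_zero, Finset.prod_const_one, one_mul]
    ring
  have e : D * p / D = p := by field_simp
  unfold saalPair
  simp only [zero_mul, zero_div, qInf1_zero, e, h1, h2]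
  ring

/-- The nonterminating `q`-Saalschütz summation, free of denominators. -/
theorem saalPair_eq (hp0 : 0 < p) (hp1 : p < 1) (A B C : ℝ) {D : ℝ} (hD : D ≠ 0) :
    saalPair p A B C D = qInf1 p p * qInf1 p D * qInf1 p (p / D) *
      (qInf1 p (B * C * p / D) * qInf1 p (A * C * p / D) * qInf1 p (A * B * p / D)) := by
  -- With two parameters zero the third is irrelevant: moved to the first place, it produces only
  -- the factors (0)_∞ = 1. So it may be chosen equal to D.
  have h0 : ∀ X : ℝ, saalPair p 0 0 X D = saalPair p 0 0 0 D := fun X => by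
    rw [saalPair_swap₁₃, saalPair_eq_zero_param hp0 hp1 X 0 0 hD]
    simp [qInf1_zero]
  rw [saalPair_eq_zero_param hp0 hp1 A B C hD, saalPair_swap₁₂ 0 B,
    saalPair_eq_zero_param hp0 hp1 B 0 C hD, h0, ← h0 D, saalPair_base hp0 hp1 hD]
  simp only [mul_zero, zero_mul, zero_div, qInf1_zero]
  ring

end Basic

section Basic

variable {p : ℝ}

/-! ### Theta functions -/

/-- The theta function `θ(x) = (x, p / x; p)_∞` of one argument. -/
noncomputable def theta1 (p x : ℝ) : ℝ := qInf1 p x * qInf1 p (p / x)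

theorem theta_nil : theta p [] = 1 := by simp [theta]

theorem theta_cons (x : ℝ) (xs : List ℝ) : theta p (x :: xs) = theta1 p x * theta p xs := by
  simp [theta, theta1, qInf, div_eq_inv_mul]

theorem qInf_nil : qInf p [] = 1 := by simp [qInf]

theorem qInf_cons (x : ℝ) (xs : List ℝ) : qInf p (x :: xs) = qInf1 p x * qInf p xs := by
  simp [qInf]

theorem theta1_div_self (hp0 : 0 < p) (x : ℝ) : theta1 p (p / x) = theta1 p x := by
  rw [theta1, theta1, mul_comm, div_div_cancel₀ hp0.ne']

theorem theta1_mul_self (hp0 : 0 < p) (hp1 : p < 1) {x : ℝ} (hx : x ≠ 0) :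
    theta1 p (x * p) = -x⁻¹ * theta1 p x := by
  have e : p / (x * p) = x⁻¹ := by field_simp
  have e2 : x⁻¹ * p = p / x := by ring
  rw [theta1, theta1, qInf1_succ hp0 hp1 x, e, qInf1_succ hp0 hp1 x⁻¹, e2]
  field_simp
  ring

theorem theta1_inv (hp0 : 0 < p) (hp1 : p < 1) {x : ℝ} (hx : x ≠ 0) :
    theta1 p x⁻¹ = -x⁻¹ * theta1 p x := by
  rw [← theta1_mul_self hp0 hp1 hx, ← theta1_div_self hp0 (x * p)]
  congr 1
  field_simp

/-- The difference of two series that is summed by the Saalschütz formula, in symmetric form. -/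
theorem saalPair_symm (hp0 : 0 < p) (hp1 : p < 1) {a b g d e f : ℝ} (ha : a ≠ 0) (hb : b ≠ 0)
    (hg : g ≠ 0) (hd : d ≠ 0) (he : e ≠ 0) (hf : f ≠ 0) (h : a * b * g * (d * e * f) = p) :
    b * balSeries p (b * d) (b * e) (b * f) (b * p / a) (b * p / g) p *
        (qInf1 p (a * d) * qInf1 p (a * e) * qInf1 p (a * f)) -
      a * balSeries p (a * d) (a * e) (a * f) (a * p / b) (a * p / g) p *
        (qInf1 p (b * d) * qInf1 p (b * e) * qInf1 p (b * f)) =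
      qInf1 p p * (b * theta1 p (a / b)) *
        (qInf1 p (p / (g * d)) * qInf1 p (p / (g * e)) * qInf1 p (p / (g * f))) := by
  have hp := hp0.ne'
  have key := saalPair_eq hp0 hp1 (b * d) (b * e) (b * f) (D := b * p / a) (by positivity)
  unfold saalPair at key
  have e1 : b * d * (b * e) * (b * f) * p / (b * p / a) = b * p / g := by
    rw [← h]; field_simp
  have e2 : b * d * (b * e) * (b * f) * p ^ 2 / (b * p / a) ^ 2 = a * p / g := by
    rw [← h]; field_simp
  have e3 : ∀ x, b * x * p / (b * p / a) = a * x := fun x => by field_simp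
  have e4 : p ^ 2 / (b * p / a) = a * p / b := by field_simp
  have e5 : p / (b * p / a) = a / b := by field_simp
  have e6 : b * e * (b * f) * p / (b * p / a) = p / (g * d) := by rw [← h]; field_simp
  have e7 : b * d * (b * f) * p / (b * p / a) = p / (g * e) := by rw [← h]; field_simp
  have e8 : b * d * (b * e) * p / (b * p / a) = p / (g * f) := by rw [← h]; field_simp
  have e9 : p / (a / b) = b * p / a := by field_simp
  rw [e1, e2, e3, e3, e3, e4, e5, e6, e7, e8] at key
  rw [theta1, e9]
  have hab : b * (a / b) = a := by field_simp
  linear_combination b * key + (balSeries p (a * d) (a * e) (a * f) (a * p / b) (a * p / g) p *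
    (qInf1 p (b * d) * qInf1 p (b * e) * qInf1 p (b * f))) * hab

/-- The three-term relation (addition formula) for theta functions. -/
theorem theta1_three_term (hp0 : 0 < p) (hp1 : p < 1) {a b g d e f : ℝ} (ha : a ≠ 0)
    (hb : b ≠ 0) (hg : g ≠ 0) (hd : d ≠ 0) (he : e ≠ 0) (hf : f ≠ 0)
    (h : a * b * g * (d * e * f) = p) :
    b * theta1 p (a / b) * (theta1 p (g * d) * theta1 p (g * e) * theta1 p (g * f)) +
      g * theta1 p (b / g) * (theta1 p (a * d) * theta1 p (a * e) * theta1 p (a * f)) +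
      a * theta1 p (g / a) * (theta1 p (b * d) * theta1 p (b * e) * theta1 p (b * f)) = 0 := by
  have h1 := saalPair_symm hp0 hp1 ha hb hg hd he hf h
  have h2 := saalPair_symm hp0 hp1 hb hg ha hd he hf (by rw [← h]; ring)
  have h3 := saalPair_symm hp0 hp1 hg ha hb hd he hf (by rw [← h]; ring)
  -- The three identities contain only three different series, attached to a, b and g, each
  -- occurring twice; ordering the denominator parameters makes the two copies literally equal.
  rw [balSeries_swap_denom _ _ _ (b * p / g)] at h2
  rw [balSeries_swap_denom _ _ _ (a * p / g), balSeries_swap_denom _ _ _ (g * p / a)] at h3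
  refine mul_left_cancel₀ (qInf1_self_ne_zero hp0 hp1) ?_
  simp only [theta1] at h1 h2 h3 ⊢
  -- Multiplying each identity by the three products with the missing letter completes its right
  -- side to theta functions, and the series cancel cyclically.
  linear_combination
    (-(qInf1 p (g * d) * qInf1 p (g * e) * qInf1 p (g * f))) * h1 -
    (qInf1 p (a * d) * qInf1 p (a * e) * qInf1 p (a * f)) * h2 -
    (qInf1 p (b * d) * qInf1 p (b * e) * qInf1 p (b * f)) * h3

/-! ### Hypergeometric series -/

theorem qFin1_natCast (a : ℝ) (n : ℕ) : qFin1 p a n = qFac p a n := by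
  simp [qFin1, qFac]

theorem qFac_ne_zero {a : ℝ} (h : ∀ n : ℕ, a * p ^ n ≠ 1) (n : ℕ) : qFac p a n ≠ 0 :=
  Finset.prod_ne_zero_iff.2 fun i _ hi => h i (by linarith)

theorem self_mul_pow_ne_one (hp0 : 0 < p) (hp1 : p < 1) (n : ℕ) : p * p ^ n ≠ 1 := by
  rw [← pow_succ']; exact (pow_lt_one₀ hp0.le hp1 (by simp)).ne

theorem qFac_eq_div (hp0 : 0 < p) (hp1 : p < 1) {a : ℝ} (h : ∀ n : ℕ, a * p ^ n ≠ 1) (n : ℕ) :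
    (qFac p a n)⁻¹ = qInf1 p (a * p ^ n) / qInf1 p a := by
  have h1 := qFac_mul_qInf1 hp0 hp1 a n
  have h2 := qInf1_ne_zero hp0 hp1 h
  have h3 := qFac_ne_zero h n
  field_simp
  linarith

theorem phi_three_two (hp0 : 0 < p) (hp1 : p < 1) (A B C : ℝ) {D E : ℝ}
    (hD : ∀ n : ℕ, D * p ^ n ≠ 1) (hE : ∀ n : ℕ, E * p ^ n ≠ 1) :
    phi [A, B, C] [D, E] p p =
      balSeries p A B C D E p / (qInf1 p D * qInf1 p E * qInf1 p p) := by
  unfold phi balSeries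
  rw [← tsum_div_const]
  refine tsum_congr fun n => ?_
  have h1 := qFac_eq_div hp0 hp1 hD n
  have h2 := qFac_eq_div hp0 hp1 hE n
  have h3 := qFac_eq_div hp0 hp1 (self_mul_pow_ne_one hp0 hp1) n
  simp only [phiTerm, qFin, List.map_cons, List.map_nil, List.prod_cons, List.prod_nil,
    List.length_cons, List.length_nil, qFin1_natCast, balTerm, div_eq_mul_inv, mul_inv, h1, h2, h3]
  norm_num
  ring

theorem phi_cancel_last (A B C D E : ℝ) {X : ℝ} (hX : ∀ n : ℕ, X * p ^ n ≠ 1) :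
    phi [A, B, X, C] [D, E, X] p p = phi [A, B, C] [D, E] p p := by
  refine tsum_congr fun n => ?_
  have h := qFac_ne_zero hX n
  simp only [phiTerm, qFin, List.map_cons, List.map_nil, List.prod_cons, List.prod_nil,
    List.length_cons, List.length_nil, qFin1_natCast]
  norm_num
  rw [show qFac p A n * (qFac p B n * (qFac p X n * qFac p C n)) * p ^ n =
    qFac p A n * (qFac p B n * qFac p C n) * p ^ n * qFac p X n by ring,
    show qFac p p n * (qFac p D n * (qFac p E n * qFac p X n)) =
    qFac p p n * (qFac p D n * qFac p E n) * qFac p X n by ring, mul_div_mul_right _ _ h]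

theorem phi_cancel_middle (A B C D E : ℝ) {X : ℝ} (hX : ∀ n : ℕ, X * p ^ n ≠ 1) :
    phi [A, B, X, C] [D, X, E] p p = phi [A, B, C] [D, E] p p := by
  rw [← phi_cancel_last A B C D E hX]
  refine tsum_congr fun n => ?_
  simp only [phiTerm, qFin, List.map_cons, List.map_nil, List.prod_cons, List.prod_nil,
    List.length_cons, List.length_nil, qFin1_natCast]
  norm_num
  ring

/-- The numerator parameter p cancels the (p; p)_n of the denominator, so that p² takes over the
role of the last denominator parameter. -/
theorem phi_four_three_sq (hp0 : 0 < p) (hp1 : p < 1) (A B C : ℝ) {D E : ℝ}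
    (hD : ∀ n : ℕ, D * p ^ n ≠ 1) (hE : ∀ n : ℕ, E * p ^ n ≠ 1) :
    phi [A, B, C, p] [D, E, p ^ 2] p p =
      balSeries p A B C D E (p ^ 2) / (qInf1 p D * qInf1 p E * qInf1 p (p ^ 2)) := by
  unfold phi balSeries
  rw [← tsum_div_const]
  refine tsum_congr fun n => ?_
  have hp2 : ∀ n : ℕ, p ^ 2 * p ^ n ≠ 1 := fun n => by
    rw [← pow_add]; exact (pow_lt_one₀ hp0.le hp1 (by simp)).ne
  have h1 := qFac_eq_div hp0 hp1 hD n
  have h2 := qFac_eq_div hp0 hp1 hE n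
  have h3 := qFac_eq_div hp0 hp1 hp2 n
  have h4 := mul_inv_cancel₀ (qFac_ne_zero (self_mul_pow_ne_one hp0 hp1) n)
  simp only [phiTerm, qFin, List.map_cons, List.map_nil, List.prod_cons, List.prod_nil,
    List.length_cons, List.length_nil, qFin1_natCast, balTerm, div_eq_mul_inv, mul_inv, h1, h2, h3]
  norm_num
  linear_combination qFac p A n * qFac p B n * qFac p C n * p ^ n *
    (qInf1 p (D * p ^ n) * (qInf1 p D)⁻¹ * (qInf1 p (E * p ^ n) * (qInf1 p E)⁻¹) *
      (qInf1 p (p ^ 2 * p ^ n) * (qInf1 p (p ^ 2))⁻¹)) * h4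

/-- The nonterminating Saalschütz summation for `₃φ₂`-series. -/
theorem phi_saalschuetz (hp0 : 0 < p) (hp1 : p < 1) {A B C D E : ℝ} (hD0 : D ≠ 0)
    (hDE : D * E = A * B * C * p)
    (hD : ∀ n : ℤ, D ≠ p ^ n) (hE : ∀ n : ℕ, E * p ^ n ≠ 1)
    (hE' : ∀ n : ℕ, p * E / D * p ^ n ≠ 1)
    (hA' : ∀ n : ℕ, A * p / D * p ^ n ≠ 1) (hB' : ∀ n : ℕ, B * p / D * p ^ n ≠ 1)
    (hC' : ∀ n : ℕ, C * p / D * p ^ n ≠ 1) :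
    phi [A, B, C] [D, E] p p =
      qInf1 p (p / D) * (qInf1 p (B * C * p / D) * qInf1 p (A * C * p / D) *
        qInf1 p (A * B * p / D)) /
        (qInf1 p E * (qInf1 p (A * p / D) * qInf1 p (B * p / D) * qInf1 p (C * p / D))) +
      p / D * (qInf1 p A * qInf1 p B * qInf1 p C) * (qInf1 p (p * E / D) * qInf1 p (p ^ 2 / D)) /
        (qInf1 p D * qInf1 p E *
          (qInf1 p (A * p / D) * qInf1 p (B * p / D) * qInf1 p (C * p / D))) *
        phi [A * p / D, B * p / D, C * p / D] [p ^ 2 / D, p * E / D] p p := by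
  have hD1 : ∀ n : ℕ, D * p ^ n ≠ 1 := fun n h => hD (-n) (by
    rw [zpow_neg, zpow_natCast]; exact eq_inv_of_mul_eq_one_left h)
  have hD2 : ∀ n : ℕ, p ^ 2 / D * p ^ n ≠ 1 := fun n h => hD (n + 2) (by
    rw [zpow_add₀ hp0.ne', zpow_natCast]
    field_simp at h
    rw [← h]; norm_cast; ring)
  rw [phi_three_two hp0 hp1 A B C hD1 hE, phi_three_two hp0 hp1 _ _ _ hD2 hE']
  have key := saalPair_eq hp0 hp1 A B C hD0
  unfold saalPair at key
  have e1 : A * B * C * p / D = E := by rw [← hDE]; field_simp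
  have e2 : A * B * C * p ^ 2 / D ^ 2 = p * E / D := by
    rw [pow_two, ← mul_assoc, ← hDE]; field_simp
  rw [e1, e2] at key
  have n1 := qInf1_ne_zero hp0 hp1 hD1
  have n2 := qInf1_ne_zero hp0 hp1 hE
  have n3 := qInf1_ne_zero hp0 hp1 hE'
  have n4 := qInf1_ne_zero hp0 hp1 hA'
  have n5 := qInf1_ne_zero hp0 hp1 hB'
  have n6 := qInf1_ne_zero hp0 hp1 hC'
  have n7 := qInf1_ne_zero hp0 hp1 hD2
  have n8 := qInf1_self_ne_zero hp0 hp1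
  generalize qInf1 p (A * p / D) = a' at *
  generalize qInf1 p (B * p / D) = b' at *
  generalize qInf1 p (C * p / D) = c' at *
  generalize qInf1 p (p ^ 2 / D) = d2 at *
  generalize qInf1 p (p * E / D) = e2 at *
  generalize balSeries p A B C D E p = S1 at *
  generalize balSeries p (A * p / D) (B * p / D) (C * p / D) (p ^ 2 / D) (p * E / D) p = S2 at *
  have hS1 : S1 = (p / D * S2 * (qInf1 p A * qInf1 p B * qInf1 p C) + qInf1 p p * qInf1 p D *
      qInf1 p (p / D) * (qInf1 p (B * C * p / D) * qInf1 p (A * C * p / D) *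
        qInf1 p (A * B * p / D))) / (a' * b' * c') := by
    rw [eq_div_iff (by positivity)]; linarith
  rw [hS1]
  field_simp
  ring

/-- The regularized form of the function `V`, for parameters `A, B, C, D, E` with
`D E = A B C p`. -/
noncomputable def vReg (p A B C D E : ℝ) : ℝ :=
  (1 - p) / (qInf1 p D * qInf1 p E * qInf1 p p) *
    (-D * balSeries p (A * p) (B * p) (C * p) (D * p) (E * p) (p ^ 2) +
      qInf1 p (A * p) * qInf1 p (B * p) * qInf1 p (C * p) /
        (qInf1 p (A * p / D) * qInf1 p (B * p / D) * qInf1 p (C * p / D)) *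
        balSeries p (A * p / D) (B * p / D) (C * p / D) (p ^ 2 / D) (p * E / D) p)

/-- The product form of `vReg`. -/
theorem vReg_eq (hp0 : 0 < p) (hp1 : p < 1) {A B C D E : ℝ} (hD0 : D ≠ 0)
    (hDE : D * E = A * B * C * p)
    (hD : ∀ n : ℕ, D * p ^ n ≠ 1) (hE : ∀ n : ℕ, E * p ^ n ≠ 1)
    (hA' : ∀ n : ℕ, A * p / D * p ^ n ≠ 1) (hB' : ∀ n : ℕ, B * p / D * p ^ n ≠ 1)
    (hC' : ∀ n : ℕ, C * p / D * p ^ n ≠ 1) :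
    p * ((1 - A) * (1 - B) * (1 - C)) * vReg p A B C D E = -D * (1 - p) *
      (qInf1 p (p / D) * (qInf1 p (B * C * p / D) * qInf1 p (A * C * p / D) *
        qInf1 p (A * B * p / D)) /
        (qInf1 p E * (qInf1 p (A * p / D) * qInf1 p (B * p / D) * qInf1 p (C * p / D))) - 1) := by
  have key := saalPair_eq hp0 hp1 A B C hD0
  unfold saalPair at key
  have e1 : A * B * C * p / D = E := by rw [← hDE]; field_simp
  have e2 : A * B * C * p ^ 2 / D ^ 2 = p * E / D := by
    rw [pow_two, ← mul_assoc, ← hDE]; field_simp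
  -- The tail of the first series and the companion term both contain (1 − A)(1 − B)(1 − C); only
  -- the term of index 0 does not. It accounts for the −1 in the result.
  rw [e1, e2, balSeries_eq_first_add hp0 hp1 A, qInf1_succ hp0 hp1 A, qInf1_succ hp0 hp1 B,
    qInf1_succ hp0 hp1 C, ← pow_two] at key
  have n1 := qInf1_ne_zero hp0 hp1 hD
  have n2 := qInf1_ne_zero hp0 hp1 hE
  have n4 := qInf1_ne_zero hp0 hp1 hA'
  have n5 := qInf1_ne_zero hp0 hp1 hB'
  have n6 := qInf1_ne_zero hp0 hp1 hC'
  have n8 := qInf1_self_ne_zero hp0 hp1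
  unfold vReg
  generalize qInf1 p (A * p / D) = a' at *
  generalize qInf1 p (B * p / D) = b' at *
  generalize qInf1 p (C * p / D) = c' at *
  generalize balSeries p (A * p) (B * p) (C * p) (D * p) (E * p) (p ^ 2) = S1 at *
  generalize balSeries p (A * p / D) (B * p / D) (C * p / D) (p ^ 2 / D) (p * E / D) p = S2 at *
  field_simp at key ⊢
  linear_combination (-(1 - p)) * key

/-- The regularized function `vReg` is unchanged when the parameters `A`, `B` are inverted. -/
theorem vReg_inv (hp0 : 0 < p) (hp1 : p < 1) {A B C D E : ℝ} (hD0 : D ≠ 0) (hA0 : A ≠ 0)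
    (hB0 : B ≠ 0) (hC0 : C ≠ 0) (hA1 : A ≠ 1) (hB1 : B ≠ 1) (hC1 : C ≠ 1)
    (hDE : D * E = A * B * C * p)
    (hD : ∀ n : ℤ, D ≠ p ^ n) (hE : ∀ n : ℤ, E ≠ p ^ n)
    (hA' : ∀ n : ℕ, A * p / D * p ^ n ≠ 1) (hB' : ∀ n : ℕ, B * p / D * p ^ n ≠ 1)
    (hC' : ∀ n : ℤ, C / D ≠ p ^ n) (hC'' : ∀ n : ℤ, C / E ≠ p ^ n) :
    vReg p A⁻¹ B⁻¹ C (C * p / E) (C * p / D) = vReg p A B C D E := by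
  have hp := hp0.ne'
  have hE0 : E ≠ 0 := by
    rintro rfl; rw [mul_zero] at hDE; exact absurd hDE.symm (by positivity)
  have conv : ∀ {x : ℝ} (m : ℤ), (∀ n : ℤ, x ≠ p ^ n) → ∀ n : ℕ, x * p ^ m * p ^ n ≠ 1 := by
    intro x m hx n h
    refine hx (-(m + n)) ?_
    rw [mul_assoc, ← zpow_natCast p n, ← zpow_add₀ hp] at h
    rw [zpow_neg]
    exact eq_inv_of_mul_eq_one_left h
  have conv' : ∀ {x : ℝ}, (∀ n : ℤ, x ≠ p ^ n) → ∀ n : ℕ, x * p ^ n ≠ 1 := fun hx n => by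
    simpa using conv 0 hx n
  have conv1 : ∀ {x : ℝ}, (∀ n : ℤ, x ≠ p ^ n) → ∀ n : ℕ, x * p * p ^ n ≠ 1 := fun hx n => by
    simpa using conv 1 hx n
  have d1 : E = A * B * C * p / D := by rw [← hDE]; field_simp
  -- Under (A, B, D, E) ↦ (A⁻¹, B⁻¹, Cp/E, Cp/D) the four factors in the numerator of the product
  -- form are permuted, and so are the four in the denominator.
  have f1 : A⁻¹ * p / (C * p / E) = B * p / D := by rw [d1]; field_simp
  have f2 : B⁻¹ * p / (C * p / E) = A * p / D := by rw [d1]; field_simp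
  have f3 : C * p / (C * p / E) = E := by field_simp
  have f4 : p / (C * p / E) = A * B * p / D := by rw [d1]; field_simp
  have f5 : B⁻¹ * C * p / (C * p / E) = A * C * p / D := by rw [d1]; field_simp
  have f6 : A⁻¹ * C * p / (C * p / E) = B * C * p / D := by rw [d1]; field_simp
  have f7 : A⁻¹ * B⁻¹ * p / (C * p / E) = p / D := by rw [d1]; field_simp
  have h1 := vReg_eq hp0 hp1 hD0 hDE (conv' hD) (conv' hE) hA' hB'
    (fun n => by rw [mul_div_right_comm]; exact conv1 hC' n)
  have h2 := vReg_eq hp0 hp1 (A := A⁻¹) (B := B⁻¹) (C := C) (D := C * p / E) (E := C * p / D)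
    (by positivity) (by rw [d1]; field_simp)
    (fun n => by rw [mul_div_right_comm]; exact conv1 hC'' n)
    (fun n => by rw [mul_div_right_comm]; exact conv1 hC' n)
    (by rw [f1]; exact hB') (by rw [f2]; exact hA') (by rw [f3]; exact conv' hE)
  rw [f1, f2, f3, f4, f5, f6, f7] at h2
  have g1 : qInf1 p (A * B * p / D) * (qInf1 p (A * C * p / D) * qInf1 p (B * C * p / D) *
      qInf1 p (p / D)) / (qInf1 p (C * p / D) * (qInf1 p (B * p / D) * qInf1 p (A * p / D) *
      qInf1 p E)) = qInf1 p (p / D) * (qInf1 p (B * C * p / D) * qInf1 p (A * C * p / D) *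
        qInf1 p (A * B * p / D)) /
        (qInf1 p E * (qInf1 p (A * p / D) * qInf1 p (B * p / D) * qInf1 p (C * p / D))) := by
    congr 1 <;> ring
  rw [g1] at h2
  have hAi : 1 - A ≠ 0 := sub_ne_zero.2 hA1.symm
  have hBi : 1 - B ≠ 0 := sub_ne_zero.2 hB1.symm
  have hCi : 1 - C ≠ 0 := sub_ne_zero.2 hC1.symm
  set X := vReg p A⁻¹ B⁻¹ C (C * p / E) (C * p / D)
  set Y := vReg p A B C D E
  set W := qInf1 p (p / D) * (qInf1 p (B * C * p / D) * qInf1 p (A * C * p / D) *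
        qInf1 p (A * B * p / D)) /
        (qInf1 p E * (qInf1 p (A * p / D) * qInf1 p (B * p / D) * qInf1 p (C * p / D))) - 1
  -- The prefactors agree too: D becomes D/(AB), and (1 − A⁻¹)(1 − B⁻¹) = (1 − A)(1 − B)/(AB). Since
  -- A, B, C differ from 1, the product form determines `vReg`.
  have f8 : C * p / E = D / (A * B) := by rw [d1]; field_simp
  have h3 : p * ((1 - A) * (1 - B) * (1 - C)) * X = -D * (1 - p) * W := by
    rw [f8] at h2
    field_simp at h2
    linear_combination h2
  exact mul_left_cancel₀ (by positivity) (h3.trans h1.symm)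

end Basic

/-! ### Zeros and quasi-periodicity of theta functions, shifted factorials of integer index -/

section Theta

variable {p : ℝ}

theorem theta1_ne_zero (hp0 : 0 < p) (hp1 : p < 1) {x : ℝ} (h : ∀ n : ℤ, x ≠ p ^ n) :
    theta1 p x ≠ 0 := by
  by_cases hx : x = 0
  · simp [theta1, hx, qInf1_zero]
  refine mul_ne_zero (qInf1_ne_zero hp0 hp1 fun n hn => h (-n) ?_)
    (qInf1_ne_zero hp0 hp1 fun n hn => h (n + 1) ?_)
  · rw [zpow_neg, zpow_natCast]; exact eq_inv_of_mul_eq_one_left hn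
  · field_simp at hn
    rw [← hn]; norm_cast; ring

/-- Every power of p is a zero of θ. Hence one condition θ(x) ≠ 0, which is open in x ≠ 0, encodes
the infinitely many conditions x ≠ pⁿ. -/
theorem ne_zpow_of_theta1_ne_zero (hp0 : 0 < p) (hp1 : p < 1) {x : ℝ} (h : theta1 p x ≠ 0)
    (n : ℤ) : x ≠ p ^ n := by
  rintro rfl
  refine h ?_
  obtain ⟨m, rfl | rfl⟩ := n.eq_nat_or_neg
  · obtain _ | m := m
    · simp [theta1, qInf1_one hp0 hp1]
    · rw [theta1, qInf1_eq_zero hp0 hp1 (a := p / p ^ ((m + 1 : ℕ) : ℤ)) m, mul_zero]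
      rw [zpow_natCast]
      have := hp0.ne'
      field_simp
      ring
  · rw [theta1, qInf1_eq_zero hp0 hp1 m, zero_mul]
    rw [zpow_neg, zpow_natCast, inv_mul_cancel₀ (pow_ne_zero _ hp0.ne')]

theorem mul_zpow_mul_pow_ne_one (hp0 : 0 < p) {x : ℝ} (hx : ∀ n : ℤ, x ≠ p ^ n) (m : ℤ)
    (n : ℕ) : x * p ^ m * p ^ n ≠ 1 := by
  intro h
  refine hx (-(m + n)) ?_
  rw [mul_assoc, ← zpow_natCast p n, ← zpow_add₀ hp0.ne'] at h
  rw [zpow_neg]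
  exact eq_inv_of_mul_eq_one_left h

theorem mul_pow_ne_one_of_ne_zpow (hp0 : 0 < p) {x : ℝ} (hx : ∀ n : ℤ, x ≠ p ^ n) (n : ℕ) :
    x * p ^ n ≠ 1 := by
  simpa using mul_zpow_mul_pow_ne_one hp0 hx 0 n

theorem inv_ne_zpow {x : ℝ} (hx : ∀ n : ℤ, x ≠ p ^ n) (n : ℤ) : x⁻¹ ≠ p ^ n := fun h =>
  hx (-n) (by rw [zpow_neg, ← h, inv_inv])

theorem mul_self_ne_zpow (hp0 : 0 < p) {x : ℝ} (hx : ∀ n : ℤ, x ≠ p ^ n) (n : ℤ) :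
    p * x ≠ p ^ n := fun h =>
  hx (n - 1) (by rw [zpow_sub_one₀ hp0.ne', ← h, mul_comm p, mul_inv_cancel_right₀ hp0.ne'])

/-- Iterated quasi-periodicity, in both directions of n; the exponent n − n² is −2(0 + 1 + … + (n −
1)). -/
theorem theta1_mul_zpow {q : ℝ} (hq0 : 0 < q) (hq1 : q < 1) {w : ℝ} (hw : w ≠ 0) (n : ℤ) :
    theta1 (q ^ 2) (w * q ^ (2 * n)) = (-w) ^ (-n) * q ^ (n - n ^ 2) * theta1 (q ^ 2) w := by
  have hp0 : 0 < q ^ 2 := by positivity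
  have hp1 : q ^ 2 < 1 := pow_lt_one₀ hq0.le hq1 (by norm_num)
  have hw' : -w ≠ 0 := neg_ne_zero.2 hw
  have step : ∀ m : ℤ, theta1 (q ^ 2) (w * q ^ (2 * (m + 1))) =
      -(w * q ^ (2 * m))⁻¹ * theta1 (q ^ 2) (w * q ^ (2 * m)) := fun m => by
    rw [← theta1_mul_self hp0 hp1 (by positivity)]
    congr 1
    rw [mul_add, zpow_add₀ hq0.ne', mul_assoc]
    norm_cast
  induction n using Int.induction_on with
  | zero => simp
  | succ m ih =>
    rw [step, ih]
    have e1 : -(w * q ^ (2 * (m : ℤ)))⁻¹ = (-w) ^ (-1 : ℤ) * q ^ (-(2 * (m : ℤ))) := by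
      rw [zpow_neg_one, zpow_neg, mul_inv, inv_neg]; ring
    rw [e1, show (-w) ^ (-1 : ℤ) * q ^ (-(2 * (m : ℤ))) * ((-w) ^ (-(m : ℤ)) *
        q ^ ((m : ℤ) - m ^ 2) * theta1 (q ^ 2) w) = ((-w) ^ (-1 : ℤ) * (-w) ^ (-(m : ℤ))) *
        (q ^ (-(2 * (m : ℤ))) * q ^ ((m : ℤ) - m ^ 2)) * theta1 (q ^ 2) w by ring,
      ← zpow_add₀ hw', ← zpow_add₀ hq0.ne']
    congr 3 <;> ring
  | pred m ih =>
    have h := step (-(m : ℤ) - 1)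
    rw [sub_add_cancel, ih] at h
    have e : w * q ^ (2 * (-(m : ℤ) - 1)) ≠ 0 := by positivity
    have h2 : theta1 (q ^ 2) (w * q ^ (2 * (-(m : ℤ) - 1))) =
        -w * q ^ (2 * (-(m : ℤ) - 1)) * ((-w) ^ (- -(m : ℤ)) * q ^ (-(m : ℤ) - (-(m : ℤ)) ^ 2) *
          theta1 (q ^ 2) w) := by
      rw [h]; field_simp
    rw [h2, show -w * q ^ (2 * (-(m : ℤ) - 1)) * ((-w) ^ (- -(m : ℤ)) *
        q ^ (-(m : ℤ) - (-(m : ℤ)) ^ 2) * theta1 (q ^ 2) w) =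
        ((-w) ^ (1 : ℤ) * (-w) ^ (- -(m : ℤ))) * (q ^ (2 * (-(m : ℤ) - 1)) *
        q ^ (-(m : ℤ) - (-(m : ℤ)) ^ 2)) * theta1 (q ^ 2) w by rw [zpow_one]; ring,
      ← zpow_add₀ hw', ← zpow_add₀ hq0.ne']
    congr 3 <;> ring

theorem qFin1_eq_div (hp0 : 0 < p) (hp1 : p < 1) {a : ℝ} (h : ∀ n : ℤ, a ≠ p ^ n) (t : ℤ) :
    qFin1 p a t = qInf1 p a / qInf1 p (a * p ^ t) := by
  have hne : qInf1 p (a * p ^ t) ≠ 0 :=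
    qInf1_ne_zero hp0 hp1 fun n => mul_zpow_mul_pow_ne_one hp0 h t n
  rw [eq_div_iff hne]
  obtain ⟨m, rfl | rfl⟩ := t.eq_nat_or_neg
  · rw [qFin1_natCast, zpow_natCast]
    exact qFac_mul_qInf1 hp0 hp1 a m
  · have hq := qFac_mul_qInf1 hp0 hp1 (a * p ^ (-(m : ℤ))) m
    rw [mul_assoc, ← zpow_natCast p m, ← zpow_add₀ hp0.ne', neg_add_cancel, zpow_zero,
      mul_one] at hq
    have hf : qFac p (a * p ^ (-(m : ℤ))) m ≠ 0 :=
      qFac_ne_zero (mul_zpow_mul_pow_ne_one hp0 h _) m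
    obtain _ | m := m
    · simp [qFin1]
    · have h1 : ¬ (0 : ℤ) ≤ -((m + 1 : ℕ) : ℤ) := by push_cast; omega
      rw [qFin1, if_neg h1, neg_neg, Int.toNat_natCast]
      change 1 / qFac p (a * p ^ (-((m + 1 : ℕ) : ℤ))) (m + 1) * _ = _
      rw [← hq]
      field_simp

end Theta

/-- The parameter `α q ^ (2 m + 1) x`. -/
noncomputable def shiftPar (q α : ℝ) (m : ℤ) (x : ℝ) : ℝ := α * q ^ (2 * m + 1) * x

/-- Conditions on the parameters under which all denominators and roots in `R` at `z = 1`
make sense, apart from those that are excluded by regularity. -/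
structure Adm (p u₁ u₂ u₃ u₄ s : ℝ) : Prop where
  s_ne : s ≠ 0
  u₁_ne : u₁ ≠ 0
  u₂_ne : u₂ ≠ 0
  u₃_ne : u₃ ≠ 0
  u₄_ne : u₄ ≠ 0
  rel : u₂ * u₄ = u₁ * u₃
  pos₁ : 0 < qInf1 p (-(u₁ * s)) * qInf1 p (-(u₁ / s))
  pos₂ : 0 < qInf1 p (-(u₂ * s)) * qInf1 p (-(u₂ / s))
  pos₃ : 0 < qInf1 p (-(u₃ * s)) * qInf1 p (-(u₃ / s))
  pos₄ : 0 < qInf1 p (-(u₄ * s)) * qInf1 p (-(u₄ / s))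
  theta₁ : 0 < theta1 p (-(u₁ * s)) * theta1 p (-(u₁ / s))
  theta₂ : 0 < theta1 p (-(u₂ * s)) * theta1 p (-(u₂ / s))
  theta₃ : 0 < theta1 p (-(u₃ * s)) * theta1 p (-(u₃ / s))
  theta₄ : 0 < theta1 p (-(u₄ * s)) * theta1 p (-(u₄ / s))
  theta_s : theta1 p (s ^ 2) ≠ 0
  theta_ρ : theta1 p (u₁ / u₂) ≠ 0
  theta_ρs : theta1 p (u₁ / u₂ * s ^ 2) ≠ 0

/-! ### Translation of the powers of q into the shifted parameters uᵢ -/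

section Parameters

variable {q : ℝ}

theorem zpow_two_mul_eq_sq (m : ℤ) : q ^ (2 * m) = (q ^ m) ^ 2 := by
  rw [mul_comm, zpow_mul]; norm_cast

theorem shiftPar_ne_zero (hq0 : 0 < q) {α x : ℝ} (hα : α ≠ 0) (hx : x ≠ 0) (m : ℤ) :
    shiftPar q α m x ≠ 0 := by
  unfold shiftPar; positivity

theorem shiftPar_one_div_four (hq0 : 0 < q) (k l : ℤ) (α x₁ x₄ : ℝ) :
    α * q ^ (2 * (l - k)) * (x₁ / x₄) = shiftPar q α l x₁ / shiftPar q 1 k x₄ := by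
  have hq := hq0.ne'
  simp only [shiftPar, zpow_add₀ hq, zpow_sub₀ hq, mul_sub, zpow_two_mul_eq_sq, zpow_one]
  field_simp

theorem shiftPar_one_div_four_succ (hq0 : 0 < q) (k l : ℤ) (α x₁ x₄ : ℝ) :
    α * q ^ (2 * (l - k + 1)) * (x₁ / x₄) =
      q ^ 2 * (shiftPar q α l x₁ / shiftPar q 1 k x₄) := by
  have hq := hq0.ne'
  simp only [shiftPar, zpow_add₀ hq, zpow_sub₀ hq, zpow_two_mul_eq_sq, zpow_one]
  field_simp

theorem shiftPar_one_div_three (hq0 : 0 < q) (k r l : ℤ) (α x₁ x₃ : ℝ) :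
    α * q ^ (2 * (l - k - r + 1)) * (x₁ / x₃) =
      q ^ 2 * (shiftPar q α l x₁ / shiftPar q 1 (k + r) x₃) := by
  have hq := hq0.ne'
  simp only [shiftPar, zpow_add₀ hq, zpow_sub₀ hq, zpow_two_mul_eq_sq, zpow_one]
  field_simp

theorem shiftPar_one_div_two (hq0 : 0 < q) (r l : ℤ) {α : ℝ} (hα : α ≠ 0) (x₁ x₂ : ℝ) :
    q ^ (-2 * r) * (x₁ / x₂) = shiftPar q α l x₁ / shiftPar q α (l + r) x₂ := by
  have hq := hq0.ne'
  rw [neg_mul, zpow_neg]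
  simp only [shiftPar, zpow_add₀ hq, zpow_two_mul_eq_sq, zpow_one]
  field_simp

theorem shiftPar_one_div_two_succ (hq0 : 0 < q) (r l : ℤ) {α : ℝ} (hα : α ≠ 0) (x₁ x₂ : ℝ) :
    q ^ (2 - 2 * r) * (x₁ / x₂) =
      q ^ 2 * (shiftPar q α l x₁ / shiftPar q α (l + r) x₂) := by
  have hq := hq0.ne'
  rw [← shiftPar_one_div_two hq0 r l hα, neg_mul, sub_eq_add_neg, zpow_add₀ hq]
  norm_cast
  ring

theorem shiftPar_two_div_one (hq0 : 0 < q) (r l : ℤ) {α : ℝ} (hα : α ≠ 0) (x₁ x₂ : ℝ) :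
    q ^ (2 * r) * (x₂ / x₁) = shiftPar q α (l + r) x₂ / shiftPar q α l x₁ := by
  have hq := hq0.ne'
  simp only [shiftPar, zpow_add₀ hq, zpow_two_mul_eq_sq, zpow_one]
  field_simp

theorem shiftPar_two_div_one_succ (hq0 : 0 < q) (r l : ℤ) {α : ℝ} (hα : α ≠ 0) (x₁ x₂ : ℝ) :
    q ^ (2 * (r + 1)) * (x₂ / x₁) =
      q ^ 2 * (shiftPar q α (l + r) x₂ / shiftPar q α l x₁) := by
  have hq := hq0.ne'
  rw [← shiftPar_two_div_one hq0 r l hα, mul_add, zpow_add₀ hq]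
  norm_cast
  ring

theorem zpow_one_sub_mul_div (hq0 : 0 < q) (m : ℤ) (x y : ℝ) :
    q ^ (1 - 2 * m) * (y / x) = q ^ 2 * y / shiftPar q 1 m x := by
  have hq := hq0.ne'
  simp only [shiftPar, zpow_add₀ hq, zpow_sub₀ hq, zpow_two_mul_eq_sq, zpow_one]
  field_simp

theorem zpow_mul_mul_eq (α : ℝ) (m : ℤ) (x y : ℝ) :
    α * q ^ (2 * m + 1) * (x * y) = shiftPar q α m x * y := by
  unfold shiftPar; ring

end Parameters

theorem qInf1_mul_div_eq {p : ℝ} (hp0 : 0 < p) (hp1 : p < 1) {a : ℝ}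
    (h : ∀ n : ℕ, a * p ^ n ≠ 1) : qInf1 p (p * a) / qInf1 p a = 1 / (1 - a) := by
  have h1 : qInf1 p (p * a) ≠ 0 := qInf1_ne_zero hp0 hp1 fun n hn => h (n + 1) (by
    rw [← hn]; ring)
  have h2 : 1 - a ≠ 0 := fun h0 => h 0 (by rw [pow_zero, mul_one]; linarith)
  rw [qInf1_succ hp0 hp1 a, mul_comm a p]
  field_simp

/-! ### Evaluation of R at z = 1 for s₄ = s and s₄ = 1/s -/

section RElement

variable {q : ℝ} (hq0 : 0 < q) (hq1 : q < 1) (k r l : ℤ) {α : ℝ} (hα : α ≠ 0)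
  (x₁ x₂ x₃ x₄ : ℝ)

include hq0 hα in
-- At z = 1 the powers of q combine into the uᵢ; only a few factors keep the unshifted ratio x₁/x₂,
-- and these later cancel against c(s₄).
theorem R_eq_shiftPar {u₁ u₂ u₃ u₄ : ℝ} (h₁ : shiftPar q α l x₁ = u₁)
    (h₂ : shiftPar q α (l + r) x₂ = u₂) (h₃ : shiftPar q 1 (k + r) x₃ = u₃)
    (h₄ : shiftPar q 1 k x₄ = u₄) (s s₄ : ℝ) :
    R q k r l 1 α x₁ x₂ x₃ x₄ s s₄ =
      α ^ r * s₄ ^ (-r) * q ^ (l - k) / qFin1 (q ^ 2) (q ^ 2 * (u₁ / u₂)) r *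
        (S q (-k) x₄⁻¹ s₄ / S q (-k - r) x₃⁻¹ s * (S q (l + r) x₂ (α * s₄) / S q l x₁ (α * s))) *
      (qInf1 (q ^ 2) (q ^ 2 * (u₁ / u₃)) * qInf1 (q ^ 2) (q ^ 2 * (s₄ / s)) *
          qInf1 (q ^ 2) (s₄ / s) /
          (qInf1 (q ^ 2) (u₁ / u₄) * qInf1 (q ^ 2) (q ^ 2 * (x₁ / x₂) * (s₄ / s)) *
            qInf1 (q ^ 2) (u₂ / u₁ * (s₄ / s))) *
          qFin1 (q ^ 2) (q ^ 2 * (u₁ / u₂) * (s * s₄)) r *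
          phi [-(q ^ 2 * s / u₃), -(u₁ * s), q ^ 2 * (u₁ / u₂), u₁ / u₂]
            [q ^ 2 * (u₁ / u₃), q ^ 2 * (u₁ / u₂) * (s / s₄), q ^ 2 * (u₁ / u₂) * (s * s₄)]
            (q ^ 2) (q ^ 2) +
        qInf1 (q ^ 2) (q ^ 2 * (u₁ / u₄) * (s₄ / s)) * qInf1 (q ^ 2) (-(q ^ 2 * s / u₃)) *
          qInf1 (q ^ 2) (-(u₁ * s)) /
          (qInf1 (q ^ 2) (u₁ / u₄) * qInf1 (q ^ 2) (-(q ^ 2 * s₄ / u₄)) *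
            qInf1 (q ^ 2) (-(u₂ * s₄))) *
          (qInf1 (q ^ 2) (q ^ 2 * (u₁ / u₂)) * qInf1 (q ^ 2) (u₁ / u₂) *
              qInf1 (q ^ 2) (s₄ ^ 2 * q ^ 2) /
            (qInf1 (q ^ 2) (q ^ 2 * (x₁ / x₂) * (s₄ / s)) *
              qInf1 (q ^ 2) (q ^ 2 * (x₁ / x₂) * (s * s₄)) *
              qInf1 (q ^ 2) (u₁ / u₂ * (s / s₄)))) *
          phi [-(q ^ 2 * s₄ / u₄), -(u₂ * s₄), q ^ 2 * (s₄ / s), s₄ / s]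
            [q ^ 2 * (u₁ / u₄) * (s₄ / s), s₄ ^ 2 * q ^ 2, q ^ 2 * (u₂ / u₁) * (s₄ / s)]
            (q ^ 2) (q ^ 2)) := by
  have hq := hq0.ne'
  have e : q ^ r * q ^ (l - k - r) = q ^ (l - k) := by rw [← zpow_add₀ hq]; congr 1; ring
  rw [R, kappa]
  simp only [inv_one, one_mul, mul_one, one_zpow]
  rw [shiftPar_one_div_two_succ hq0 r l hα, shiftPar_one_div_three hq0, shiftPar_one_div_four hq0,
    shiftPar_two_div_one hq0 r l hα, zpow_one_sub_mul_div hq0, zpow_one_sub_mul_div hq0,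
    zpow_mul_mul_eq, zpow_mul_mul_eq, shiftPar_one_div_two hq0 r l hα,
    shiftPar_one_div_four_succ hq0, shiftPar_two_div_one_succ hq0 r l hα, h₁, h₂, h₃, h₄]
  simp only [qInf_cons, qInf_nil, mul_one, qFin, List.map_cons, List.map_nil, List.prod_cons,
    List.prod_nil]
  rw [← e]
  ring

theorem phi_of_one_mem (A B C : ℝ) (bs : List ℝ) (p w : ℝ) (hbs : bs.length = 3) :
    phi [A, B, C, 1] bs p w = 1 := by
  unfold phi
  rw [tsum_eq_single 0]
  · simp [phiTerm, qFin, qFin1, hbs]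
  · intro n hn
    obtain ⟨m, rfl⟩ := Nat.exists_eq_succ_of_ne_zero hn
    have : qFin1 p 1 ((m + 1 : ℕ) : ℤ) = 0 := by
      rw [qFin1_natCast, qFac_succ']; ring
    simp only [phiTerm, qFin, List.map_cons, List.prod_cons, this]
    simp

variable {x₁ x₂ x₃ x₄}

include hq0 hq1 hα in
-- The factor (s₄/s₃)_∞ = (1)_∞ = 0 removes T₁, and s₄/s₃ = 1 is a numerator parameter of the series
-- in T₂, which leaves only its term of index 0.
theorem R_diag {u₁ u₂ u₃ u₄ s : ℝ} (h₁ : shiftPar q α l x₁ = u₁)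
    (h₂ : shiftPar q α (l + r) x₂ = u₂) (h₃ : shiftPar q 1 (k + r) x₃ = u₃)
    (h₄ : shiftPar q 1 k x₄ = u₄) (hA : Adm (q ^ 2) u₁ u₂ u₃ u₄ s)
    (hreg : ∀ n : ℕ, u₁ / u₄ * (q ^ 2) ^ n ≠ 1) :
    R q k r l 1 α x₁ x₂ x₃ x₄ s s =
      α ^ r * s ^ (-r) * q ^ (l - k) *
        (S q (-k) x₄⁻¹ s / S q (-k - r) x₃⁻¹ s * (S q (l + r) x₂ (α * s) / S q l x₁ (α * s))) *
      (qInf1 (q ^ 2) (-(q ^ 2 * s / u₃)) * qInf1 (q ^ 2) (-(u₁ * s)) *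
        qInf1 (q ^ 2) (q ^ 2 * s ^ 2) /
        ((1 - u₁ / u₄) * qInf1 (q ^ 2) (-(q ^ 2 * s / u₄)) * qInf1 (q ^ 2) (-(u₂ * s)) *
          qInf1 (q ^ 2) (q ^ 2 * (x₁ / x₂) * s ^ 2))) := by
  have hp0 : 0 < q ^ 2 := by positivity
  have hp1 : q ^ 2 < 1 := pow_lt_one₀ hq0.le hq1 (by norm_num)
  have hs := hA.s_ne
  have hρ := ne_zpow_of_theta1_ne_zero hp0 hp1 hA.theta_ρ
  have n1 : qInf1 (q ^ 2) (u₁ / u₂) ≠ 0 :=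
    qInf1_ne_zero hp0 hp1 (mul_pow_ne_one_of_ne_zpow hp0 hρ)
  have n2 : qInf1 (q ^ 2) (q ^ 2 * (u₁ / u₂)) ≠ 0 := qInf1_ne_zero hp0 hp1
    (mul_pow_ne_one_of_ne_zpow hp0 (mul_self_ne_zpow hp0 hρ))
  -- Shifting by r turns u₁/u₂ back into x₁/x₂, so the factorial of index r in κ_r becomes a
  -- quotient of two infinite products.
  have e1 : q ^ 2 * (u₁ / u₂) * (q ^ 2) ^ r = q ^ 2 * (x₁ / x₂) := by
    rw [← h₁, ← h₂, ← shiftPar_one_div_two hq0 r l hα, neg_mul, zpow_neg, zpow_mul,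
      ← zpow_natCast q 2]
    push_cast
    have : (q ^ (2 : ℤ)) ^ r ≠ 0 := by positivity
    field_simp
  have n3 : qInf1 (q ^ 2) (q ^ 2 * (x₁ / x₂)) ≠ 0 := by
    rw [← e1]
    exact qInf1_ne_zero hp0 hp1 (mul_zpow_mul_pow_ne_one hp0 (mul_self_ne_zpow hp0 hρ) r)
  have e2 : qFin1 (q ^ 2) (q ^ 2 * (u₁ / u₂)) r =
      qInf1 (q ^ 2) (q ^ 2 * (u₁ / u₂)) / qInf1 (q ^ 2) (q ^ 2 * (x₁ / x₂)) := by
    rw [qFin1_eq_div hp0 hp1 (mul_self_ne_zpow hp0 hρ), e1]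
  have e3 := qInf1_mul_div_eq hp0 hp1 hreg
  rw [R_eq_shiftPar hq0 k r l hα x₁ x₂ x₃ x₄ h₁ h₂ h₃ h₄, div_self hs, qInf1_one hp0 hp1,
    phi_of_one_mem _ _ _ _ _ _ rfl, e2]
  simp only [mul_zero, zero_mul, zero_div, zero_add, mul_one]
  have e4 : ∀ a b c d : ℝ, qInf1 (q ^ 2) (q ^ 2 * (u₁ / u₄)) * a * b /
      (qInf1 (q ^ 2) (u₁ / u₄) * c * d) = 1 / (1 - u₁ / u₄) * (a * b / (c * d)) := by
    intro a b c d
    rw [← e3, mul_assoc, mul_assoc, mul_div_mul_comm]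
  have e5 : s ^ 2 * q ^ 2 = q ^ 2 * s ^ 2 := mul_comm _ _
  rw [e4, e5, ← pow_two s]
  have n4 : 1 - u₁ / u₄ ≠ 0 := fun h0 => hreg 0 (by rw [pow_zero, mul_one]; linarith)
  generalize qInf1 (q ^ 2) (q ^ 2 * (x₁ / x₂)) = y1 at *
  generalize qInf1 (q ^ 2) (q ^ 2 * (u₁ / u₂)) = y2 at *
  generalize qInf1 (q ^ 2) (u₁ / u₂) = y3 at *
  generalize 1 - u₁ / u₄ = y4 at *
  simp only [div_eq_mul_inv, mul_inv, inv_inv, one_mul]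
  have f1 := mul_inv_cancel₀ n1
  have f2 := mul_inv_cancel₀ n2
  have f3 := mul_inv_cancel₀ n3
  generalize S q (-k) x₄⁻¹ s = z1
  generalize (S q (-k - r) x₃⁻¹ s)⁻¹ = z2
  generalize S q (l + r) x₂ (α * s) = z3
  generalize (S q l x₁ (α * s))⁻¹ = z4
  generalize qInf1 (q ^ 2) (-(q ^ 2 * s * u₃⁻¹)) = z5
  generalize qInf1 (q ^ 2) (-(u₁ * s)) = z6
  generalize (qInf1 (q ^ 2) (-(q ^ 2 * s * u₄⁻¹)))⁻¹ = z7
  generalize (qInf1 (q ^ 2) (-(u₂ * s)))⁻¹ = z8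
  generalize qInf1 (q ^ 2) (q ^ 2 * s ^ 2) = z9
  calc _ = α ^ r * s ^ (-r) * q ^ (l - k) * (z1 * z2 * (z3 * z4)) *
        (z5 * z6 * z9 * (y4⁻¹ * z7 * z8 * (qInf1 (q ^ 2) (q ^ 2 * (x₁ * x₂⁻¹) * s ^ 2))⁻¹)) *
        ((y1 * y1⁻¹) * (y2 * y2⁻¹) * (y3 * y3⁻¹)) := by ring
    _ = _ := by rw [f1, f2, f3]; ring

theorem phi_swap_denom (A B C D E p w : ℝ) :
    phi [A, B, C] [D, E] p w = phi [A, B, C] [E, D] p w := by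
  refine tsum_congr fun n => ?_
  simp only [phiTerm, qFin, List.map_cons, List.map_nil, List.prod_cons, List.prod_nil,
    List.length_cons, List.length_nil]
  congr 2
  ring

include hq0 hq1 hα in
-- Both series reduce to balanced ₃φ₂ and are the two series of one Saalschütz formula. The outcome
-- is the expression of `R_diag` with s₄ = s⁻¹ in place of s₄ = s.
theorem R_antidiag {u₁ u₂ u₃ u₄ s : ℝ} (h₁ : shiftPar q α l x₁ = u₁)
    (h₂ : shiftPar q α (l + r) x₂ = u₂) (h₃ : shiftPar q 1 (k + r) x₃ = u₃)
    (h₄ : shiftPar q 1 k x₄ = u₄) (hA : Adm (q ^ 2) u₁ u₂ u₃ u₄ s)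
    (hreg : ∀ n : ℕ, u₁ / u₄ * (q ^ 2) ^ n ≠ 1)
    (hreg' : ∀ n : ℕ, q ^ 2 * (u₁ / u₃) * (q ^ 2) ^ n ≠ 1)
    (hreg'' : ∀ n : ℕ, q ^ 2 * (u₁ / u₄) * s⁻¹ ^ 2 * (q ^ 2) ^ n ≠ 1)
    (hY : qInf1 (q ^ 2) (q ^ 2 * (x₁ / x₂) * s⁻¹ ^ 2) ≠ 0) :
    R q k r l 1 α x₁ x₂ x₃ x₄ s s⁻¹ =
      α ^ r * s⁻¹ ^ (-r) * q ^ (l - k) *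
        (S q (-k) x₄⁻¹ s⁻¹ / S q (-k - r) x₃⁻¹ s *
          (S q (l + r) x₂ (α * s⁻¹) / S q l x₁ (α * s))) *
      (qInf1 (q ^ 2) (-(q ^ 2 * s⁻¹ / u₃)) * qInf1 (q ^ 2) (-(u₁ * s⁻¹)) *
        qInf1 (q ^ 2) (q ^ 2 * s⁻¹ ^ 2) /
        ((1 - u₁ / u₄) * qInf1 (q ^ 2) (-(q ^ 2 * s⁻¹ / u₄)) * qInf1 (q ^ 2) (-(u₂ * s⁻¹)) *
          qInf1 (q ^ 2) (q ^ 2 * (x₁ / x₂) * s⁻¹ ^ 2))) := by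
  have hp0 : 0 < q ^ 2 := by positivity
  have hp1 : q ^ 2 < 1 := pow_lt_one₀ hq0.le hq1 (by norm_num)
  have hs := hA.s_ne
  have hu₁ := hA.u₁_ne
  have hu₂ := hA.u₂_ne
  have hu₃ := hA.u₃_ne
  have hu₄ := hA.u₄_ne
  have hρ := ne_zpow_of_theta1_ne_zero hp0 hp1 hA.theta_ρ
  have hρs := ne_zpow_of_theta1_ne_zero hp0 hp1 hA.theta_ρs
  have hss := ne_zpow_of_theta1_ne_zero hp0 hp1 hA.theta_s
  have hθ₂ := ne_zpow_of_theta1_ne_zero hp0 hp1 (right_ne_zero_of_mul hA.theta₂.ne')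
  have hθ₄ := ne_zpow_of_theta1_ne_zero hp0 hp1 (left_ne_zero_of_mul hA.theta₄.ne')
  have n1 : qInf1 (q ^ 2) (u₁ / u₂) ≠ 0 :=
    qInf1_ne_zero hp0 hp1 (mul_pow_ne_one_of_ne_zpow hp0 hρ)
  have n2 : qInf1 (q ^ 2) (q ^ 2 * (u₁ / u₂)) ≠ 0 := qInf1_ne_zero hp0 hp1
    (mul_pow_ne_one_of_ne_zpow hp0 (mul_self_ne_zpow hp0 hρ))
  have e1 : q ^ 2 * (u₁ / u₂) * (q ^ 2) ^ r = q ^ 2 * (x₁ / x₂) := by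
    rw [← h₁, ← h₂, ← shiftPar_one_div_two hq0 r l hα, neg_mul, zpow_neg, zpow_mul,
      ← zpow_natCast q 2]
    push_cast
    have : (q ^ (2 : ℤ)) ^ r ≠ 0 := by positivity
    field_simp
  have n3 : qInf1 (q ^ 2) (q ^ 2 * (x₁ / x₂)) ≠ 0 := by
    rw [← e1]
    exact qInf1_ne_zero hp0 hp1 (mul_zpow_mul_pow_ne_one hp0 (mul_self_ne_zpow hp0 hρ) r)
  have e2 : qFin1 (q ^ 2) (q ^ 2 * (u₁ / u₂)) r =
      qInf1 (q ^ 2) (q ^ 2 * (u₁ / u₂)) / qInf1 (q ^ 2) (q ^ 2 * (x₁ / x₂)) := by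
    rw [qFin1_eq_div hp0 hp1 (mul_self_ne_zpow hp0 hρ), e1]
  have e3 := qInf1_mul_div_eq hp0 hp1 hreg
  have n4 : 1 - u₁ / u₄ ≠ 0 := fun h0 => hreg 0 (by rw [pow_zero, mul_one]; linarith)
  have n5 : qInf1 (q ^ 2) (u₁ / u₄) ≠ 0 := qInf1_ne_zero hp0 hp1 hreg
  have hss' : ∀ n : ℤ, s⁻¹ ^ 2 ≠ (q ^ 2) ^ n := by
    rw [inv_pow]; exact inv_ne_zpow hss
  have hX : ∀ n : ℕ, s⁻¹ ^ 2 * q ^ 2 * (q ^ 2) ^ n ≠ 1 := by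
    rw [mul_comm]; exact mul_pow_ne_one_of_ne_zpow hp0 (mul_self_ne_zpow hp0 hss')
  have g1 : s⁻¹ / s = s⁻¹ ^ 2 := by rw [pow_two]; rfl
  have g2 : s / s⁻¹ = s ^ 2 := by rw [div_inv_eq_mul, pow_two]
  have g3 : s * s⁻¹ = 1 := mul_inv_cancel₀ hs
  have g4 : q ^ 2 * s⁻¹ ^ 2 = s⁻¹ ^ 2 * q ^ 2 := mul_comm _ _
  rw [R_eq_shiftPar hq0 k r l hα x₁ x₂ x₃ x₄ h₁ h₂ h₃ h₄, g1, g2, g3, g4]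
  simp only [mul_one]
  -- Because s s₄ = 1, q²u₁/u₂ is both a numerator and a denominator parameter in the first series;
  -- in the second, q²s₄/s₃ and s₄²q² are both q²s⁻².
  rw [phi_cancel_last _ _ _ _ _
    (mul_pow_ne_one_of_ne_zpow hp0 (mul_self_ne_zpow hp0 hρ)), phi_cancel_middle _ _ _ _ _ hX,
    phi_swap_denom]
  have hD0 : q ^ 2 * (u₁ / u₂) * s ^ 2 ≠ 0 := by positivity
  have rel' : u₃ = u₂ * u₄ / u₁ := by rw [hA.rel]; field_simp
  have f1 : -(q ^ 2 * s / u₃) * q ^ 2 / (q ^ 2 * (u₁ / u₂) * s ^ 2) = -(q ^ 2 * s⁻¹ / u₄) := by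
    rw [rel']; field_simp
  have f2 : -(u₁ * s) * q ^ 2 / (q ^ 2 * (u₁ / u₂) * s ^ 2) = -(u₂ * s⁻¹) := by field_simp
  have f3 : u₁ / u₂ * q ^ 2 / (q ^ 2 * (u₁ / u₂) * s ^ 2) = s⁻¹ ^ 2 := by field_simp
  have f4 : q ^ 2 * (q ^ 2 * (u₁ / u₃)) / (q ^ 2 * (u₁ / u₂) * s ^ 2) =
      q ^ 2 * (u₁ / u₄) * s⁻¹ ^ 2 := by rw [rel']; field_simp
  have f5 : (q ^ 2) ^ 2 / (q ^ 2 * (u₁ / u₂) * s ^ 2) = q ^ 2 * (u₂ / u₁) * s⁻¹ ^ 2 := by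
    field_simp
  have f6 : q ^ 2 / (q ^ 2 * (u₁ / u₂) * s ^ 2) = u₂ / u₁ * s⁻¹ ^ 2 := by field_simp
  have f7 : -(u₁ * s) * (u₁ / u₂) * q ^ 2 / (q ^ 2 * (u₁ / u₂) * s ^ 2) = -(u₁ * s⁻¹) := by
    field_simp
  have f8 : -(q ^ 2 * s / u₃) * (u₁ / u₂) * q ^ 2 / (q ^ 2 * (u₁ / u₂) * s ^ 2) =
      -(q ^ 2 * s⁻¹ / u₃) := by field_simp
  have f9 : -(q ^ 2 * s / u₃) * -(u₁ * s) * q ^ 2 / (q ^ 2 * (u₁ / u₂) * s ^ 2) =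
      q ^ 2 * (u₁ / u₄) := by rw [rel']; field_simp
  have hA' : ∀ n : ℕ, -(q ^ 2 * s⁻¹ / u₄) * (q ^ 2) ^ n ≠ 1 := by
    have := mul_pow_ne_one_of_ne_zpow hp0 (mul_self_ne_zpow hp0 (inv_ne_zpow hθ₄))
    convert this using 3
    field_simp
  have hB' : ∀ n : ℕ, -(u₂ * s⁻¹) * (q ^ 2) ^ n ≠ 1 := mul_pow_ne_one_of_ne_zpow hp0 hθ₂
  have hD : ∀ n : ℤ, q ^ 2 * (u₁ / u₂) * s ^ 2 ≠ (q ^ 2) ^ n := by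
    rw [mul_assoc]; exact mul_self_ne_zpow hp0 hρs
  -- For this D the companion series is the one in T₂, up to the order of its denominator
  -- parameters.
  have key := phi_saalschuetz hp0 hp1 (A := -(q ^ 2 * s / u₃)) (B := -(u₁ * s)) (C := u₁ / u₂)
    (D := q ^ 2 * (u₁ / u₂) * s ^ 2) (E := q ^ 2 * (u₁ / u₃)) hD0 (by field_simp)
    hD hreg' (by rw [f4]; exact hreg'') (by rw [f1]; exact hA') (by rw [f2]; exact hB')
    (by rw [f3]; exact mul_pow_ne_one_of_ne_zpow hp0 hss')
  rw [f1, f2, f3, f4, f5, f6, f7, f8, f9, phi_swap_denom (-(q ^ 2 * s⁻¹ / u₄))] at key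
  have w1 : qInf1 (q ^ 2) (u₂ / u₁ * s⁻¹ ^ 2) =
      (1 - u₂ / u₁ * s⁻¹ ^ 2) * qInf1 (q ^ 2) (q ^ 2 * (u₂ / u₁) * s⁻¹ ^ 2) := by
    rw [qInf1_succ hp0 hp1]; congr 2; ring
  have w2 : qInf1 (q ^ 2) (u₁ / u₂ * s ^ 2) =
      (1 - u₁ / u₂ * s ^ 2) * qInf1 (q ^ 2) (q ^ 2 * (u₁ / u₂) * s ^ 2) := by
    rw [qInf1_succ hp0 hp1]; congr 2; ring
  have n6 : 1 - u₁ / u₂ * s ^ 2 ≠ 0 := fun h0 => hρs 0 (by rw [zpow_zero]; linarith)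
  -- Source of the sign that makes the companion series cancel against T₂.
  have w3 : 1 - u₂ / u₁ * s⁻¹ ^ 2 = -(1 - u₁ / u₂ * s ^ 2) / (u₁ / u₂ * s ^ 2) := by
    field_simp; ring
  have n7 : qInf1 (q ^ 2) (q ^ 2 * (u₁ / u₂) * s ^ 2) ≠ 0 :=
    qInf1_ne_zero hp0 hp1 (mul_pow_ne_one_of_ne_zpow hp0 hD)
  have n8 : qInf1 (q ^ 2) (q ^ 2 * (u₂ / u₁) * s⁻¹ ^ 2) ≠ 0 := by
    have e : q ^ 2 * (u₂ / u₁) * s⁻¹ ^ 2 = q ^ 2 * (u₁ / u₂ * s ^ 2)⁻¹ := by field_simp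
    rw [e]
    exact qInf1_ne_zero hp0 hp1
      (mul_pow_ne_one_of_ne_zpow hp0 (mul_self_ne_zpow hp0 (inv_ne_zpow hρs)))
  have n9 := qInf1_ne_zero hp0 hp1 hA'
  have n10 := qInf1_ne_zero hp0 hp1 hB'
  have n11 := qInf1_ne_zero hp0 hp1 hreg'
  have n12 := qInf1_ne_zero hp0 hp1 (mul_pow_ne_one_of_ne_zpow hp0 hss')
  have w4 : qInf1 (q ^ 2) (q ^ 2 * (u₁ / u₄)) = qInf1 (q ^ 2) (u₁ / u₄) / (1 - u₁ / u₄) := by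
    field_simp at e3 ⊢; linarith
  rw [e2, key, w1, w2, w3, w4]
  have n13 : u₁ / u₂ * s ^ 2 ≠ 0 := by positivity
  have w5 : q ^ 2 * (u₁ / u₂) * s ^ 2 = q ^ 2 * (u₁ / u₂ * s ^ 2) := by ring
  have w6 : u₂ / u₁ * s⁻¹ ^ 2 = (u₁ / u₂ * s ^ 2)⁻¹ := by field_simp
  rw [w6]
  generalize phi _ _ _ _ = φ
  generalize qInf1 (q ^ 2) (q ^ 2 * (x₁ / x₂)) = y1 at *
  generalize qInf1 (q ^ 2) (q ^ 2 * (u₁ / u₂)) = y2 at *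
  generalize qInf1 (q ^ 2) (u₁ / u₂) = y3 at *
  generalize qInf1 (q ^ 2) (q ^ 2 * (x₁ / x₂) * s⁻¹ ^ 2) = y5 at *
  generalize qInf1 (q ^ 2) (q ^ 2 * (u₁ / u₂) * s ^ 2) = y6 at *
  generalize qInf1 (q ^ 2) (q ^ 2 * (u₂ / u₁) * s⁻¹ ^ 2) = y7 at *
  generalize qInf1 (q ^ 2) (q ^ 2 * (u₁ / u₃)) = y8 at *
  generalize qInf1 (q ^ 2) (u₁ / u₄) = y9 at *
  generalize qInf1 (q ^ 2) (q ^ 2 * (u₁ / u₄) * s⁻¹ ^ 2) = y10 at *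
  generalize qInf1 (q ^ 2) (s⁻¹ ^ 2) = y11 at *
  generalize qInf1 (q ^ 2) (s⁻¹ ^ 2 * q ^ 2) = y12 at *
  generalize qInf1 (q ^ 2) (-(q ^ 2 * s / u₃)) = y13 at *
  generalize qInf1 (q ^ 2) (-(u₁ * s)) = y14 at *
  generalize qInf1 (q ^ 2) (-(q ^ 2 * s⁻¹ / u₃)) = y15 at *
  generalize qInf1 (q ^ 2) (-(u₁ * s⁻¹)) = y16 at *
  generalize qInf1 (q ^ 2) (-(q ^ 2 * s⁻¹ / u₄)) = y17 at *
  generalize qInf1 (q ^ 2) (-(u₂ * s⁻¹)) = y18 at *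
  generalize S q (-k) x₄⁻¹ s⁻¹ / S q (-k - r) x₃⁻¹ s *
    (S q (l + r) x₂ (α * s⁻¹) / S q l x₁ (α * s)) = z
  generalize α ^ r * s⁻¹ ^ (-r) * q ^ (l - k) = z'
  generalize 1 - u₁ / u₄ = m at *
  generalize u₁ / u₂ * s ^ 2 = d at *
  field_simp
  ring

end RElement

/-! ### Square roots -/

theorem abs_eq_sign_mul {y x : ℝ} (h : 0 < y * x) : |x| = Real.sign y * x := by
  rcases lt_trichotomy y 0 with hy | rfl | hy
  · have : x < 0 := by nlinarith
    rw [Real.sign_of_neg hy, abs_of_neg this]; ring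
  · simp at h
  · have : 0 < x := by nlinarith
    rw [Real.sign_of_pos hy, abs_of_pos this, one_mul]

section Roots

variable {a₁ a₂ a₃ a₄ b₁ b₂ b₃ b₄ A₃ A₄ B₃ B₄ c₃ c₄ η t t' : ℝ}

/-- To be read with aᵢ = (−uᵢs)_∞, bᵢ = (−uᵢ/s)_∞, Aᵢ = (−q²s/uᵢ)_∞, Bᵢ = (−q²/(uᵢs))_∞, t = s^k, t'
= s^(k+r) and η the sign of x₄^k. This collects the roots in the summand with s₄ = s;
`sqrt_combination_right` does so for s₄ = 1/s. The sign and the root on the right are the same in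
both. -/
theorem sqrt_combination_left (h₁ : 0 < a₁ * b₁) (h₂ : 0 < a₂ * b₂) (h₃ : 0 < a₃ * b₃)
    (h₄ : 0 < a₄ * b₄) (H₃ : 0 < A₃ * B₃) (H₄ : 0 < A₄ * B₄) (hc₃ : 0 < c₃) (hc₄ : 0 < c₄)
    (hη : η ^ 2 = 1) (ht : t ≠ 0) (ht' : t' ≠ 0) :
    √ (c₃ * t' * (a₃ * B₃) * (c₃ * t'⁻¹ * (b₃ * A₃))) *
        √ (η * c₄ * t⁻¹ * (b₄ * A₄) / (η * c₄ * t * (a₄ * B₄))) *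
        (√ (A₄ * B₄) / √ (A₃ * B₃) * (√ (a₂ * b₂) / √ (a₁ * b₁))) *
        (A₃ * a₁ / (A₄ * a₂) * (t / t')) =
      η * Real.sign (η * c₄ * t⁻¹ * (b₄ * A₄) * (b₄ * a₃ * a₁ * b₂)) *
        √ (a₄ * b₃ * b₁ * a₂ / (b₄ * a₃ * a₁ * b₂)) *
        (c₃ * t'⁻¹ * (b₃ * A₃) / (a₄ * b₃ * b₁ * a₂ / (b₄ * a₃ * a₁ * b₂))) := by
  have n₁ := left_ne_zero_of_mul h₁.ne'
  have n₂ := left_ne_zero_of_mul h₂.ne'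
  have n₃ := left_ne_zero_of_mul h₃.ne'
  have n₄ := left_ne_zero_of_mul h₄.ne'
  have m₁ := right_ne_zero_of_mul h₁.ne'
  have m₂ := right_ne_zero_of_mul h₂.ne'
  have m₃ := right_ne_zero_of_mul h₃.ne'
  have m₄ := right_ne_zero_of_mul h₄.ne'
  have N₃ := left_ne_zero_of_mul H₃.ne'
  have N₄ := left_ne_zero_of_mul H₄.ne'
  have M₃ := right_ne_zero_of_mul H₃.ne'
  have M₄ := right_ne_zero_of_mul H₄.ne'
  have hη0 : η ≠ 0 := by rintro rfl; norm_num at hη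
  have pW : 0 < a₄ * b₃ * b₁ * a₂ / (b₄ * a₃ * a₁ * b₂) := by
    have : a₄ * b₃ * b₁ * a₂ / (b₄ * a₃ * a₁ * b₂) =
      (a₄ * b₄) * (a₃ * b₃) * (a₁ * b₁) * (a₂ * b₂) / (b₄ * a₃ * a₁ * b₂) ^ 2 := by field_simp
    rw [this]; positivity
  have pT : 0 < η * c₄ * t⁻¹ * (b₄ * A₄) / (η * c₄ * t * (a₄ * B₄)) := by
    have : η * c₄ * t⁻¹ * (b₄ * A₄) / (η * c₄ * t * (a₄ * B₄)) =
      (a₄ * b₄) * (A₄ * B₄) / (t * a₄ * B₄) ^ 2 := by field_simp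
    rw [this]; positivity
  have pΘ : 0 < c₃ * t' * (a₃ * B₃) * (c₃ * t'⁻¹ * (b₃ * A₃)) := by
    have : c₃ * t' * (a₃ * B₃) * (c₃ * t'⁻¹ * (b₃ * A₃)) =
      c₃ ^ 2 * ((a₃ * b₃) * (A₃ * B₃)) := by field_simp
    rw [this]; positivity
  -- The product of roots has square K² times the quotient under the remaining root, hence equals
  -- |K| times that root. The sign of K is then found by exhibiting a product as a square times
  -- positive factors.
  set K := c₃ * A₄ * a₃ * b₄ * b₂ / (t * a₄ * b₁) with hK
  have hroot : √ (c₃ * t' * (a₃ * B₃) * (c₃ * t'⁻¹ * (b₃ * A₃))) *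
        √ (η * c₄ * t⁻¹ * (b₄ * A₄) / (η * c₄ * t * (a₄ * B₄))) *
        (√ (A₄ * B₄) / √ (A₃ * B₃) * (√ (a₂ * b₂) / √ (a₁ * b₁))) =
      |K| * √ (a₄ * b₃ * b₁ * a₂ / (b₄ * a₃ * a₁ * b₂)) := by
    refine (sq_eq_sq₀ (by positivity) (by positivity)).1 ?_
    simp only [mul_pow, div_pow, sq_abs]
    rw [Real.sq_sqrt pW.le, Real.sq_sqrt pT.le, Real.sq_sqrt pΘ.le, Real.sq_sqrt H₃.le,
      Real.sq_sqrt H₄.le, Real.sq_sqrt h₁.le, Real.sq_sqrt h₂.le, hK]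
    field_simp
  have hsign : |K| = Real.sign (η * c₄ * t⁻¹ * (b₄ * A₄) * (b₄ * a₃ * a₁ * b₂)) * (η * K) := by
    rw [← abs_eq_sign_mul, abs_mul, show |η| = 1 by rw [← sq_eq_sq₀ (abs_nonneg _) zero_le_one, sq_abs, hη, one_pow], one_mul]
    have : η * c₄ * t⁻¹ * (b₄ * A₄) * (b₄ * a₃ * a₁ * b₂) * (η * K) =
      η ^ 2 * c₄ * c₃ * (A₄ * a₃ * b₄ * b₂ / (t * a₄ * b₁)) ^ 2 * ((a₄ * b₄) * (a₁ * b₁)) := by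
      rw [hK]; field_simp
    rw [this, hη]
    positivity
  rw [hroot, hsign, hK]
  field_simp

theorem sqrt_combination_right (h₁ : 0 < a₁ * b₁) (h₂ : 0 < a₂ * b₂) (h₃ : 0 < a₃ * b₃)
    (h₄ : 0 < a₄ * b₄) (H₃ : 0 < A₃ * B₃) (H₄ : 0 < A₄ * B₄) (hc₃ : 0 < c₃) (hc₄ : 0 < c₄)
    (hη : η ^ 2 = 1) (ht : t ≠ 0) (ht' : t' ≠ 0) :
    √ (c₃ * t' * (a₃ * B₃) * (c₃ * t'⁻¹ * (b₃ * A₃))) *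
        √ (η * c₄ * t * (a₄ * B₄) / (η * c₄ * t⁻¹ * (b₄ * A₄))) *
        (√ (A₄ * B₄) / √ (A₃ * B₃) * (√ (a₂ * b₂) / √ (a₁ * b₁))) *
        (B₃ * b₁ / (B₄ * b₂) * (t' / t)) =
      η * Real.sign (η * c₄ * t⁻¹ * (b₄ * A₄) * (b₄ * a₃ * a₁ * b₂)) *
        √ (a₄ * b₃ * b₁ * a₂ / (b₄ * a₃ * a₁ * b₂)) * (c₃ * t' * (a₃ * B₃)) := by
  have n₁ := left_ne_zero_of_mul h₁.ne'
  have n₂ := left_ne_zero_of_mul h₂.ne'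
  have n₃ := left_ne_zero_of_mul h₃.ne'
  have n₄ := left_ne_zero_of_mul h₄.ne'
  have m₁ := right_ne_zero_of_mul h₁.ne'
  have m₂ := right_ne_zero_of_mul h₂.ne'
  have m₃ := right_ne_zero_of_mul h₃.ne'
  have m₄ := right_ne_zero_of_mul h₄.ne'
  have N₃ := left_ne_zero_of_mul H₃.ne'
  have N₄ := left_ne_zero_of_mul H₄.ne'
  have M₃ := right_ne_zero_of_mul H₃.ne'
  have M₄ := right_ne_zero_of_mul H₄.ne'
  have hη0 : η ≠ 0 := by rintro rfl; norm_num at hη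
  have pW : 0 < a₄ * b₃ * b₁ * a₂ / (b₄ * a₃ * a₁ * b₂) := by
    have : a₄ * b₃ * b₁ * a₂ / (b₄ * a₃ * a₁ * b₂) =
      (a₄ * b₄) * (a₃ * b₃) * (a₁ * b₁) * (a₂ * b₂) / (b₄ * a₃ * a₁ * b₂) ^ 2 := by field_simp
    rw [this]; positivity
  have pT : 0 < η * c₄ * t * (a₄ * B₄) / (η * c₄ * t⁻¹ * (b₄ * A₄)) := by
    have : η * c₄ * t * (a₄ * B₄) / (η * c₄ * t⁻¹ * (b₄ * A₄)) =
      (a₄ * b₄) * (A₄ * B₄) * t ^ 2 / (b₄ * A₄) ^ 2 := by field_simp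
    rw [this]; positivity
  have pΘ : 0 < c₃ * t' * (a₃ * B₃) * (c₃ * t'⁻¹ * (b₃ * A₃)) := by
    have : c₃ * t' * (a₃ * B₃) * (c₃ * t'⁻¹ * (b₃ * A₃)) =
      c₃ ^ 2 * ((a₃ * b₃) * (A₃ * B₃)) := by field_simp
    rw [this]; positivity
  set K := c₃ * t * B₄ * a₃ * b₂ / b₁ with hK
  have hroot : √ (c₃ * t' * (a₃ * B₃) * (c₃ * t'⁻¹ * (b₃ * A₃))) *
        √ (η * c₄ * t * (a₄ * B₄) / (η * c₄ * t⁻¹ * (b₄ * A₄))) *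
        (√ (A₄ * B₄) / √ (A₃ * B₃) * (√ (a₂ * b₂) / √ (a₁ * b₁))) =
      |K| * √ (a₄ * b₃ * b₁ * a₂ / (b₄ * a₃ * a₁ * b₂)) := by
    refine (sq_eq_sq₀ (by positivity) (by positivity)).1 ?_
    simp only [mul_pow, div_pow, sq_abs]
    rw [Real.sq_sqrt pW.le, Real.sq_sqrt pT.le, Real.sq_sqrt pΘ.le, Real.sq_sqrt H₃.le,
      Real.sq_sqrt H₄.le, Real.sq_sqrt h₁.le, Real.sq_sqrt h₂.le, hK]
    field_simp
  have hsign : |K| = Real.sign (η * c₄ * t⁻¹ * (b₄ * A₄) * (b₄ * a₃ * a₁ * b₂)) * (η * K) := by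
    rw [← abs_eq_sign_mul, abs_mul, show |η| = 1 by rw [← sq_eq_sq₀ (abs_nonneg _) zero_le_one, sq_abs, hη, one_pow], one_mul]
    have : η * c₄ * t⁻¹ * (b₄ * A₄) * (b₄ * a₃ * a₁ * b₂) * (η * K) =
      η ^ 2 * c₄ * c₃ * (a₃ * b₄ * b₂ / b₁) ^ 2 * ((A₄ * B₄) * (a₁ * b₁)) := by
      rw [hK]; field_simp
    rw [this, hη]
    positivity
  rw [hroot, hsign, hK]
  field_simp

end Roots

/-- Quasi-periodicity brings the thetas of r, which have unshifted arguments, to the shifted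
arguments −uᵢs^(±1) that occur in R. -/
theorem theta1_neg_eq_shift {q : ℝ} (hq0 : 0 < q) (hq1 : q < 1) (m : ℤ) {y : ℝ} (hy : y ≠ 0) :
    theta1 (q ^ 2) (-(y * q)) = y ^ m * q ^ (m ^ 2) * theta1 (q ^ 2) (-(q ^ (2 * m + 1) * y)) := by
  have hq := hq0.ne'
  have h := theta1_mul_zpow hq0 hq1 (w := -(y * q)) (by simp [hq, hy]) m
  have e1 : -(y * q) * q ^ (2 * m) = -(q ^ (2 * m + 1) * y) := by
    rw [zpow_add₀ hq, zpow_one]; ring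
  have e2 : q ^ (m - m ^ 2) = q ^ m * (q ^ (m ^ 2))⁻¹ := by
    rw [sub_eq_add_neg, zpow_add₀ hq, zpow_neg]
  rw [e1, neg_neg, zpow_neg, mul_zpow, e2] at h
  rw [h]
  field_simp

theorem theta1_neg_div {p u s : ℝ} : theta1 p (-(u / s)) =
    qInf1 p (-(u / s)) * qInf1 p (-(p * s / u)) := by
  rw [theta1, div_neg, div_div_eq_mul_div]

theorem theta1_neg_mul {p u s : ℝ} : theta1 p (-(u * s)) =
    qInf1 p (-(u * s)) * qInf1 p (-(p * s⁻¹ / u)) := by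
  rw [theta1, div_neg, mul_comm u s, ← div_div, div_eq_mul_inv p s]

/-- The quotient of infinite products whose root occurs in `rFormula`. -/
noncomputable def wSq (p u₁ u₂ u₃ u₄ s : ℝ) : ℝ :=
  qInf1 p (-(u₄ * s)) * qInf1 p (-(u₃ / s)) * qInf1 p (-(u₁ / s)) * qInf1 p (-(u₂ * s)) /
    (qInf1 p (-(u₄ / s)) * qInf1 p (-(u₃ * s)) * qInf1 p (-(u₁ * s)) * qInf1 p (-(u₂ / s)))

/-! ### The two summands of r at z = 1 as products -/

section RElement

variable {q : ℝ} (hq0 : 0 < q) (hq1 : q < 1) (k r l : ℤ) {α : ℝ} (hα : α = 1 ∨ α = -1)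

include hq0 in
theorem S_neg_inv (m : ℤ) (x s : ℝ) :
    S q (-m) x⁻¹ s = √ (qInf1 (q ^ 2) (-(q ^ 2 * s / shiftPar q 1 m x)) *
      qInf1 (q ^ 2) (-(q ^ 2 * s⁻¹ / shiftPar q 1 m x))) := by
  have hq := hq0.ne'
  have h : ∀ y : ℝ, x⁻¹ * y * q ^ (2 * -m + 1) = q ^ 2 * y / shiftPar q 1 m x := by
    intro y
    rw [← zpow_one_sub_mul_div hq0]
    ring_nf
  rw [S, h, h, qInf_cons, qInf_cons, qInf_nil, mul_one]

include hα in
theorem S_mul_sign (m : ℤ) (x s : ℝ) :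
    S q m x (α * s) = √ (qInf1 (q ^ 2) (-(shiftPar q α m x * s)) *
      qInf1 (q ^ 2) (-(shiftPar q α m x / s))) := by
  have hα' : α⁻¹ = α := by rcases hα with rfl | rfl <;> norm_num
  rw [S, mul_inv, hα', qInf_cons, qInf_cons, qInf_nil, mul_one]
  congr 4 <;> (unfold shiftPar; ring)

theorem S_inv (m : ℤ) (x s : ℝ) : S q m x s⁻¹ = S q m x s := by
  rw [S, S, inv_inv, qInf_cons, qInf_cons, qInf_cons, qInf_cons, qInf_nil]
  congr 1; ring

include hα in
theorem S_mul_sign_inv (m : ℤ) (x s : ℝ) : S q m x (α * s⁻¹) = S q m x (α * s) := by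
  have hα' : α⁻¹ = α := by rcases hα with rfl | rfl <;> norm_num
  rw [← S_inv m x (α * s), mul_inv, hα']

theorem rootSign_eq {x₁ x₂ x₃ x₄ u₁ u₂ u₃ u₄ : ℝ} (h₁ : shiftPar q α l x₁ = u₁)
    (h₂ : shiftPar q α (l + r) x₂ = u₂) (h₃ : shiftPar q 1 (k + r) x₃ = u₃)
    (h₄ : shiftPar q 1 k x₄ = u₄) (s : ℝ) :
    rootSign q k r l α x₁ x₂ x₃ x₄ s = Real.sign (theta1 (q ^ 2) (-(x₄ / s * q)) *
      (qInf1 (q ^ 2) (-(u₄ / s)) * qInf1 (q ^ 2) (-(u₃ * s)) * qInf1 (q ^ 2) (-(u₁ * s)) *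
        qInf1 (q ^ 2) (-(u₂ / s)))) := by
  have e₁ : α * q ^ (2 * l + 1) * (x₁ * s) = u₁ * s := by rw [← h₁, shiftPar]; ring
  have e₂ : α * q ^ (2 * (l + r) + 1) * (x₂ / s) = u₂ / s := by rw [← h₂, shiftPar]; ring
  have e₃ : q ^ (2 * (k + r) + 1) * (x₃ * s) = u₃ * s := by rw [← h₃, shiftPar]; ring
  have e₄ : q ^ (2 * k + 1) * (x₄ / s) = u₄ / s := by rw [← h₄, shiftPar]; ring
  rw [rootSign, e₁, e₂, e₃, e₄, theta_cons, theta_nil]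
  simp only [qInf_cons, qInf_nil, mul_one, mul_assoc]

include hq0 hq1 hα in
/-- At `z = 1`, `s₄ = s₃` and regular parameters, both summands of `r` are products. -/
theorem rElt_eq_prod {η α' Z x₁ x₂ x₃ x₄ u₁ u₂ u₃ u₄ s : ℝ} (hη : η = 1 ∨ η = -1)
    (hx₃ : 0 < x₃) (hx₄ : 0 < η * x₄) (h₁ : shiftPar q α l x₁ = u₁)
    (h₂ : shiftPar q α (l + r) x₂ = u₂) (h₃ : shiftPar q 1 (k + r) x₃ = u₃)
    (h₄ : shiftPar q 1 k x₄ = u₄) (hA : Adm (q ^ 2) u₁ u₂ u₃ u₄ s)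
    (hreg : ∀ n : ℕ, u₁ / u₄ * (q ^ 2) ^ n ≠ 1)
    (hreg' : ∀ n : ℕ, q ^ 2 * (u₁ / u₃) * (q ^ 2) ^ n ≠ 1)
    (hreg'' : ∀ n : ℕ, q ^ 2 * (u₁ / u₄) * s⁻¹ ^ 2 * (q ^ 2) ^ n ≠ 1)
    (hY : qInf1 (q ^ 2) (q ^ 2 * (x₁ / x₂) * s⁻¹ ^ 2) ≠ 0) :
    rElt q k r l 1 α (α * α') Z x₁ x₂ x₃ x₄ s s =
      η ^ k * α ^ r * rootSign q k r l α x₁ x₂ x₃ x₄ s *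
        (iota s * (qInf1 (q ^ 2) (q ^ 2 * (x₁ / x₂)) / qInf1 (q ^ 2) (q ^ 2)) *
          (q ^ (l - k) / (1 - u₁ / u₄)) * √ (wSq (q ^ 2) u₁ u₂ u₃ u₄ s) *
          (theta1 (q ^ 2) (-(x₃ / s * q)) * (theta1 (q ^ 2) (-(α * x₂ * s * q)) *
              theta1 (q ^ 2) (-(α' * (Z / x₂) * s * q)) *
              theta1 (q ^ 2) (-(α * α' * (Z / x₃) / s * q))) / wSq (q ^ 2) u₁ u₂ u₃ u₄ s -
            theta1 (q ^ 2) (-(x₃ * s * q)) * (theta1 (q ^ 2) (-(α * x₂ / s * q)) *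
              theta1 (q ^ 2) (-(α' * (Z / x₂) / s * q)) *
              theta1 (q ^ 2) (-(α * α' * (Z / x₃) * s * q))))) := by
  have hα0 : α ≠ 0 := by rcases hα with rfl | rfl <;> norm_num
  have hp0 : 0 < q ^ 2 := by positivity
  have hp1 : q ^ 2 < 1 := pow_lt_one₀ hq0.le hq1 (by norm_num)
  have hq := hq0.ne'
  have hs := hA.s_ne
  have hx₄0 : x₄ ≠ 0 := fun h => by rw [h, mul_zero] at hx₄; exact hx₄.false
  have hηk : (η ^ k) ^ 2 = 1 := by
    rw [← zpow_natCast, ← zpow_mul, mul_comm, zpow_mul]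
    rcases hη with rfl | rfl <;> norm_num
  have hηη : η * η = 1 := by rcases hη with rfl | rfl <;> norm_num
  -- Only ηx₄ is known to be positive; the sign η^k split off here reappears in the result.
  have hx₄k : x₄ ^ k = η ^ k * (η * x₄) ^ k := by
    rw [← mul_zpow, ← mul_assoc, hηη, one_mul]
  have hT : theta1 (q ^ 2) (-(x₄ / s * q)) = η ^ k * (q ^ (k ^ 2) * (η * x₄) ^ k) * (s ^ k)⁻¹ *
      (qInf1 (q ^ 2) (-(u₄ / s)) * qInf1 (q ^ 2) (-(q ^ 2 * s / u₄))) := by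
    rw [theta1_neg_eq_shift hq0 hq1 k (by positivity), ← theta1_neg_div, div_zpow, hx₄k, ← h₄,
      shiftPar, mul_div_assoc, one_mul]
    field_simp
  have hT' : theta1 (q ^ 2) (-(x₄ * s * q)) = η ^ k * (q ^ (k ^ 2) * (η * x₄) ^ k) * s ^ k *
      (qInf1 (q ^ 2) (-(u₄ * s)) * qInf1 (q ^ 2) (-(q ^ 2 * s⁻¹ / u₄))) := by
    rw [theta1_neg_eq_shift hq0 hq1 k (by positivity), ← theta1_neg_mul, mul_zpow, hx₄k, ← h₄,
      shiftPar, one_mul, mul_assoc (q ^ (2 * k + 1))]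
    ring
  have hΘ : theta1 (q ^ 2) (-(x₃ / s * q)) = q ^ ((k + r) ^ 2) * x₃ ^ (k + r) *
      (s ^ (k + r))⁻¹ *
      (qInf1 (q ^ 2) (-(u₃ / s)) * qInf1 (q ^ 2) (-(q ^ 2 * s / u₃))) := by
    rw [theta1_neg_eq_shift hq0 hq1 (k + r) (by positivity), ← theta1_neg_div, div_zpow, ← h₃,
      shiftPar, mul_div_assoc, one_mul]
    field_simp
  have hΘ' : theta1 (q ^ 2) (-(x₃ * s * q)) = q ^ ((k + r) ^ 2) * x₃ ^ (k + r) * s ^ (k + r) *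
      (qInf1 (q ^ 2) (-(u₃ * s)) * qInf1 (q ^ 2) (-(q ^ 2 * s⁻¹ / u₃))) := by
    rw [theta1_neg_eq_shift hq0 hq1 (k + r) (by positivity), ← theta1_neg_mul, mul_zpow, ← h₃,
      shiftPar, one_mul, mul_assoc (q ^ (2 * (k + r) + 1))]
    ring
  have hτ : s ^ (-r) = s ^ k / s ^ (k + r) := by
    rw [zpow_add₀ hs, zpow_neg]; field_simp
  have hτ' : s⁻¹ ^ (-r) = s ^ (k + r) / s ^ k := by
    rw [inv_zpow, zpow_neg, inv_inv, zpow_add₀ hs]; field_simp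
  have hθ₃ := hA.theta₃
  have hθ₄ := hA.theta₄
  -- Each product of two thetas splits into a pair already known to be positive and the pair
  -- (−q²s/uᵢ)_∞ (−q²/(uᵢs))_∞ under the roots S₋ₖ or S₋ₖ₋ᵣ; so the latter pair is positive as well.
  rw [theta1_neg_div, theta1_neg_mul, mul_mul_mul_comm, mul_comm (qInf1 _ (-(q ^ 2 * s⁻¹ / _)))]
    at hθ₃ hθ₄
  have H₃ := pos_of_mul_pos_right hθ₃ hA.pos₃.le
  have H₄ := pos_of_mul_pos_right hθ₄ hA.pos₄.le
  have hc₃ : 0 < q ^ ((k + r) ^ 2) * x₃ ^ (k + r) := by positivity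
  have hc₄ : 0 < q ^ (k ^ 2) * (η * x₄) ^ k := by positivity
  have ht : s ^ k ≠ 0 := zpow_ne_zero _ hs
  have ht' : s ^ (k + r) ≠ 0 := zpow_ne_zero _ hs
  have L := sqrt_combination_left hA.pos₁ hA.pos₂ hA.pos₃ hA.pos₄ H₃ H₄ hc₃ hc₄ hηk ht ht'
  have L' := sqrt_combination_right hA.pos₁ hA.pos₂ hA.pos₃ hA.pos₄ H₃ H₄ hc₃ hc₄ hηk ht ht'
  rw [← hT, ← hT', ← hΘ, ← hΘ', ← wSq] at L L'
  have hsign := rootSign_eq k r l h₁ h₂ h₃ h₄ s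
  rw [← hsign] at L L'
  have hss := ne_zpow_of_theta1_ne_zero hp0 hp1 hA.theta_s
  have hρ := ne_zpow_of_theta1_ne_zero hp0 hp1 hA.theta_ρ
  have hρs := ne_zpow_of_theta1_ne_zero hp0 hp1 hA.theta_ρs
  have n1 : qInf1 (q ^ 2) (q ^ 2 * s ^ 2) ≠ 0 := qInf1_ne_zero hp0 hp1
    (mul_pow_ne_one_of_ne_zpow hp0 (mul_self_ne_zpow hp0 hss))
  have n2 : qInf1 (q ^ 2) (q ^ 2 * s⁻¹ ^ 2) ≠ 0 := by
    rw [inv_pow]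
    exact qInf1_ne_zero hp0 hp1
      (mul_pow_ne_one_of_ne_zpow hp0 (mul_self_ne_zpow hp0 (inv_ne_zpow hss)))
  have e1 : q ^ 2 * (u₁ / u₂) * (q ^ 2) ^ r = q ^ 2 * (x₁ / x₂) := by
    rw [← h₁, ← h₂, ← shiftPar_one_div_two hq0 r l hα0, neg_mul, zpow_neg, zpow_mul,
      ← zpow_natCast q 2]
    push_cast
    have : (q ^ (2 : ℤ)) ^ r ≠ 0 := by positivity
    field_simp
  have n3 : qInf1 (q ^ 2) (q ^ 2 * (x₁ / x₂) * s ^ 2) ≠ 0 := by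
    rw [← e1, show q ^ 2 * (u₁ / u₂) * (q ^ 2) ^ r * s ^ 2 =
      q ^ 2 * (u₁ / u₂ * s ^ 2) * (q ^ 2) ^ r by ring]
    exact qInf1_ne_zero hp0 hp1 (mul_zpow_mul_pow_ne_one hp0 (mul_self_ne_zpow hp0 hρs) r)
  have n4 : 1 - u₁ / u₄ ≠ 0 := fun h0 => hreg 0 (by rw [pow_zero, mul_one]; linarith)
  have n5 := qInf1_self_ne_zero hp0 hp1
  have hc : c q 1 x₁ x₂ x₄ s s = √ (theta1 (q ^ 2) (-(x₄ / s * q)) /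
      theta1 (q ^ 2) (-(x₄ * s * q))) * (qInf1 (q ^ 2) (q ^ 2 * (x₁ / x₂)) *
        qInf1 (q ^ 2) (q ^ 2 * (x₁ / x₂) * s ^ 2) /
        (qInf1 (q ^ 2) (q ^ 2 * s ^ 2) * qInf1 (q ^ 2) (q ^ 2))) := by
    simp only [c, theta_cons, theta_nil, qInf_cons, qInf_nil, mul_one, one_mul, div_self hs,
      ← pow_two s]
  have hc' : c q 1 x₁ x₂ x₄ s s⁻¹ = √ (theta1 (q ^ 2) (-(x₄ * s * q)) /
      theta1 (q ^ 2) (-(x₄ / s * q))) * (qInf1 (q ^ 2) (q ^ 2 * (x₁ / x₂) * s⁻¹ ^ 2) *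
        qInf1 (q ^ 2) (q ^ 2 * (x₁ / x₂)) /
        (qInf1 (q ^ 2) (q ^ 2) * qInf1 (q ^ 2) (q ^ 2 * s⁻¹ ^ 2))) := by
    have g1 : s⁻¹ / s = s⁻¹ ^ 2 := by rw [pow_two]; rfl
    simp only [c, theta_cons, theta_nil, qInf_cons, qInf_nil, mul_one, one_mul, g1,
      mul_inv_cancel₀ hs, div_inv_eq_mul, ← div_eq_mul_inv x₄ s]
  have hS : S q (-k) x₄⁻¹ s / S q (-k - r) x₃⁻¹ s *
      (S q (l + r) x₂ (α * s) / S q l x₁ (α * s)) =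
      √ (qInf1 (q ^ 2) (-(q ^ 2 * s / u₄)) * qInf1 (q ^ 2) (-(q ^ 2 * s⁻¹ / u₄))) /
        √ (qInf1 (q ^ 2) (-(q ^ 2 * s / u₃)) * qInf1 (q ^ 2) (-(q ^ 2 * s⁻¹ / u₃))) *
      (√ (qInf1 (q ^ 2) (-(u₂ * s)) * qInf1 (q ^ 2) (-(u₂ / s))) /
        √ (qInf1 (q ^ 2) (-(u₁ * s)) * qInf1 (q ^ 2) (-(u₁ / s)))) := by
    rw [show -k - r = -(k + r) by ring, S_neg_inv hq0, S_neg_inv hq0, S_mul_sign hα,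
      S_mul_sign hα, h₁, h₂, h₃, h₄]
  have ha₂ := left_ne_zero_of_mul hA.pos₂.ne'
  have hb₂ := right_ne_zero_of_mul hA.pos₂.ne'
  have hA₄ := left_ne_zero_of_mul H₄.ne'
  have hB₄ := right_ne_zero_of_mul H₄.ne'
  have t1 : α * α' * α⁻¹ * (Z / x₂) = α' * (Z / x₂) := by field_simp
  rw [rElt, R_diag hq0 hq1 k r l hα0 h₁ h₂ h₃ h₄ hA hreg,
    R_antidiag hq0 hq1 k r l hα0 h₁ h₂ h₃ h₄ hA hreg hreg' hreg'' hY, S_inv, S_mul_sign_inv hα,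
    hS, hc, hc', hτ, hτ', t1]
  simp only [theta_cons, theta_nil, inv_one, mul_one, ← div_eq_mul_inv u₁ s,
    ← div_eq_mul_inv u₂ s]
  generalize theta1 (q ^ 2) (-(α * x₂ * s * q)) = θ1
  generalize theta1 (q ^ 2) (-(α' * (Z / x₂) * s * q)) = θ2
  generalize theta1 (q ^ 2) (-(α * α' * (Z / x₃) / s * q)) = θ3
  generalize theta1 (q ^ 2) (-(α * x₂ / s * q)) = θ4
  generalize theta1 (q ^ 2) (-(α' * (Z / x₂) / s * q)) = θ5
  generalize theta1 (q ^ 2) (-(α * α' * (Z / x₃) * s * q)) = θ6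
  generalize √ (qInf1 (q ^ 2) (-(q ^ 2 * s / u₄)) * qInf1 (q ^ 2) (-(q ^ 2 * s⁻¹ / u₄))) /
        √ (qInf1 (q ^ 2) (-(q ^ 2 * s / u₃)) * qInf1 (q ^ 2) (-(q ^ 2 * s⁻¹ / u₃))) *
      (√ (qInf1 (q ^ 2) (-(u₂ * s)) * qInf1 (q ^ 2) (-(u₂ / s))) /
        √ (qInf1 (q ^ 2) (-(u₁ * s)) * qInf1 (q ^ 2) (-(u₁ / s)))) = SS at L L' ⊢
  generalize √ (wSq (q ^ 2) u₁ u₂ u₃ u₄ s) = W at *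
  generalize wSq (q ^ 2) u₁ u₂ u₃ u₄ s = W2 at *
  generalize √ (theta1 (q ^ 2) (-(x₃ * s * q)) * theta1 (q ^ 2) (-(x₃ / s * q))) = U at *
  generalize √ (theta1 (q ^ 2) (-(x₄ / s * q)) / theta1 (q ^ 2) (-(x₄ * s * q))) = U1 at *
  generalize √ (theta1 (q ^ 2) (-(x₄ * s * q)) / theta1 (q ^ 2) (-(x₄ / s * q))) = U2 at *
  generalize theta1 (q ^ 2) (-(x₃ / s * q)) = Θm at *
  generalize theta1 (q ^ 2) (-(x₃ * s * q)) = Θp at *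
  generalize rootSign q k r l α x₁ x₂ x₃ x₄ s = ς at *
  generalize s ^ k / s ^ (k + r) = t1 at *
  generalize s ^ (k + r) / s ^ k = t2 at *
  generalize qInf1 (q ^ 2) (q ^ 2 * (x₁ / x₂)) = y1 at *
  generalize qInf1 (q ^ 2) (q ^ 2 * (x₁ / x₂) * s ^ 2) = y2 at *
  generalize qInf1 (q ^ 2) (q ^ 2 * (x₁ / x₂) * s⁻¹ ^ 2) = y3 at *
  generalize qInf1 (q ^ 2) (q ^ 2 * s ^ 2) = y4 at *
  generalize qInf1 (q ^ 2) (q ^ 2 * s⁻¹ ^ 2) = y5 at *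
  generalize qInf1 (q ^ 2) (q ^ 2) = y6 at *
  generalize 1 - u₁ / u₄ = m at *
  -- The infinite products in x₁/x₂ and s in the numerator of c(s₄^(±1)) cancel those in the
  -- denominator of R; for s₄ = 1/s this is where `hY` is needed.
  have c1 : ∀ A a A' a' : ℝ, y1 * y2 / (y4 * y6) * (A * a * y4 / (m * A' * a' * y2)) =
      y1 / y6 / m * (A * a / (A' * a')) := fun A a A' a' => by
    simp only [div_eq_mul_inv, mul_inv]
    have h : y4 * y4⁻¹ * (y2 * y2⁻¹) = 1 := by
      rw [mul_inv_cancel₀ n1, mul_inv_cancel₀ n3, one_mul]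
    linear_combination (y1 * y6⁻¹ * m⁻¹ * A * a * A'⁻¹ * a'⁻¹) * h
  have c2 : ∀ A a A' a' : ℝ, y3 * y1 / (y6 * y5) * (A * a * y5 / (m * A' * a' * y3)) =
      y1 / y6 / m * (A * a / (A' * a')) := fun A a A' a' => by
    simp only [div_eq_mul_inv, mul_inv]
    have h : y5 * y5⁻¹ * (y3 * y3⁻¹) = 1 := by
      rw [mul_inv_cancel₀ n2, mul_inv_cancel₀ hY, one_mul]
    linear_combination (y1 * y6⁻¹ * m⁻¹ * A * a * A'⁻¹ * a'⁻¹) * h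
  have d1 := c1 (qInf1 (q ^ 2) (-(q ^ 2 * s / u₃))) (qInf1 (q ^ 2) (-(u₁ * s)))
    (qInf1 (q ^ 2) (-(q ^ 2 * s / u₄))) (qInf1 (q ^ 2) (-(u₂ * s)))
  have d2 := c2 (qInf1 (q ^ 2) (-(q ^ 2 * s⁻¹ / u₃))) (qInf1 (q ^ 2) (-(u₁ / s)))
    (qInf1 (q ^ 2) (-(q ^ 2 * s⁻¹ / u₄))) (qInf1 (q ^ 2) (-(u₂ / s)))
  linear_combination iota s * U * U1 * SS * (θ1 * (θ2 * θ3)) * (α ^ r * t1 * q ^ (l - k)) * d1 -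
    iota s * U * U2 * SS * (θ4 * (θ5 * θ6)) * (α ^ r * t2 * q ^ (l - k)) * d2 +
    iota s * (y1 / y6 / m) * (θ1 * (θ2 * θ3)) * (α ^ r * q ^ (l - k)) * L -
    iota s * (y1 / y6 / m) * (θ4 * (θ5 * θ6)) * (α ^ r * q ^ (l - k)) * L'

end RElement

/-- The expression `rFormula` with its hypergeometric part in the regularized form `vReg`;
here `uᵢ` are the shifted parameters. -/
noncomputable def rReg (q : ℝ) (k r l : ℤ) (α α' Z x₁ x₂ x₃ x₄ u₁ u₂ u₃ u₄ s : ℝ) : ℝ :=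
  q * (x₃ / s) * iota s * (qInf1 (q ^ 2) (q ^ 2 * (x₁ / x₂)) / qInf1 (q ^ 2) (q ^ 2)) *
    √ (wSq (q ^ 2) u₁ u₂ u₃ u₄ s) *
  ((-α) ^ (l - k) * q ^ ((l - k) ^ 2) * (x₁ / x₄) ^ (l - k) *
      (qInf1 (q ^ 2) (q ^ 2 * (u₁ / u₄)) * qInf1 (q ^ 2) (q ^ 2 * (u₄ / u₁))) *
      (theta1 (q ^ 2) (α * α' * q ^ 2 * Z) * theta1 (q ^ 2) (α' * (Z / x₂ / x₃)) *
        theta1 (q ^ 2) (s ^ 2)) +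
    q ^ (l + k) * (x₁ / x₂) *
      vReg (q ^ 2) (u₁ / u₄) (u₁ / u₂) (s ^ 2)⁻¹ (-(q ^ 2 / (u₃ * s))) (-(u₁ / s)) *
      (theta1 (q ^ 2) (-(α * q * (x₂ * s))) * theta1 (q ^ 2) (-(α' * q * (Z / x₂ * s))) *
        theta1 (q ^ 2) (-(q * (x₃ / s))) * theta1 (q ^ 2) (-(α * α' * q * (Z / x₃ / s)))) *
      ((1 - q ^ (2 * r) * (x₂ / x₁)) * (1 - s ^ 2) / (1 - q ^ 2)))

/-! ### The series `vReg` at admissible parameters -/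

namespace Adm

variable {p u₁ u₂ u₃ u₄ s : ℝ}

variable (hp0 : 0 < p) (hp1 : p < 1) (hA : Adm p u₁ u₂ u₃ u₄ s)
include hp0 hp1 hA

theorem neg_u₁_div_ne (n : ℤ) : -(u₁ / s) ≠ p ^ n :=
  ne_zpow_of_theta1_ne_zero hp0 hp1 (right_ne_zero_of_mul hA.theta₁.ne') n

theorem neg_u₂_mul_ne (n : ℤ) : -(u₂ * s) ≠ p ^ n :=
  ne_zpow_of_theta1_ne_zero hp0 hp1 (left_ne_zero_of_mul hA.theta₂.ne') n

theorem neg_u₃_mul_ne (n : ℤ) : -(u₃ * s) ≠ p ^ n :=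
  ne_zpow_of_theta1_ne_zero hp0 hp1 (left_ne_zero_of_mul hA.theta₃.ne') n

theorem neg_u₃_div_ne (n : ℤ) : -(u₃ / s) ≠ p ^ n :=
  ne_zpow_of_theta1_ne_zero hp0 hp1 (right_ne_zero_of_mul hA.theta₃.ne') n

theorem neg_u₄_mul_ne (n : ℤ) : -(u₄ * s) ≠ p ^ n :=
  ne_zpow_of_theta1_ne_zero hp0 hp1 (left_ne_zero_of_mul hA.theta₄.ne') n

theorem neg_u₄_div_ne (n : ℤ) : -(u₄ / s) ≠ p ^ n :=
  ne_zpow_of_theta1_ne_zero hp0 hp1 (right_ne_zero_of_mul hA.theta₄.ne') n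

theorem denom_ne (n : ℤ) : -(p / (u₃ * s)) ≠ p ^ n := by
  have := mul_self_ne_zpow hp0 (inv_ne_zpow (hA.neg_u₃_mul_ne hp0 hp1)) n
  rwa [inv_neg, mul_neg, ← div_eq_mul_inv] at this

omit hp1 in
-- This and the next two identities use D = −p/(u₃s), together with u₂u₄ = u₁u₃ in the first two.
-- They identify the numerators Ap/D, Bp/D, Cp/D of the second series in `vReg` with those of the
-- ₃φ₂ in v.
theorem numer₁_eq : u₁ / u₄ * p / (-(p / (u₃ * s))) = -(u₂ * s) := by
  have := hp0.ne'
  have := hA.s_ne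
  have := hA.u₃_ne
  have := hA.u₄_ne
  have h : u₂ = u₁ * u₃ / u₄ := by rw [← hA.rel]; field_simp
  rw [h]; field_simp

omit hp1 in
theorem numer₂_eq : u₁ / u₂ * p / (-(p / (u₃ * s))) = -(u₄ * s) := by
  have := hp0.ne'
  have := hA.s_ne
  have := hA.u₃_ne
  have := hA.u₂_ne
  have h : u₄ = u₁ * u₃ / u₂ := by rw [← hA.rel]; field_simp
  rw [h]; field_simp

omit hp1 in
theorem numer₃_eq : (s ^ 2)⁻¹ * p / (-(p / (u₃ * s))) = -(u₃ / s) := by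
  have := hp0.ne'
  have := hA.s_ne
  have := hA.u₃_ne
  field_simp

omit hp0 hp1 in
theorem balanced : -(p / (u₃ * s)) * -(u₁ / s) = u₁ / u₄ * (u₁ / u₂) * (s ^ 2)⁻¹ * p := by
  have := hA.s_ne
  have := hA.u₂_ne
  have := hA.u₁_ne
  have := hA.u₃_ne
  have := hA.u₄_ne
  have h : u₂ = u₁ * u₃ / u₄ := by rw [← hA.rel]; field_simp
  rw [h]; field_simp

/-- The product form of `vReg` for admissible parameters. -/
theorem vReg_eq_wSq :
    p * ((1 - u₁ / u₄) * (1 - u₁ / u₂) * (1 - (s ^ 2)⁻¹)) *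
        vReg p (u₁ / u₄) (u₁ / u₂) (s ^ 2)⁻¹ (-(p / (u₃ * s))) (-(u₁ / s)) =
      p / (u₃ * s) * (1 - p) * (1 / wSq p u₁ u₂ u₃ u₄ s - 1) := by
  have hp := hp0.ne'
  have hs := hA.s_ne
  have hu₂ := hA.u₂_ne
  have hu₁ := hA.u₁_ne
  have hu₃ := hA.u₃_ne
  have hu₄ := hA.u₄_ne
  have m := fun {x : ℝ} (hx : ∀ n : ℤ, x ≠ p ^ n) => mul_pow_ne_one_of_ne_zpow hp0 hx
  have key := vReg_eq hp0 hp1 (A := u₁ / u₄) (B := u₁ / u₂) (C := (s ^ 2)⁻¹)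
    (D := -(p / (u₃ * s))) (E := -(u₁ / s)) (by simp [hp, hu₃, hs]) hA.balanced
    (m (hA.denom_ne hp0 hp1)) (m (hA.neg_u₁_div_ne hp0 hp1))
    (by rw [hA.numer₁_eq hp0]; exact m (hA.neg_u₂_mul_ne hp0 hp1))
    (by rw [hA.numer₂_eq hp0]; exact m (hA.neg_u₄_mul_ne hp0 hp1))
    (by rw [hA.numer₃_eq hp0]; exact m (hA.neg_u₃_div_ne hp0 hp1))
  have h₄ : u₄ = u₁ * u₃ / u₂ := by rw [← hA.rel]; field_simp
  have e1 : p / (-(p / (u₃ * s))) = -(u₃ * s) := by field_simp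
  have e2 : u₁ / u₂ * (s ^ 2)⁻¹ * p / (-(p / (u₃ * s))) = -(u₄ / s) := by
    rw [h₄]; field_simp
  have e3 : u₁ / u₄ * (s ^ 2)⁻¹ * p / (-(p / (u₃ * s))) = -(u₂ / s) := by
    rw [h₄]; field_simp
  have e4 : u₁ / u₄ * (u₁ / u₂) * p / (-(p / (u₃ * s))) = -(u₁ * s) := by
    rw [h₄]; field_simp
  rw [hA.numer₁_eq hp0, hA.numer₂_eq hp0, hA.numer₃_eq hp0, e1, e2, e3, e4, neg_neg] at key
  rw [key, wSq, one_div_div]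
  congr 2
  ring

end Adm

/-- The addition formula in the form that relates the two summands of `r`. -/
theorem theta1_relation {q : ℝ} (hq0 : 0 < q) (hq1 : q < 1) {α α' Z x₁ x₂ x₃ x₄ s : ℝ}
    (hα : α = 1 ∨ α = -1) (hα' : α' = 1 ∨ α' = -1) (hZ : Z ≠ 0) (hx₁ : x₁ ≠ 0) (hx₂ : x₂ ≠ 0)
    (hx₃ : x₃ ≠ 0) (hx₄ : x₄ ≠ 0) (hs : s ≠ 0) (hx : x₂ * x₄ = x₁ * x₃) :
    q * (x₃ / s) * theta1 (q ^ 2) (α * (x₁ / x₄)) *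
        (theta1 (q ^ 2) (α * α' * q ^ 2 * Z) * theta1 (q ^ 2) (α' * (Z / x₂ / x₃)) *
          theta1 (q ^ 2) (s ^ 2)) =
      theta1 (q ^ 2) (-(x₃ / s * q)) * (theta1 (q ^ 2) (-(α * x₂ * s * q)) *
          theta1 (q ^ 2) (-(α' * (Z / x₂) * s * q)) *
          theta1 (q ^ 2) (-(α * α' * (Z / x₃) / s * q))) -
        theta1 (q ^ 2) (-(x₃ * s * q)) * (theta1 (q ^ 2) (-(α * x₂ / s * q)) *
          theta1 (q ^ 2) (-(α' * (Z / x₂) / s * q)) *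
          theta1 (q ^ 2) (-(α * α' * (Z / x₃) * s * q))) := by
  have hp0 : 0 < q ^ 2 := by positivity
  have hp1 : q ^ 2 < 1 := pow_lt_one₀ hq0.le hq1 (by norm_num)
  have hq := hq0.ne'
  have hαα : α ^ 2 = 1 := by rcases hα with rfl | rfl <;> norm_num
  have hαα' : α' ^ 2 = 1 := by rcases hα' with rfl | rfl <;> norm_num
  have hα0 : α ≠ 0 := by rintro rfl; norm_num at hαα
  have hα0' : α' ≠ 0 := by rintro rfl; norm_num at hαα'
  have hαi : α = α⁻¹ := eq_inv_of_mul_eq_one_left (by rw [← pow_two, hαα])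
  have hαi' : α' = α'⁻¹ := eq_inv_of_mul_eq_one_left (by rw [← pow_two, hαα'])
  -- With these values the six quotients and products pairing s, 1/s and g reproduce all theta
  -- arguments of r up to inversion, reflection x ↦ p/x and one shift by p. The balancing condition
  -- abg·def = q² holds because α² = α'² = 1.
  have key := theta1_three_term hp0 hp1 (a := s) (b := s⁻¹) (g := -(α * x₂ * q))
    (d := -(q / x₃)) (e := -(α' * (Z / x₂) * q)) (f := -(α * α' * (x₃ / (q * Z))))
    hs (by positivity) (by simp [hα0, hx₂, hq]) (by simp [hx₃, hq])
    (by simp [hα0', hx₂, hq, hZ]) (by simp [hα0, hα0', hx₃, hq, hZ])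
    (by field_simp; rw [hαα, hαα']; ring)
  have hx₁₄ : x₂ / x₃ = x₁ / x₄ := by field_simp; linarith
  have e1 : s / s⁻¹ = s ^ 2 := by rw [div_inv_eq_mul, pow_two]
  have e2 : -(α * x₂ * q) * -(q / x₃) = α * (x₁ / x₄) * q ^ 2 := by rw [← hx₁₄]; ring
  have e3 : -(α * x₂ * q) * -(α' * (Z / x₂) * q) = α * α' * q ^ 2 * Z := by field_simp
  have e4 : -(α * x₂ * q) * -(α * α' * (x₃ / (q * Z))) = (α' * (Z / x₂ / x₃))⁻¹ := by
    rw [mul_inv, ← hαi']; field_simp; rw [hαα]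
  have e5 : s⁻¹ / -(α * x₂ * q) = (-(α * x₂ * s * q))⁻¹ := by field_simp
  have e6 : s * -(q / x₃) = q ^ 2 / (-(x₃ / s * q)) := by field_simp
  have e7 : s * -(α' * (Z / x₂) * q) = -(α' * (Z / x₂) * s * q) := by ring
  have e8 : s * -(α * α' * (x₃ / (q * Z))) = (-(α * α' * (Z / x₃) / s * q))⁻¹ := by
    rw [inv_neg, mul_inv, mul_div_assoc, mul_inv, mul_inv, ← hαi, ← hαi']; field_simp
  have e9 : -(α * x₂ * q) / s = -(α * x₂ / s * q) := by ring
  have e10 : s⁻¹ * -(q / x₃) = q ^ 2 / (-(x₃ * s * q)) := by field_simp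
  have e11 : s⁻¹ * -(α' * (Z / x₂) * q) = -(α' * (Z / x₂) / s * q) := by field_simp
  have e12 : s⁻¹ * -(α * α' * (x₃ / (q * Z))) = (-(α * α' * (Z / x₃) * s * q))⁻¹ := by
    rw [inv_neg, mul_inv, mul_inv, mul_inv, mul_inv, ← hαi, ← hαi']; field_simp
  rw [e1, e2, e3, e4, e5, e6, e7, e8, e9, e10, e11, e12,
    theta1_mul_self hp0 hp1 (by positivity), theta1_inv hp0 hp1 (by positivity),
    theta1_inv hp0 hp1 (x := -(α * x₂ * s * q)) (by simp [hα0, hx₂, hs, hq]),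
    theta1_inv hp0 hp1 (x := -(α * α' * (Z / x₃) / s * q)) (by simp [hα0, hα0', hx₃, hs, hq, hZ]),
    theta1_inv hp0 hp1 (x := -(α * α' * (Z / x₃) * s * q)) (by simp [hα0, hα0', hx₃, hs, hq, hZ]),
    theta1_div_self hp0, theta1_div_self hp0] at key
  rw [← hx₁₄] at key ⊢
  generalize theta1 (q ^ 2) (α * (x₂ / x₃)) = θ1 at *
  generalize theta1 (q ^ 2) (α * α' * q ^ 2 * Z) = θ2 at *
  generalize theta1 (q ^ 2) (α' * (Z / x₂ / x₃)) = θ3 at *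
  generalize theta1 (q ^ 2) (s ^ 2) = θ4 at *
  generalize theta1 (q ^ 2) (-(x₃ / s * q)) = θ5 at *
  generalize theta1 (q ^ 2) (-(α * x₂ * s * q)) = θ6 at *
  generalize theta1 (q ^ 2) (-(α' * (Z / x₂) * s * q)) = θ7 at *
  generalize theta1 (q ^ 2) (-(α * α' * (Z / x₃) / s * q)) = θ8 at *
  generalize theta1 (q ^ 2) (-(x₃ * s * q)) = θ9 at *
  generalize theta1 (q ^ 2) (-(α * x₂ / s * q)) = θ10 at *
  generalize theta1 (q ^ 2) (-(α' * (Z / x₂) / s * q)) = θ11 at *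
  generalize theta1 (q ^ 2) (-(α * α' * (Z / x₃) * s * q)) = θ12 at *
  field_simp at key ⊢
  refine mul_left_cancel₀ hx₃ ?_
  linear_combination key

/-! ### The closed formula for r at regular points -/

section RElement

variable {q : ℝ} (hq0 : 0 < q) (hq1 : q < 1) (k r l : ℤ) {α : ℝ} (hα : α = 1 ∨ α = -1)

include hq0 hq1 hα in
/-- At `z = 1`, `s₄ = s₃` and regular parameters, `r` is given by the regularized formula. -/
theorem rElt_eq_rReg {η α' Z x₁ x₂ x₃ x₄ u₁ u₂ u₃ u₄ s : ℝ} (hη : η = 1 ∨ η = -1)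
    (hα' : α' = 1 ∨ α' = -1) (hZ : Z ≠ 0) (hx₁ : x₁ ≠ 0) (hx₂ : x₂ ≠ 0)
    (hx₃ : 0 < x₃) (hx₄ : 0 < η * x₄) (hx : x₂ * x₄ = x₁ * x₃) (h₁ : shiftPar q α l x₁ = u₁)
    (h₂ : shiftPar q α (l + r) x₂ = u₂) (h₃ : shiftPar q 1 (k + r) x₃ = u₃)
    (h₄ : shiftPar q 1 k x₄ = u₄) (hA : Adm (q ^ 2) u₁ u₂ u₃ u₄ s)
    (hreg : ∀ n : ℕ, u₁ / u₄ * (q ^ 2) ^ n ≠ 1)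
    (hreg' : ∀ n : ℕ, q ^ 2 * (u₁ / u₃) * (q ^ 2) ^ n ≠ 1)
    (hreg'' : ∀ n : ℕ, q ^ 2 * (u₁ / u₄) * s⁻¹ ^ 2 * (q ^ 2) ^ n ≠ 1)
    (hY : qInf1 (q ^ 2) (q ^ 2 * (x₁ / x₂) * s⁻¹ ^ 2) ≠ 0) :
    rElt q k r l 1 α (α * α') Z x₁ x₂ x₃ x₄ s s =
      η ^ k * α ^ r * rootSign q k r l α x₁ x₂ x₃ x₄ s *
        rReg q k r l α α' Z x₁ x₂ x₃ x₄ u₁ u₂ u₃ u₄ s := by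
  have hp0 : 0 < q ^ 2 := by positivity
  have hp1 : q ^ 2 < 1 := pow_lt_one₀ hq0.le hq1 (by norm_num)
  have hq := hq0.ne'
  have hα0 : α ≠ 0 := by rcases hα with rfl | rfl <;> norm_num
  have hs := hA.s_ne
  have hu₁ := hA.u₁_ne
  have hu₃ := hA.u₃_ne
  have hu₄ := hA.u₄_ne
  have hx₄0 : x₄ ≠ 0 := fun h => by rw [h, mul_zero] at hx₄; exact hx₄.false
  have n4 : 1 - u₁ / u₄ ≠ 0 := fun h0 => hreg 0 (by rw [pow_zero, mul_one]; linarith)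
  rw [rElt_eq_prod hq0 hq1 k r l hα hη hx₃ hx₄ h₁ h₂ h₃ h₄ hA hreg hreg' hreg'' hY]
  congr 1
  have hw : α * (x₁ / x₄) ≠ 0 := by positivity
  -- Quasi-periodicity moves θ(αx₁/x₄) to θ(u₁/u₄), whose factor 1 − u₁/u₄ cancels the pole and
  -- leaves the two infinite products.
  have hfirst : (-α) ^ (l - k) * q ^ ((l - k) ^ 2) * (x₁ / x₄) ^ (l - k) *
      (qInf1 (q ^ 2) (q ^ 2 * (u₁ / u₄)) * qInf1 (q ^ 2) (q ^ 2 * (u₄ / u₁))) =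
      q ^ (l - k) * theta1 (q ^ 2) (α * (x₁ / x₄)) / (1 - u₁ / u₄) := by
    have h := theta1_mul_zpow hq0 hq1 hw (l - k)
    have e1 : α * (x₁ / x₄) * q ^ (2 * (l - k)) = u₁ / u₄ := by
      rw [← h₁, ← h₄, ← shiftPar_one_div_four hq0]; ring
    have e2 : q ^ 2 / (u₁ / u₄) = q ^ 2 * (u₄ / u₁) := by rw [div_div_eq_mul_div]; ring
    rw [e1, theta1, qInf1_succ hp0 hp1 (u₁ / u₄), e2, mul_comm (u₁ / u₄) (q ^ 2), zpow_neg,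
      sub_eq_add_neg (l - k), zpow_add₀ hq, zpow_neg] at h
    have hm : (-(α * (x₁ / x₄))) ^ (l - k) = (-α) ^ (l - k) * (x₁ / x₄) ^ (l - k) := by
      rw [← mul_zpow, neg_mul]
    have hm0 : (-(α * (x₁ / x₄))) ^ (l - k) ≠ 0 := zpow_ne_zero _ (neg_ne_zero.2 hw)
    rw [eq_div_iff n4, mul_right_comm ((-α) ^ (l - k)), ← hm]
    generalize (-(α * (x₁ / x₄))) ^ (l - k) = M at *
    field_simp at h ⊢
    linear_combination h
  have hv := hA.vReg_eq_wSq hp0 hp1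
  have hrel := theta1_relation hq0 hq1 hα hα' hZ hx₁ hx₂ hx₃.ne' hx₄0 hs hx
  have hρ := ne_zpow_of_theta1_ne_zero hp0 hp1 hA.theta_ρ
  have hss := ne_zpow_of_theta1_ne_zero hp0 hp1 hA.theta_s
  have m1 : 1 - u₁ / u₂ ≠ 0 := fun h0 => hρ 0 (by rw [zpow_zero]; linarith)
  have m2 : 1 - (s ^ 2)⁻¹ ≠ 0 := fun h0 =>
    inv_ne_zpow hss 0 (by rw [zpow_zero]; linarith)
  have m3 : 1 - q ^ 2 ≠ 0 := by linarith
  -- The product form solved for `vReg`: the factors 1 − u₁/u₂ and 1 − s⁻² cancel against the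
  -- elementary factors of the formula, while 1/(1 − u₁/u₄) remains as in r.
  have hv' : q ^ (l + k) * (x₁ / x₂) *
      vReg (q ^ 2) (u₁ / u₄) (u₁ / u₂) (s ^ 2)⁻¹ (-(q ^ 2 / (u₃ * s))) (-(u₁ / s)) *
      ((1 - q ^ (2 * r) * (x₂ / x₁)) * (1 - s ^ 2) / (1 - q ^ 2)) =
      q ^ (l - k) / (1 - u₁ / u₄) * (s / (q * x₃)) * (1 / wSq (q ^ 2) u₁ u₂ u₃ u₄ s - 1) := by
    have hv2 : vReg (q ^ 2) (u₁ / u₄) (u₁ / u₂) (s ^ 2)⁻¹ (-(q ^ 2 / (u₃ * s))) (-(u₁ / s)) =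
        q ^ 2 / (u₃ * s) * (1 - q ^ 2) * (1 / wSq (q ^ 2) u₁ u₂ u₃ u₄ s - 1) /
          (q ^ 2 * ((1 - u₁ / u₄) * (1 - u₁ / u₂) * (1 - (s ^ 2)⁻¹))) := by
      rw [eq_div_iff (by positivity), ← hv]; ring
    have hB : 1 - q ^ (2 * r) * (x₂ / x₁) = -(1 - u₁ / u₂) * (q ^ (2 * r) * (x₂ / x₁)) := by
      rw [← h₁, ← h₂, ← shiftPar_one_div_two hq0 r l hα0,
        show -2 * r = -(2 * r) by ring, zpow_neg]
      have : q ^ (2 * r) ≠ 0 := by positivity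
      field_simp
      ring
    have hC : 1 - s ^ 2 = -(1 - (s ^ 2)⁻¹) * s ^ 2 := by field_simp; ring
    have hu : q ^ (l + k) * q ^ (2 * r) / u₃ = q ^ (l - k) / (q * x₃) := by
      rw [← h₃, shiftPar]
      simp only [zpow_add₀ hq, zpow_sub₀ hq, zpow_two_mul_eq_sq, zpow_one]
      field_simp
    rw [hv2, hB, hC]
    generalize 1 / wSq (q ^ 2) u₁ u₂ u₃ u₄ s - 1 = X
    generalize 1 - u₁ / u₂ = y1 at *
    generalize 1 - u₁ / u₄ = y2 at *
    generalize 1 - (s ^ 2)⁻¹ = y3 at *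
    generalize 1 - q ^ 2 = y4 at *
    calc _ = q ^ (l + k) * q ^ (2 * r) / u₃ * (s / y2) * X := by field_simp
      _ = _ := by rw [hu]; field_simp
  have e1 : -(α * q * (x₂ * s)) = -(α * x₂ * s * q) := by ring
  have e2 : -(α' * q * (Z / x₂ * s)) = -(α' * (Z / x₂) * s * q) := by ring
  have e3 : -(q * (x₃ / s)) = -(x₃ / s * q) := by ring
  have e4 : -(α * α' * q * (Z / x₃ / s)) = -(α * α' * (Z / x₃) / s * q) := by ring
  rw [rReg, hfirst, e1, e2, e3, e4, mul_right_comm (q ^ (l + k) * (x₁ / x₂) * _), hv']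
  generalize √ (wSq (q ^ 2) u₁ u₂ u₃ u₄ s) = W at *
  generalize wSq (q ^ 2) u₁ u₂ u₃ u₄ s = W2 at *
  generalize theta1 (q ^ 2) (α * (x₁ / x₄)) = θ1 at *
  generalize theta1 (q ^ 2) (α * α' * q ^ 2 * Z) = θ2 at *
  generalize theta1 (q ^ 2) (α' * (Z / x₂ / x₃)) = θ3 at *
  generalize theta1 (q ^ 2) (s ^ 2) = θ4 at *
  generalize theta1 (q ^ 2) (-(x₃ / s * q)) = θ5 at *
  generalize theta1 (q ^ 2) (-(α * x₂ * s * q)) = θ6 at *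
  generalize theta1 (q ^ 2) (-(α' * (Z / x₂) * s * q)) = θ7 at *
  generalize theta1 (q ^ 2) (-(α * α' * (Z / x₃) / s * q)) = θ8 at *
  generalize theta1 (q ^ 2) (-(x₃ * s * q)) * (theta1 (q ^ 2) (-(α * x₂ / s * q)) *
    theta1 (q ^ 2) (-(α' * (Z / x₂) / s * q)) *
    theta1 (q ^ 2) (-(α * α' * (Z / x₃) * s * q))) = Y at *
  generalize 1 - u₁ / u₄ = m at *
  generalize qInf1 (q ^ 2) (q ^ 2 * (x₁ / x₂)) / qInf1 (q ^ 2) (q ^ 2) = P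
  have hqx : q * (x₃ / s) * (s / (q * x₃)) = 1 := by field_simp
  -- This is the splitting X/W − Y = (X − Y) + X(1/W − 1): the addition formula gives the first
  -- part, `vReg` the second.
  linear_combination (-(iota s * P * W * (q ^ (l - k) / m))) * hrel -
    (iota s * P * W * (q ^ (l - k) / m) * (1 / W2 - 1) * (θ6 * θ7 * θ5 * θ8)) * hqx

end RElement

/-! ### Continuity in the parameters -/

section Limits

variable {X : Type*} {F : Filter X} {p : ℝ}

theorem tendsto_qInf1 (hp0 : 0 < p) (hp1 : p < 1) {f : X → ℝ} {a : ℝ}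
    (h : Tendsto f F (𝓝 a)) : Tendsto (fun x => qInf1 p (f x)) F (𝓝 (qInf1 p a)) :=
  ((continuous_qInf1 hp0 hp1).tendsto a).comp h

theorem tendsto_theta1 (hp0 : 0 < p) (hp1 : p < 1) {f : X → ℝ} {a : ℝ}
    (h : Tendsto f F (𝓝 a)) (ha : a ≠ 0) :
    Tendsto (fun x => theta1 p (f x)) F (𝓝 (theta1 p a)) :=
  (tendsto_qInf1 hp0 hp1 h).mul (tendsto_qInf1 hp0 hp1 (tendsto_const_nhds.div h ha))

theorem tendsto_sign {f : X → ℝ} {a : ℝ} (h : Tendsto f F (𝓝 a)) (ha : a ≠ 0) :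
    Tendsto (fun x => Real.sign (f x)) F (𝓝 (Real.sign a)) := by
  refine tendsto_const_nhds.congr' ?_
  rcases ha.lt_or_gt with ha | ha
  · filter_upwards [h.eventually_lt_const ha] with x hx
    rw [Real.sign_of_neg ha, Real.sign_of_neg hx]
  · filter_upwards [h.eventually_const_lt ha] with x hx
    rw [Real.sign_of_pos ha, Real.sign_of_pos hx]

variable {f₁ f₂ f₃ f₄ g : X → ℝ} {u₁ u₂ u₃ u₄ s : ℝ}

theorem eventually_pos_qInf1 (hp0 : 0 < p) (hp1 : p < 1) {f : X → ℝ} {u : ℝ}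
    (hf : Tendsto f F (𝓝 u)) (hg : Tendsto g F (𝓝 s)) (hs : s ≠ 0)
    (h : 0 < qInf1 p (-(u * s)) * qInf1 p (-(u / s))) :
    ∀ᶠ x in F, 0 < qInf1 p (-(f x * g x)) * qInf1 p (-(f x / g x)) :=
  ((tendsto_qInf1 hp0 hp1 (hf.mul hg).neg).mul
    (tendsto_qInf1 hp0 hp1 (hf.div hg hs).neg)).eventually_const_lt h

theorem eventually_pos_theta1 (hp0 : 0 < p) (hp1 : p < 1) {f : X → ℝ} {u : ℝ}
    (hf : Tendsto f F (𝓝 u)) (hg : Tendsto g F (𝓝 s)) (hu : u ≠ 0) (hs : s ≠ 0)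
    (h : 0 < theta1 p (-(u * s)) * theta1 p (-(u / s))) :
    ∀ᶠ x in F, 0 < theta1 p (-(f x * g x)) * theta1 p (-(f x / g x)) :=
  ((tendsto_theta1 hp0 hp1 (hf.mul hg).neg (by simp [hu, hs])).mul
    (tendsto_theta1 hp0 hp1 (hf.div hg hs).neg (by simp [hu, hs]))).eventually_const_lt h

/-- All conditions are open except the relation u₂u₄ = u₁u₃, which is therefore assumed along the
filter. -/
theorem Adm.eventually (hp0 : 0 < p) (hp1 : p < 1) (hA : Adm p u₁ u₂ u₃ u₄ s)
    (h₁ : Tendsto f₁ F (𝓝 u₁)) (h₂ : Tendsto f₂ F (𝓝 u₂)) (h₃ : Tendsto f₃ F (𝓝 u₃))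
    (h₄ : Tendsto f₄ F (𝓝 u₄)) (hg : Tendsto g F (𝓝 s))
    (hrel : ∀ᶠ x in F, f₂ x * f₄ x = f₁ x * f₃ x) :
    ∀ᶠ x in F, Adm p (f₁ x) (f₂ x) (f₃ x) (f₄ x) (g x) := by
  have hs := hA.s_ne
  have hu₁ := hA.u₁_ne
  have hu₂ := hA.u₂_ne
  have hρ : u₁ / u₂ ≠ 0 := by positivity
  filter_upwards [hrel, hg.eventually_ne hs, h₁.eventually_ne hu₁, h₂.eventually_ne hu₂,
    h₃.eventually_ne hA.u₃_ne, h₄.eventually_ne hA.u₄_ne,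
    eventually_pos_qInf1 hp0 hp1 h₁ hg hs hA.pos₁, eventually_pos_qInf1 hp0 hp1 h₂ hg hs hA.pos₂,
    eventually_pos_qInf1 hp0 hp1 h₃ hg hs hA.pos₃, eventually_pos_qInf1 hp0 hp1 h₄ hg hs hA.pos₄,
    eventually_pos_theta1 hp0 hp1 h₁ hg hu₁ hs hA.theta₁,
    eventually_pos_theta1 hp0 hp1 h₂ hg hu₂ hs hA.theta₂,
    eventually_pos_theta1 hp0 hp1 h₃ hg hA.u₃_ne hs hA.theta₃,
    eventually_pos_theta1 hp0 hp1 h₄ hg hA.u₄_ne hs hA.theta₄,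
    (tendsto_theta1 hp0 hp1 (hg.pow 2) (by positivity)).eventually_ne hA.theta_s,
    (tendsto_theta1 hp0 hp1 (h₁.div h₂ hu₂) hρ).eventually_ne hA.theta_ρ,
    (tendsto_theta1 hp0 hp1 ((h₁.div h₂ hu₂).mul (hg.pow 2))
      (by positivity)).eventually_ne hA.theta_ρs]
    with x a1 a2 a3 a4 a5 a6 a7 a8 a9 a10 a11 a12 a13 a14 a15 a16 a17
  exact ⟨a2, a3, a4, a5, a6, a1, a7, a8, a9, a10, a11, a12, a13, a14, a15, a16, a17⟩

theorem tendsto_wSq (hp0 : 0 < p) (hp1 : p < 1) (hA : Adm p u₁ u₂ u₃ u₄ s)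
    (h₁ : Tendsto f₁ F (𝓝 u₁)) (h₂ : Tendsto f₂ F (𝓝 u₂)) (h₃ : Tendsto f₃ F (𝓝 u₃))
    (h₄ : Tendsto f₄ F (𝓝 u₄)) (hg : Tendsto g F (𝓝 s)) :
    Tendsto (fun x => wSq p (f₁ x) (f₂ x) (f₃ x) (f₄ x) (g x)) F (𝓝 (wSq p u₁ u₂ u₃ u₄ s)) := by
  have hs := hA.s_ne
  have m := fun {f : X → ℝ} {u : ℝ} (h : Tendsto f F (𝓝 u)) =>
    tendsto_qInf1 hp0 hp1 (h.mul hg).neg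
  have d := fun {f : X → ℝ} {u : ℝ} (h : Tendsto f F (𝓝 u)) =>
    tendsto_qInf1 hp0 hp1 (h.div hg hs).neg
  exact ((((m h₄).mul (d h₃)).mul (d h₁)).mul (m h₂)).div
    ((((d h₄).mul (m h₃)).mul (m h₁)).mul (d h₂))
    (mul_ne_zero (mul_ne_zero (mul_ne_zero (right_ne_zero_of_mul hA.pos₄.ne')
      (left_ne_zero_of_mul hA.pos₃.ne')) (left_ne_zero_of_mul hA.pos₁.ne'))
      (right_ne_zero_of_mul hA.pos₂.ne'))

/-- The case A = 1 is not excluded: `vReg` stays continuous at u₁ = u₄, where the defining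
expression of r is singular. -/
theorem tendsto_vReg (hp0 : 0 < p) (hp1 : p < 1) {fA fB fC fD fE : X → ℝ} {A B C D E : ℝ}
    (hA : Tendsto fA F (𝓝 A)) (hB : Tendsto fB F (𝓝 B)) (hC : Tendsto fC F (𝓝 C))
    (hD : Tendsto fD F (𝓝 D)) (hE : Tendsto fE F (𝓝 E)) (hD0 : D ≠ 0)
    (hDn : ∀ n : ℕ, D * p ^ n ≠ 1) (hEn : ∀ n : ℕ, E * p ^ n ≠ 1)
    (hA' : ∀ n : ℕ, A * p / D * p ^ n ≠ 1) (hB' : ∀ n : ℕ, B * p / D * p ^ n ≠ 1)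
    (hC' : ∀ n : ℕ, C * p / D * p ^ n ≠ 1) :
    Tendsto (fun x => vReg p (fA x) (fB x) (fC x) (fD x) (fE x)) F (𝓝 (vReg p A B C D E)) := by
  have m := fun {f : X → ℝ} {u : ℝ} (h : Tendsto f F (𝓝 u)) =>
    tendsto_qInf1 hp0 hp1 (h.mul_const p)
  have d := fun {f : X → ℝ} {u : ℝ} (h : Tendsto f F (𝓝 u)) =>
    tendsto_qInf1 hp0 hp1 ((h.mul_const p).div hD hD0)
  have hc : Tendsto (fun _ : X => p) F (𝓝 p) := tendsto_const_nhds
  have hc2 : Tendsto (fun _ : X => p ^ 2) F (𝓝 (p ^ 2)) := tendsto_const_nhds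
  have n1 := qInf1_ne_zero hp0 hp1 hDn
  have n2 := qInf1_ne_zero hp0 hp1 hEn
  have n3 := qInf1_ne_zero hp0 hp1 hA'
  have n4 := qInf1_ne_zero hp0 hp1 hB'
  have n5 := qInf1_ne_zero hp0 hp1 hC'
  have n6 := qInf1_self_ne_zero hp0 hp1
  refine (tendsto_const_nhds.div (((tendsto_qInf1 hp0 hp1 hD).mul
    (tendsto_qInf1 hp0 hp1 hE)).mul_const _) (by positivity)).mul ((hD.neg.mul
    (tendsto_balSeries hp0 hp1 (hA.mul_const p) (hB.mul_const p) (hC.mul_const p)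
      (hD.mul_const p) (hE.mul_const p) hc2)).add
    (((((m hA).mul (m hB)).mul (m hC)).div (((d hA).mul (d hB)).mul (d hC))
      (by positivity)).mul
    (tendsto_balSeries hp0 hp1 ((hA.mul_const p).div hD hD0) ((hB.mul_const p).div hD hD0)
      ((hC.mul_const p).div hD hD0) (hc2.div hD hD0) ((hE.const_mul p).div hD hD0) hc)))

theorem Adm.tendsto_vReg (hp0 : 0 < p) (hp1 : p < 1) (hA : Adm p u₁ u₂ u₃ u₄ s)
    (h₁ : Tendsto f₁ F (𝓝 u₁)) (h₂ : Tendsto f₂ F (𝓝 u₂)) (h₃ : Tendsto f₃ F (𝓝 u₃))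
    (h₄ : Tendsto f₄ F (𝓝 u₄)) (hg : Tendsto g F (𝓝 s)) :
    Tendsto (fun x => vReg p (f₁ x / f₄ x) (f₁ x / f₂ x) (g x ^ 2)⁻¹ (-(p / (f₃ x * g x)))
      (-(f₁ x / g x))) F
      (𝓝 (vReg p (u₁ / u₄) (u₁ / u₂) (s ^ 2)⁻¹ (-(p / (u₃ * s))) (-(u₁ / s)))) := by
  have hs := hA.s_ne
  have hu₃ := hA.u₃_ne
  have m := fun {x : ℝ} (hx : ∀ n : ℤ, x ≠ p ^ n) => mul_pow_ne_one_of_ne_zpow hp0 hx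
  exact QIntertwiner.tendsto_vReg hp0 hp1 (h₁.div h₄ hA.u₄_ne) (h₁.div h₂ hA.u₂_ne)
    ((hg.pow 2).inv₀ (by positivity)) (tendsto_const_nhds.div (h₃.mul hg) (by positivity)).neg
    (h₁.div hg hs).neg (by simp [hp0.ne', hu₃, hs])
    (m (hA.denom_ne hp0 hp1)) (m (hA.neg_u₁_div_ne hp0 hp1))
    (by rw [hA.numer₁_eq hp0]; exact m (hA.neg_u₂_mul_ne hp0 hp1))
    (by rw [hA.numer₂_eq hp0]; exact m (hA.neg_u₄_mul_ne hp0 hp1))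
    (by rw [hA.numer₃_eq hp0]; exact m (hA.neg_u₃_div_ne hp0 hp1))

end Limits

/-! ### Extension of r by continuity to all admissible points -/

section RElement

variable {q : ℝ} (hq0 : 0 < q) (hq1 : q < 1) (k r l : ℤ) {α : ℝ} (hα : α = 1 ∨ α = -1)
  {X : Type*} {F : Filter X} {X₁ X₂ X₃ X₄ f₁ f₂ f₃ f₄ g : X → ℝ}
  {x₁ x₂ x₃ x₄ u₁ u₂ u₃ u₄ s : ℝ}

include hq0 hq1 in
theorem tendsto_rReg {α' Z : ℝ} (hα : α ≠ 0) (hα' : α' ≠ 0) (hZ : Z ≠ 0)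
    (hA : Adm (q ^ 2) u₁ u₂ u₃ u₄ s)
    (hx₁ : x₁ ≠ 0) (hx₂ : x₂ ≠ 0) (hx₃ : x₃ ≠ 0) (hx₄ : x₄ ≠ 0)
    (H₁ : Tendsto X₁ F (𝓝 x₁)) (H₂ : Tendsto X₂ F (𝓝 x₂)) (H₃ : Tendsto X₃ F (𝓝 x₃))
    (H₄ : Tendsto X₄ F (𝓝 x₄))
    (h₁ : Tendsto f₁ F (𝓝 u₁)) (h₂ : Tendsto f₂ F (𝓝 u₂)) (h₃ : Tendsto f₃ F (𝓝 u₃))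
    (h₄ : Tendsto f₄ F (𝓝 u₄)) (hg : Tendsto g F (𝓝 s)) :
    Tendsto (fun x => rReg q k r l α α' Z (X₁ x) (X₂ x) (X₃ x) (X₄ x)
      (f₁ x) (f₂ x) (f₃ x) (f₄ x) (g x)) F
      (𝓝 (rReg q k r l α α' Z x₁ x₂ x₃ x₄ u₁ u₂ u₃ u₄ s)) := by
  have hp0 : 0 < q ^ 2 := by positivity
  have hp1 : q ^ 2 < 1 := pow_lt_one₀ hq0.le hq1 (by norm_num)
  have hs := hA.s_ne
  have hs2 : s ^ 2 ≠ 0 := by positivity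
  have tq := fun {f : X → ℝ} {a : ℝ} (h : Tendsto f F (𝓝 a)) => tendsto_qInf1 hp0 hp1 h
  have tθ := fun {f : X → ℝ} {a : ℝ} (h : Tendsto f F (𝓝 a)) (ha : a ≠ 0) =>
    tendsto_theta1 hp0 hp1 h ha
  have hZ₂ : Tendsto (fun x => Z / X₂ x) F (𝓝 (Z / x₂)) := tendsto_const_nhds.div H₂ hx₂
  have hZ₃ : Tendsto (fun x => Z / X₃ x) F (𝓝 (Z / x₃)) := tendsto_const_nhds.div H₃ hx₃
  have hι : Tendsto (fun x => iota (g x)) F (𝓝 (iota s)) :=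
    (hg.abs.inv₀ (by positivity)).mul hg
  have T₁ := ((((H₃.div hg hs).const_mul q).mul hι).mul
      ((tq ((H₁.div H₂ hx₂).const_mul (q ^ 2))).div_const (qInf1 (q ^ 2) (q ^ 2)))).mul
      (tendsto_wSq hp0 hp1 hA h₁ h₂ h₃ h₄ hg).sqrt
  have T₂ := ((((H₁.div H₄ hx₄).zpow₀ (l - k) (Or.inl (div_ne_zero hx₁ hx₄))).const_mul
      ((-α) ^ (l - k) * q ^ ((l - k) ^ 2))).mul
      ((tq ((h₁.div h₄ hA.u₄_ne).const_mul (q ^ 2))).mul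
        (tq ((h₄.div h₁ hA.u₁_ne).const_mul (q ^ 2))))).mul
      (((tθ ((hZ₂.div H₃ hx₃).const_mul α') (by positivity)).const_mul
        (theta1 (q ^ 2) (α * α' * q ^ 2 * Z))).mul (tθ (hg.pow 2) hs2))
  have T₃ := (((tθ ((H₂.mul hg).const_mul (α * q)).neg (by simp [hα, hq0.ne', hx₂, hs])).mul
        (tθ ((hZ₂.mul hg).const_mul (α' * q)).neg (by simp [hα', hq0.ne', hx₂, hs, hZ]))).mul
        (tθ ((H₃.div hg hs).const_mul q).neg (by simp [hq0.ne', hx₃, hs]))).mul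
        (tθ ((hZ₃.div hg hs).const_mul (α * α' * q)).neg
          (by simp [hα, hα', hq0.ne', hx₃, hs, hZ]))
  have T₄ := ((((H₂.div H₁ hx₁).const_mul (q ^ (2 * r))).const_sub 1).mul
    ((hg.pow 2).const_sub 1)).div_const (1 - q ^ 2)
  exact T₁.mul (T₂.add (((((H₁.div H₂ hx₂).const_mul (q ^ (l + k))).mul
    (hA.tendsto_vReg hp0 hp1 h₁ h₂ h₃ h₄ hg)).mul T₃).mul T₄))

theorem tendsto_shiftPar (β : ℝ) (m : ℤ) (H : Tendsto X₁ F (𝓝 x₁)) :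
    Tendsto (fun x => shiftPar q β m (X₁ x)) F (𝓝 (shiftPar q β m x₁)) :=
  H.const_mul _

theorem shiftPar_rel (hq0 : 0 < q) (hx : x₂ * x₄ = x₁ * x₃) :
    shiftPar q α (l + r) x₂ * shiftPar q 1 k x₄ =
      shiftPar q α l x₁ * shiftPar q 1 (k + r) x₃ := by
  have e : q ^ (2 * (l + r) + 1) * q ^ (2 * k + 1) = q ^ (2 * l + 1) * q ^ (2 * (k + r) + 1) := by
    rw [← zpow_add₀ hq0.ne', ← zpow_add₀ hq0.ne']; congr 1; ring
  unfold shiftPar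
  linear_combination α * q ^ (2 * (l + r) + 1) * q ^ (2 * k + 1) * hx + α * (x₁ * x₃) * e

include hq0 hq1 hα in
/-- The value of `r` at `z = 1`, `s₄ = s₃`, extended by continuity. -/
theorem hasValue_rReg {η α' Z : ℝ} (hη : η = 1 ∨ η = -1)
    (hα' : α' = 1 ∨ α' = -1) (hZ : Z ≠ 0) (hx₁ : x₁ ≠ 0) (hx₂ : x₂ ≠ 0)
    (hx₃ : 0 < x₃) (hx₄ : 0 < η * x₄) (h₁ : shiftPar q α l x₁ = u₁)
    (h₂ : shiftPar q α (l + r) x₂ = u₂) (h₃ : shiftPar q 1 (k + r) x₃ = u₃)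
    (h₄ : shiftPar q 1 k x₄ = u₄) (hA : Adm (q ^ 2) u₁ u₂ u₃ u₄ s)
    (hY : qInf1 (q ^ 2) (q ^ 2 * (x₁ / x₂) * s⁻¹ ^ 2) ≠ 0) :
    HasValue q k r l 1 α (α * α') Z x₁ x₂ x₃ x₄ s
      (η ^ k * α ^ r * rootSign q k r l α x₁ x₂ x₃ x₄ s *
        rReg q k r l α α' Z x₁ x₂ x₃ x₄ u₁ u₂ u₃ u₄ s) := by
  have hp0 : 0 < q ^ 2 := by positivity
  have hp1 : q ^ 2 < 1 := pow_lt_one₀ hq0.le hq1 (by norm_num)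
  have hα0 : α ≠ 0 := by rcases hα with rfl | rfl <;> norm_num
  have hα0' : α' ≠ 0 := by rcases hα' with rfl | rfl <;> norm_num
  have hx₄0 : x₄ ≠ 0 := fun h => by rw [h, mul_zero] at hx₄; exact hx₄.false
  have hs := hA.s_ne
  set y₀ : ℝ × ℝ × ℝ × ℝ × ℝ := (x₁, x₂, x₃, x₄, s) with hy₀
  set F := 𝓝[regularSet q k r l 1 α] y₀ with hF
  have hle : F ≤ 𝓝 y₀ := nhdsWithin_le_nhds
  have H₁ : Tendsto (fun y : ℝ × ℝ × ℝ × ℝ × ℝ => y.1) F (𝓝 x₁) :=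
    (continuous_fst.tendsto y₀).mono_left hle
  have H₂ : Tendsto (fun y : ℝ × ℝ × ℝ × ℝ × ℝ => y.2.1) F (𝓝 x₂) :=
    ((by fun_prop : Continuous fun y : ℝ × ℝ × ℝ × ℝ × ℝ => y.2.1).tendsto y₀).mono_left hle
  have H₃ : Tendsto (fun y : ℝ × ℝ × ℝ × ℝ × ℝ => y.2.2.1) F (𝓝 x₃) :=
    ((by fun_prop : Continuous fun y : ℝ × ℝ × ℝ × ℝ × ℝ => y.2.2.1).tendsto y₀).mono_left hle
  have H₄ : Tendsto (fun y : ℝ × ℝ × ℝ × ℝ × ℝ => y.2.2.2.1) F (𝓝 x₄) :=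
    ((by fun_prop : Continuous fun y : ℝ × ℝ × ℝ × ℝ × ℝ => y.2.2.2.1).tendsto y₀).mono_left hle
  have Hs : Tendsto (fun y : ℝ × ℝ × ℝ × ℝ × ℝ => y.2.2.2.2) F (𝓝 s) :=
    ((by fun_prop : Continuous fun y : ℝ × ℝ × ℝ × ℝ × ℝ => y.2.2.2.2).tendsto y₀).mono_left hle
  have K₁ := tendsto_shiftPar (q := q) α l H₁
  have K₂ := tendsto_shiftPar (q := q) α (l + r) H₂
  have K₃ := tendsto_shiftPar (q := q) 1 (k + r) H₃
  have K₄ := tendsto_shiftPar (q := q) 1 k H₄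
  rw [h₁] at K₁
  rw [h₂] at K₂
  rw [h₃] at K₃
  rw [h₄] at K₄
  have hmem : ∀ᶠ y in F, y ∈ regularSet q k r l 1 α := self_mem_nhdsWithin
  have hAev := hA.eventually hp0 hp1 K₁ K₂ K₃ K₄ Hs
    (hmem.mono fun y hy => shiftPar_rel k r l hq0 hy.1)
  have hYev := (tendsto_qInf1 hp0 hp1 (((H₁.div H₂ hx₂).const_mul (q ^ 2)).mul
    ((Hs.inv₀ hs).pow 2))).eventually_ne hY
  have hsign : Tendsto (fun y : ℝ × ℝ × ℝ × ℝ × ℝ => rootSign q k r l α y.1 y.2.1 y.2.2.1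
      y.2.2.2.1 y.2.2.2.2) F (𝓝 (rootSign q k r l α x₁ x₂ x₃ x₄ s)) := by
    simp only [rootSign_eq k r l rfl rfl rfl rfl]
    rw [h₁, h₂, h₃, h₄]
    have m := fun {f : ℝ × ℝ × ℝ × ℝ × ℝ → ℝ} {u : ℝ} (h : Tendsto f F (𝓝 u)) =>
      tendsto_qInf1 hp0 hp1 (h.mul Hs).neg
    have d := fun {f : ℝ × ℝ × ℝ × ℝ × ℝ → ℝ} {u : ℝ} (h : Tendsto f F (𝓝 u)) =>
      tendsto_qInf1 hp0 hp1 (h.div Hs hs).neg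
    -- The argument of the sign must not vanish at the limit point, so that the sign is constant
    -- nearby.
    have hT : theta1 (q ^ 2) (-(x₄ / s * q)) ≠ 0 := by
      rw [theta1_neg_eq_shift hq0 hq1 k (by positivity)]
      have := right_ne_zero_of_mul hA.theta₄.ne'
      rw [← h₄, shiftPar, mul_div_assoc, one_mul] at this
      positivity
    exact tendsto_sign ((tendsto_theta1 hp0 hp1 ((H₄.div Hs hs).mul_const q).neg
      (by simp [hx₄0, hs, hq0.ne'])).mul ((((d K₄).mul (m K₃)).mul (m K₁)).mul (d K₂)))
      (mul_ne_zero hT (mul_ne_zero (mul_ne_zero (mul_ne_zero (right_ne_zero_of_mul hA.pos₄.ne')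
      (left_ne_zero_of_mul hA.pos₃.ne')) (left_ne_zero_of_mul hA.pos₁.ne'))
      (right_ne_zero_of_mul hA.pos₂.ne')))
  have hmain := (hsign.const_mul (η ^ k * α ^ r)).mul
    (tendsto_rReg hq0 hq1 k r l hα0 hα0' hZ hA hx₁ hx₂ hx₃.ne' hx₄0 H₁ H₂ H₃ H₄ K₁ K₂ K₃ K₄ Hs)
  -- At regular points near the limit point r equals `rReg`: regularity holds on the set defining
  -- the filter, and the other conditions persist nearby.
  refine hmain.congr' ?_
  have hpow : ∀ (m : ℤ) (n : ℕ), q ^ (2 * (m + n)) = q ^ (2 * m) * (q ^ 2) ^ n := fun m n => by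
    rw [mul_add, zpow_add₀ hq0.ne', zpow_mul q 2 (n : ℤ)]; norm_cast
  filter_upwards [hmem, hAev, hYev, H₁.eventually_ne hx₁, H₂.eventually_ne hx₂,
    H₃.eventually_const_lt hx₃, (H₄.const_mul η).eventually_const_lt hx₄]
    with y hy hAy hYy y₁ y₂ y₃ y₄
  rw [one_mul]
  refine (rElt_eq_rReg hq0 hq1 k r l hα hη hα' hZ y₁ y₂ y₃ y₄ hy.1 rfl rfl rfl rfl hAy
    (fun n => ?_) (fun n => ?_) (fun n => ?_) hYy).symm
  · have := (hy.2 n).1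
    rw [one_mul, hpow] at this
    rw [← shiftPar_one_div_four hq0]
    convert this using 1; ring
  · have := (hy.2 n).2.1
    rw [hpow] at this
    rw [← shiftPar_one_div_three hq0]
    convert this using 1; ring
  · have := (hy.2 n).2.2
    rw [one_mul, hpow] at this
    rw [← shiftPar_one_div_four_succ hq0]
    convert this using 1; field_simp

end RElement

/-! ### From the positivity conditions P(A, B) to admissible parameters -/

theorem qInf1_mul_pos {p : ℝ} (hp0 : 0 < p) (hp1 : p < 1) {a b : ℝ}
    (h : ∀ n : ℕ, 0 < (1 - a * p ^ n) * (1 - b * p ^ n)) : 0 < qInf1 p a * qInf1 p b := by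
  have ha : qInf1 p a ≠ 0 := qInf1_ne_zero hp0 hp1 fun n hn => by simpa [hn] using h n
  have hb : qInf1 p b ≠ 0 := qInf1_ne_zero hp0 hp1 fun n hn => by simpa [hn] using h n
  refine lt_of_le_of_ne ?_ (mul_ne_zero ha hb).symm
  refine ge_of_tendsto' ((tendsto_qFac hp0 hp1 a).mul (tendsto_qFac hp0 hp1 b)) fun n => ?_
  rw [qFac, qFac, ← Finset.prod_mul_distrib]
  exact Finset.prod_nonneg fun i _ => (h i).le

/-- Indices n ≥ 0 give (a)_∞(b)_∞ and indices n < 0 give (p/a)_∞(p/b)_∞: inverting 1 − ap⁻ⁿ⁻¹ costs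
the factor −pⁿ⁺¹/a, and these factors are harmless in pairs since ab > 0. -/
theorem theta1_mul_pos {p : ℝ} (hp0 : 0 < p) (hp1 : p < 1) {a b : ℝ} (ha : 0 < a * b)
    (h : ∀ n : ℤ, 0 < (1 - a * p ^ n) * (1 - b * p ^ n)) : 0 < theta1 p a * theta1 p b := by
  have ha0 := left_ne_zero_of_mul ha.ne'
  have hb0 := right_ne_zero_of_mul ha.ne'
  have h1 := qInf1_mul_pos hp0 hp1 (a := a) (b := b) fun n => by exact_mod_cast h n
  have h2 := qInf1_mul_pos hp0 hp1 (a := p / a) (b := p / b) fun n => by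
    have hn := h (-(n + 1))
    have hpn : 0 < p ^ (n + 1) := by positivity
    have e : (1 - p / a * p ^ n) * (1 - p / b * p ^ n) = (p ^ (n + 1)) ^ 2 / (a * b) *
        ((1 - a * p ^ (-((n : ℤ) + 1))) * (1 - b * p ^ (-((n : ℤ) + 1)))) := by
      have : p ^ (-((n : ℤ) + 1)) = (p ^ (n + 1))⁻¹ := by rw [zpow_neg]; norm_cast
      rw [this]
      field_simp
      ring
    rw [e]
    positivity
  rw [theta1, theta1, mul_mul_mul_comm]
  exact mul_pos h1 h2

section

variable {q : ℝ} (hq0 : 0 < q) (hq1 : q < 1)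

theorem sq_zpow (n : ℤ) : (q ^ 2) ^ n = q ^ (2 * n) := by
  rw [zpow_mul]; norm_cast

include hq0 in
theorem RootsPos.shiftPar_pos {β x s : ℝ} (hβ : β = 1 ∨ β = -1) (h : RootsPos q x (β * s))
    (m n : ℤ) : 0 < (1 - -(shiftPar q β m x * s) * (q ^ 2) ^ n) *
      (1 - -(shiftPar q β m x / s) * (q ^ 2) ^ n) := by
  have hβ' : β⁻¹ = β := by rcases hβ with rfl | rfl <;> norm_num
  have := h (m + n)
  have e : q ^ (2 * (m + n) + 1) = q ^ (2 * m + 1) * (q ^ 2) ^ n := by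
    rw [sq_zpow, ← zpow_add₀ hq0.ne']; congr 1; ring
  rw [e, mul_inv, hβ'] at this
  unfold shiftPar
  convert this using 1
  rw [div_eq_mul_inv]
  ring

include hq0 hq1 in
theorem RootsPos.qInf1_pos {β x s : ℝ} (hβ : β = 1 ∨ β = -1) (h : RootsPos q x (β * s))
    (m : ℤ) : 0 < qInf1 (q ^ 2) (-(shiftPar q β m x * s)) *
      qInf1 (q ^ 2) (-(shiftPar q β m x / s)) := by
  have hp0 : 0 < q ^ 2 := by positivity
  have hp1 : q ^ 2 < 1 := pow_lt_one₀ hq0.le hq1 (by norm_num)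
  exact qInf1_mul_pos hp0 hp1 fun n => by exact_mod_cast h.shiftPar_pos hq0 hβ m n

include hq0 hq1 in
theorem RootsPos.theta1_pos {β x s : ℝ} (hβ : β = 1 ∨ β = -1) (hx : x ≠ 0) (hs : s ≠ 0)
    (h : RootsPos q x (β * s)) (m : ℤ) : 0 < theta1 (q ^ 2) (-(shiftPar q β m x * s)) *
      theta1 (q ^ 2) (-(shiftPar q β m x / s)) := by
  have hp0 : 0 < q ^ 2 := by positivity
  have hp1 : q ^ 2 < 1 := pow_lt_one₀ hq0.le hq1 (by norm_num)
  have hβ0 : β ≠ 0 := by rcases hβ with rfl | rfl <;> norm_num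
  have hu : shiftPar q β m x ≠ 0 := shiftPar_ne_zero hq0 hβ0 hx m
  refine theta1_mul_pos hp0 hp1 ?_ fun n => h.shiftPar_pos hq0 hβ m n
  have e : -(shiftPar q β m x * s) * -(shiftPar q β m x / s) = shiftPar q β m x ^ 2 := by
    field_simp
  rw [e]
  positivity

theorem shiftPar_mul (α ε : ℝ) (m : ℤ) (x : ℝ) :
    shiftPar q α m (ε * x) = shiftPar q (α * ε) m x := by
  unfold shiftPar; ring

include hq0 hq1 in
-- Each uᵢ absorbs its sign αε, α or ε, so that P(xᵢ, ±s) becomes positivity of the pair at uᵢs and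
-- uᵢ/s for every integer shift. The exclusions of powers of q² become nonvanishing thetas.
theorem adm_shiftPar (k r l : ℤ) {ε α x₁ x₂ x₃ x₄ s : ℝ} (hε : ε = 1 ∨ ε = -1)
    (hα : α = 1 ∨ α = -1) (hx₁ : 0 < x₁) (hx₂ : 0 < x₂) (hx₃ : 0 < x₃) (hx₄ : 0 < x₄)
    (hs0 : s ≠ 0) (hx : x₂ * x₄ = x₁ * x₃) (hs : ∀ n : ℤ, s ^ 2 ≠ q ^ (2 * n))
    (hR1 : ∀ n : ℤ, ε * (x₂ / x₁) ≠ q ^ (2 * n))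
    (hR2 : ∀ n : ℤ, ε * (x₂ / x₁) / s ^ 2 ≠ q ^ (2 * n))
    (h₁ : RootsPos q x₁ (α * s)) (h₂ : RootsPos q x₂ (α * (ε * s)))
    (h₃ : RootsPos q x₃ s) (h₄ : RootsPos q x₄ (ε * s)) :
    Adm (q ^ 2) (shiftPar q α l x₁) (shiftPar q α (l + r) (ε * x₂)) (shiftPar q 1 (k + r) x₃)
      (shiftPar q 1 k (ε * x₄)) s := by
  have hp0 : 0 < q ^ 2 := by positivity
  have hp1 : q ^ 2 < 1 := pow_lt_one₀ hq0.le hq1 (by norm_num)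
  have hα0 : α ≠ 0 := by rcases hα with rfl | rfl <;> norm_num
  have hε0 : ε ≠ 0 := by rcases hε with rfl | rfl <;> norm_num
  have hεε : ε ^ 2 = 1 := by rcases hε with rfl | rfl <;> norm_num
  have hαε : α * ε = 1 ∨ α * ε = -1 := by
    rcases hε with rfl | rfl <;> rcases hα with rfl | rfl <;> norm_num
  rw [← mul_assoc] at h₂
  rw [← one_mul s] at h₃
  have ρ : shiftPar q α l x₁ / shiftPar q α (l + r) (ε * x₂) =
      q ^ (2 * -r) * (ε * (x₂ / x₁))⁻¹ := by
    rw [← shiftPar_one_div_two hq0 r l hα0, mul_neg, neg_mul]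
    congr 1
    field_simp
  refine ⟨hs0, shiftPar_ne_zero hq0 hα0 hx₁.ne' l,
    shiftPar_ne_zero hq0 hα0 (mul_ne_zero hε0 hx₂.ne') _,
    shiftPar_ne_zero hq0 one_ne_zero hx₃.ne' _,
    shiftPar_ne_zero hq0 one_ne_zero (mul_ne_zero hε0 hx₄.ne') k,
    shiftPar_rel k r l hq0 (by linear_combination ε ^ 2 * hx + x₁ * x₃ * hεε),
    h₁.qInf1_pos hq0 hq1 hα l, ?_, h₃.qInf1_pos hq0 hq1 (Or.inl rfl) _, ?_, h₁.theta1_pos hq0 hq1 hα hx₁.ne' hs0 l, ?_,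
    h₃.theta1_pos hq0 hq1 (Or.inl rfl) hx₃.ne' hs0 _, ?_, ?_, ?_, ?_⟩
  · rw [shiftPar_mul]; exact h₂.qInf1_pos hq0 hq1 hαε _
  · rw [shiftPar_mul, one_mul]; exact h₄.qInf1_pos hq0 hq1 hε _
  · rw [shiftPar_mul]; exact h₂.theta1_pos hq0 hq1 hαε hx₂.ne' hs0 _
  · rw [shiftPar_mul, one_mul]; exact h₄.theta1_pos hq0 hq1 hε hx₄.ne' hs0 _
  · exact theta1_ne_zero hp0 hp1 fun n => by rw [sq_zpow]; exact hs n
  · refine theta1_ne_zero hp0 hp1 fun n h => hR1 (-(n + r)) ?_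
    rw [sq_zpow, ρ] at h
    rw [mul_neg, zpow_neg, mul_add, zpow_add₀ hq0.ne', ← h]
    rw [mul_neg, zpow_neg]
    have : q ^ (2 * r) ≠ 0 := by positivity
    field_simp
  · refine theta1_ne_zero hp0 hp1 fun n h => hR2 (-(n + r)) ?_
    rw [sq_zpow, ρ] at h
    rw [mul_neg, zpow_neg, mul_add, zpow_add₀ hq0.ne', ← h]
    rw [mul_neg, zpow_neg]
    have : q ^ (2 * r) ≠ 0 := by positivity
    field_simp

include hq0 hq1 in
-- A vanishing factor of index n means ερs² = q^(2(n+1)), which explains why only positive exponents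
-- are excluded in `hR3`.
theorem qInf1_antidiag_ne_zero {ε x₁ x₂ s : ℝ} (hε : ε ≠ 0) (hx₁ : 0 < x₁) (hx₂ : 0 < x₂)
    (hs0 : s ≠ 0) (hR3 : ∀ n : ℤ, 0 < n → ε * (x₂ / x₁) * s ^ 2 ≠ q ^ (2 * n)) :
    qInf1 (q ^ 2) (q ^ 2 * (x₁ / (ε * x₂)) * s⁻¹ ^ 2) ≠ 0 := by
  have hp0 : 0 < q ^ 2 := by positivity
  have hp1 : q ^ 2 < 1 := pow_lt_one₀ hq0.le hq1 (by norm_num)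
  refine qInf1_ne_zero hp0 hp1 fun n h => hR3 (n + 1) (by omega) ?_
  rw [← sq_zpow]
  have e : (q ^ 2) ^ ((n : ℤ) + 1) = q ^ 2 * (q ^ 2) ^ n := by norm_cast; ring
  rw [e]
  field_simp at h ⊢
  linear_combination -h

end

/-! ### Comparison of v with `vReg` -/

section

variable {q : ℝ} (hq0 : 0 < q) (hq1 : q < 1) (k r l : ℤ) {α x₁ x₂ x₃ x₄ u₁ u₂ u₃ u₄ s : ℝ}

include hq0 in
theorem zpow_two_mul_add_three_mul (α : ℝ) (m : ℤ) (x : ℝ) :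
    α * q ^ (2 * m + 3) * x = q ^ 2 * (α * q ^ (2 * m + 1) * x) := by
  rw [show 2 * m + 3 = 2 * m + 1 + 2 by ring, zpow_add₀ hq0.ne' (2 * m + 1) 2]
  norm_cast
  ring

include hq0 in
/-- The function `v` at `ε = 1` in terms of the shifted parameters. -/
theorem v_eq_shiftPar (hα : α ≠ 0) (h₁ : shiftPar q α l x₁ = u₁)
    (h₂ : shiftPar q α (l + r) x₂ = u₂) (h₃ : shiftPar q 1 (k + r) x₃ = u₃)
    (h₄ : shiftPar q 1 k x₄ = u₄) :
    v q k r l 1 α x₁ x₂ x₃ x₄ s =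
      (1 + u₄ * s) * (1 + u₃ / s) / ((1 + q ^ 2 * (u₄ / s)) * (1 + u₃ * s / q ^ 2)) *
        phi [u₁ / u₄ * q ^ 2, u₁ / u₂ * q ^ 2, (s ^ 2)⁻¹ * q ^ 2, q ^ 2]
          [-(q ^ 2 / (u₃ * s)) * q ^ 2, -(u₁ / s) * q ^ 2, (q ^ 2) ^ 2] (q ^ 2) (q ^ 2) +
      qInf1 (q ^ 2) (u₁ / u₄ * q ^ 2) * qInf1 (q ^ 2) (u₁ * u₃) *
          qInf1 (q ^ 2) (-(u₃ * s) * q ^ 2) /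
          (qInf1 (q ^ 2) (-(u₄ * s) * q ^ 2) * qInf1 (q ^ 2) (-(u₃ / s) * q ^ 2) *
            qInf1 (q ^ 2) (-(q ^ 2 / (u₃ * s)))) *
        (qInf1 (q ^ 2) (u₁ / u₂ * q ^ 2) * qInf1 (q ^ 2) ((s ^ 2)⁻¹ * q ^ 2) /
          (qInf1 (q ^ 2) (-(u₁ / s) * q ^ 2) * qInf1 (q ^ 2) (-(u₂ * s)))) *
        ((1 - q ^ 2) / (1 + q ^ 2 * (u₄ / s))) *
        phi [-(u₄ * s), -(u₃ / s), -(u₂ * s)] [u₁ * u₃, -(u₃ * s) * q ^ 2] (q ^ 2) (q ^ 2) := by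
  have hq := hq0.ne'
  have z3 := fun (m : ℤ) (x : ℝ) => zpow_two_mul_add_three_mul hq0 1 m x
  simp only [one_mul] at z3
  have e1 := shiftPar_one_div_four_succ hq0 k l α x₁ x₄
  have e2 := shiftPar_one_div_two_succ hq0 r l hα x₁ x₂
  have g3 : q ^ (3 - 2 * (k + r)) = q ^ 2 * q ^ (1 - 2 * (k + r)) := by
    rw [show 3 - 2 * (k + r) = 2 + (1 - 2 * (k + r)) by ring, zpow_add₀ hq]; norm_cast
  have g1 : q ^ (1 - 2 * (k + r)) = q ^ 2 / q ^ (2 * (k + r) + 1) := by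
    rw [eq_div_iff (by positivity), ← zpow_add₀ hq]
    ring_nf; norm_cast
  have gm : q ^ (2 * (k + r) - 1) = q ^ (2 * (k + r) + 1) / q ^ 2 := by
    rw [eq_div_iff (by positivity), ← zpow_natCast q 2, ← zpow_add₀ hq]
    congr 1; push_cast; ring
  have gp : q ^ (2 * (k + l + r + 1)) = q ^ (2 * l + 1) * q ^ (2 * (k + r) + 1) := by
    rw [← zpow_add₀ hq]; congr 1; ring
  have g4 : q ^ 4 = (q ^ 2) ^ 2 := by ring
  rw [h₁, h₄] at e1
  rw [h₁, h₂] at e2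
  have a1 : α * q ^ (2 * l + 1) * (x₁ / s) = u₁ / s := by rw [← h₁, shiftPar]; ring
  have a2 : α * q ^ (2 * (l + r) + 1) * (x₂ * s) = u₂ * s := by rw [← h₂, shiftPar]; ring
  have a3 : q ^ (2 * (k + r) + 1) * (x₃ * s) = u₃ * s := by rw [← h₃, shiftPar]; ring
  have a3' : q ^ (2 * (k + r) + 1) * (x₃ / s) = u₃ / s := by rw [← h₃, shiftPar]; ring
  have a4 : q ^ (2 * k + 1) * (x₄ * s) = u₄ * s := by rw [← h₄, shiftPar]; ring
  have a4' : q ^ (2 * k + 1) * (x₄ / s) = u₄ / s := by rw [← h₄, shiftPar]; ring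
  have b1 : q ^ 2 * q ^ (1 - 2 * (k + r)) / (x₃ * s) = q ^ 2 / (u₃ * s) * q ^ 2 := by
    rw [g1, ← a3]; simp only [div_eq_mul_inv, mul_inv]; ring
  have b2 : q ^ (1 - 2 * (k + r)) / (x₃ * s) = q ^ 2 / (u₃ * s) := by
    rw [g1, ← a3, div_div]
  have b3 : q ^ (2 * (k + r) - 1) * (x₃ * s) = u₃ * s / q ^ 2 := by
    rw [gm, ← a3]; ring
  have b4 : α * q ^ (2 * (k + l + r + 1)) * (x₁ * x₃) = u₁ * u₃ := by
    rw [gp, ← h₁, ← h₃]; unfold shiftPar; ring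
  unfold v
  simp only [one_mul, z3, g3, g4]
  rw [zpow_two_mul_add_three_mul hq0 α, a1, a2, a3, a3', a4, a4', b1, b2, b3, b4, e1, e2]
  simp only [qInf_cons, qInf_nil, mul_one]
  simp only [mul_comm (q ^ 2) (u₁ / u₄), mul_comm (q ^ 2) (u₁ / u₂), mul_comm (q ^ 2) (u₁ / s),
    mul_comm (q ^ 2) (u₃ * s), mul_comm (q ^ 2) (u₃ / s), mul_comm (q ^ 2) (u₄ * s), neg_mul,
    div_eq_inv_mul (q ^ 2) (s ^ 2), mul_assoc]

include hq0 hq1 in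
-- The ₄φ₃ and the ₃φ₂ of v are the two series of `vReg` divided by their denominator products. The
-- condition `hu` is needed only for this division: `vReg` itself makes sense when (u₁u₃)_∞ = 0.
theorem Adm.v_eq_vReg (hA : Adm (q ^ 2) u₁ u₂ u₃ u₄ s) (hα : α ≠ 0)
    (h₁ : shiftPar q α l x₁ = u₁)
    (h₂ : shiftPar q α (l + r) x₂ = u₂) (h₃ : shiftPar q 1 (k + r) x₃ = u₃)
    (h₄ : shiftPar q 1 k x₄ = u₄) (hu : ∀ n : ℕ, u₁ * u₃ * (q ^ 2) ^ n ≠ 1) :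
    v q k r l 1 α x₁ x₂ x₃ x₄ s * ((1 + q ^ 2 * (u₄ / s)) /
        ((1 + u₄ * s) * (1 + u₃ / s) * (1 + u₁ / s))) =
      vReg (q ^ 2) (u₁ / u₄) (u₁ / u₂) (s ^ 2)⁻¹ (-(q ^ 2 / (u₃ * s))) (-(u₁ / s)) := by
  have hp0 : 0 < q ^ 2 := by positivity
  have hp1 : q ^ 2 < 1 := pow_lt_one₀ hq0.le hq1 (by norm_num)
  have hs := hA.s_ne
  have hu₃ := hA.u₃_ne
  have hq := hq0.ne'
  have z0 := fun {x : ℝ} (hx : ∀ n : ℤ, x ≠ (q ^ 2) ^ n) =>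
    qInf1_ne_zero hp0 hp1 (mul_pow_ne_one_of_ne_zpow hp0 hx)
  have z1 := fun {x : ℝ} (hx : ∀ n : ℤ, x ≠ (q ^ 2) ^ n) (n : ℕ) =>
    zpow_one (q ^ 2) ▸ mul_zpow_mul_pow_ne_one hp0 hx 1 n
  have s1 := fun {x : ℝ} => qInf1_succ hp0 hp1 x
  rw [v_eq_shiftPar hq0 k r l hα h₁ h₂ h₃ h₄,
    phi_four_three_sq hp0 hp1 _ _ _ (z1 (hA.denom_ne hp0 hp1)) (z1 (hA.neg_u₁_div_ne hp0 hp1)),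
    phi_three_two hp0 hp1 _ _ _ hu (z1 (hA.neg_u₃_mul_ne hp0 hp1)), vReg, hA.numer₁_eq hp0,
    hA.numer₂_eq hp0, hA.numer₃_eq hp0]
  have e1 : (q ^ 2) ^ 2 / (-(q ^ 2 / (u₃ * s))) = -(u₃ * s) * q ^ 2 := by field_simp
  have e2 : q ^ 2 * -(u₁ / s) / (-(q ^ 2 / (u₃ * s))) = u₁ * u₃ := by field_simp
  have e3 : 1 + u₃ * s / q ^ 2 = (1 - -(q ^ 2 / (u₃ * s))) / (q ^ 2 / (u₃ * s)) := by
    field_simp; ring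
  have hb : balSeries (q ^ 2) (-(u₂ * s)) (-(u₄ * s)) (-(u₃ / s)) (-(u₃ * s) * q ^ 2) (u₁ * u₃)
      (q ^ 2) = balSeries (q ^ 2) (-(u₄ * s)) (-(u₃ / s)) (-(u₂ * s)) (u₁ * u₃)
        (-(u₃ * s) * q ^ 2) (q ^ 2) := by
    rw [balSeries_swap_denom, balSeries_swap_numer₁₃, balSeries_swap_numer₁₂]
  have d₃ := z0 (hA.neg_u₃_div_ne hp0 hp1)
  have d₄ := z0 (hA.neg_u₄_mul_ne hp0 hp1)
  have d₂ := z0 (hA.neg_u₂_mul_ne hp0 hp1)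
  have dD := z0 (hA.denom_ne hp0 hp1)
  have dE := z0 (hA.neg_u₁_div_ne hp0 hp1)
  have dp := qInf1_self_ne_zero hp0 hp1
  have dF := qInf1_ne_zero hp0 hp1 hu
  have dG := qInf1_ne_zero hp0 hp1 (z1 (hA.neg_u₃_mul_ne hp0 hp1))
  have dw : 1 + q ^ 2 * (u₄ / s) ≠ 0 := fun h => hA.neg_u₄_div_ne hp0 hp1 (-1) (by
    rw [zpow_neg_one]; field_simp at h ⊢; linarith)
  have hp2 : (q ^ 2) ^ 2 = q ^ 2 * q ^ 2 := by ring
  have hx0 : q ^ 2 / (u₃ * s) ≠ 0 := by positivity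
  rw [e1, e2, e3, hb]
  rw [hp2]
  rw [s1 (x := -(u₃ / s))] at d₃ ⊢
  rw [s1 (x := -(u₄ * s))] at d₄ ⊢
  rw [s1 (x := -(q ^ 2 / (u₃ * s)))] at dD ⊢
  rw [s1 (x := -(u₁ / s))] at dE ⊢
  rw [s1 (x := q ^ 2)] at dp ⊢
  rw [sub_neg_eq_add] at d₃ d₄ dD dE ⊢
  rw [sub_neg_eq_add, sub_neg_eq_add, sub_neg_eq_add]
  have d₃' := left_ne_zero_of_mul d₃
  have d₄' := left_ne_zero_of_mul d₄
  have dD' := left_ne_zero_of_mul dD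
  have dE' := left_ne_zero_of_mul dE
  have dp' := left_ne_zero_of_mul dp
  replace d₃ := right_ne_zero_of_mul d₃
  replace d₄ := right_ne_zero_of_mul d₄
  replace dD := right_ne_zero_of_mul dD
  replace dE := right_ne_zero_of_mul dE
  replace dp := right_ne_zero_of_mul dp
  generalize balSeries (q ^ 2) _ _ _ _ _ (q ^ 2 * q ^ 2) = b₁
  generalize balSeries (q ^ 2) _ _ _ _ _ (q ^ 2) = b₂
  generalize qInf1 (q ^ 2) (-(u₃ / s) * q ^ 2) = c₁ at *
  generalize qInf1 (q ^ 2) (-(u₄ * s) * q ^ 2) = c₂ at *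
  generalize qInf1 (q ^ 2) (-(q ^ 2 / (u₃ * s)) * q ^ 2) = c₃ at *
  generalize qInf1 (q ^ 2) (-(u₁ / s) * q ^ 2) = c₄ at *
  generalize qInf1 (q ^ 2) (q ^ 2 * q ^ 2) = c₅ at *
  generalize qInf1 (q ^ 2) (-(u₂ * s)) = c₆ at *
  generalize qInf1 (q ^ 2) (u₁ * u₃) = c₇ at *
  generalize qInf1 (q ^ 2) (-(u₃ * s) * q ^ 2) = c₈ at *
  generalize qInf1 (q ^ 2) (u₁ / u₄ * q ^ 2) = c₉ at *
  generalize qInf1 (q ^ 2) (u₁ / u₂ * q ^ 2) = c₁₀ at *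
  generalize qInf1 (q ^ 2) ((s ^ 2)⁻¹ * q ^ 2) = c₁₁ at *
  clear hb e1 e2 e3 z0 z1 s1 hA h₁ h₂ h₃ h₄ hu
  generalize q ^ 2 / (u₃ * s) = y at *
  generalize 1 + q ^ 2 * (u₄ / s) = w at *
  generalize 1 + u₃ / s = w₃ at *
  generalize 1 + u₄ * s = w₄ at *
  generalize 1 + u₁ / s = w₁ at *
  generalize 1 - q ^ 2 = w₀ at *
  generalize 1 + y = w₂ at *
  field_simp

end

/-! ### Reduction of z = ε to z = 1 -/

section

variable {q : ℝ} (k r l : ℤ) {ε : ℝ} (hε : ε = 1 ∨ ε = -1) (α x₁ x₂ x₃ x₄ s t : ℝ)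

include hε

theorem v_sign : v q k r l ε α x₁ x₂ x₃ x₄ s = v q k r l 1 α x₁ (ε * x₂) x₃ (ε * x₄) s := by
  rcases hε with rfl | rfl
  · simp only [one_mul]
  · simp only [v, one_mul, neg_mul, mul_neg, div_neg, neg_div, neg_neg]

theorem c_sign : c q ε x₁ x₂ x₄ s (ε * t) = c q 1 x₁ (ε * x₂) (ε * x₄) s t := by
  rcases hε with rfl | rfl
  · simp only [one_mul]
  · simp only [c, one_mul, neg_mul, mul_neg, div_neg, neg_div, neg_neg]

theorem kappa_sign : kappa q r ε α x₁ x₂ (ε * t) = kappa q r 1 α x₁ (ε * x₂) t := by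
  rcases hε with rfl | rfl
  · simp only [one_mul]
  · have h : (-1 : ℝ) ^ r * (-1) ^ (-r) = 1 := by rw [← zpow_add₀ (by norm_num)]; simp
    have h2 : (-1 : ℝ) ^ r * α ^ r * (-1 * t) ^ (-r) = 1 ^ r * α ^ r * t ^ (-r) := by
      rw [mul_zpow, one_zpow]; linear_combination α ^ r * t ^ (-r) * h
    rw [kappa, kappa, h2]
    simp only [one_mul, neg_mul, mul_neg, div_neg]

/-- In κ_r the sign z^r cancels the one from s₄^(−r), and x₂, x₄ absorb the others; only z^(−k−r)
survives. -/
theorem R_sign : R q k r l ε α x₁ x₂ x₃ x₄ s (ε * t) =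
    ε ^ (k + r) * R q k r l 1 α x₁ (ε * x₂) x₃ (ε * x₄) s t := by
  have hz : ε ^ (-k - r) = ε ^ (k + r) * 1 ^ (-k - r) := by
    rw [one_zpow, mul_one, show -k - r = -(k + r) by ring, zpow_neg, ← inv_zpow]
    rcases hε with rfl | rfl <;> norm_num
  rw [R, R, kappa_sign r hε, hz]
  generalize kappa q r 1 α x₁ (ε * x₂) t = κ
  generalize ε ^ (k + r) = c
  rcases hε with rfl | rfl
  · simp only [one_mul]; ring
  · simp only [S, one_mul, neg_mul, mul_neg, div_neg, neg_div, neg_neg, inv_neg, inv_one, mul_one,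
      neg_sq]
    ring

theorem rElt_sign (β Z : ℝ) :
    rElt q k r l ε α β Z x₁ x₂ x₃ x₄ s (ε * t) =
      ε ^ (k + r) * rElt q k r l 1 α β Z x₁ (ε * x₂) x₃ (ε * x₄) s t := by
  have ht : (ε * t)⁻¹ = ε * t⁻¹ := by rcases hε with rfl | rfl <;> simp
  rw [rElt, rElt, ht, R_sign k r l hε, R_sign k r l hε, c_sign hε, c_sign hε]
  generalize R q k r l 1 α x₁ (ε * x₂) x₃ (ε * x₄) s t = R₁
  generalize R q k r l 1 α x₁ (ε * x₂) x₃ (ε * x₄) s t⁻¹ = R₂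
  generalize c q 1 x₁ (ε * x₂) (ε * x₄) s t = c₁
  generalize c q 1 x₁ (ε * x₂) (ε * x₄) s t⁻¹ = c₂
  generalize ε ^ (k + r) = c
  rcases hε with rfl | rfl
  · simp only [one_mul]; ring
  · simp only [one_mul, neg_mul, mul_neg, div_neg, neg_div, neg_neg, inv_neg, inv_one, mul_one]
    ring

/-- The map changing x₂, x₄ to εx₂, εx₄ is continuous and sends regular points for ε to regular
points for 1, so the limit transfers. -/
theorem HasValue.sign {α β Z x₁ x₂ x₃ x₄ s w : ℝ}
    (h : HasValue q k r l 1 α β Z x₁ (ε * x₂) x₃ (ε * x₄) s w) :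
    HasValue q k r l ε α β Z x₁ x₂ x₃ x₄ s (ε ^ (k + r) * w) := by
  have hε' : ε⁻¹ = ε := by rcases hε with rfl | rfl <;> norm_num
  have hεε : ε * ε = 1 := by rcases hε with rfl | rfl <;> norm_num
  have hf : Tendsto (fun y : ℝ × ℝ × ℝ × ℝ × ℝ => (y.1, ε * y.2.1, y.2.2.1, ε * y.2.2.2.1,
      y.2.2.2.2)) (𝓝[regularSet q k r l ε α] (x₁, x₂, x₃, x₄, s))
      (𝓝[regularSet q k r l 1 α] (x₁, ε * x₂, x₃, ε * x₄, s)) := by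
    refine tendsto_nhdsWithin_iff.2 ⟨?_, ?_⟩
    · exact (Continuous.tendsto (by fun_prop) (x₁, x₂, x₃, x₄, s)).mono_left nhdsWithin_le_nhds
    · filter_upwards [self_mem_nhdsWithin] with y hy
      refine ⟨?_, fun n => ?_⟩
      · have := hy.1
        change ε * y.2.1 * (ε * y.2.2.2.1) = y.1 * y.2.2.1
        linear_combination hεε * (y.2.1 * y.2.2.2.1) + this
      · obtain ⟨a, b, c⟩ := hy.2 n
        refine ⟨?_, b, ?_⟩
        · convert a using 1
          rw [div_mul_eq_div_div_swap, div_eq_mul_inv _ ε, hε']; ring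
        · convert c using 1
          rw [mul_assoc ε, div_mul_eq_div_div_swap, div_eq_mul_inv _ ε, hε']; ring
  refine ((h.comp hf).const_mul (ε ^ (k + r))).congr fun y => ?_
  rw [rElt_sign k r l hε]
  simp only [Function.comp, one_mul]

end

/-! ### The explicit formula of part (1) -/

section

variable {q : ℝ} (hq0 : 0 < q) (hq1 : q < 1) (k r l : ℤ) {α x₁ x₂ x₃ x₄ u₁ u₂ u₃ u₄ s : ℝ}

include hq0 hq1 in
theorem rFormula_eq_rReg (hA : Adm (q ^ 2) u₁ u₂ u₃ u₄ s) (hα : α = 1 ∨ α = -1)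
    (h₁ : shiftPar q α l x₁ = u₁)
    (h₂ : shiftPar q α (l + r) x₂ = u₂) (h₃ : shiftPar q 1 (k + r) x₃ = u₃)
    (h₄ : shiftPar q 1 k x₄ = u₄) (hu : ∀ n : ℕ, u₁ * u₃ * (q ^ 2) ^ n ≠ 1) (α' Z : ℝ) :
    rFormula q k r l α α' Z x₁ x₂ x₃ x₄ s =
      rReg q k r l α α' Z x₁ x₂ x₃ x₄ u₁ u₂ u₃ u₄ s := by
  have hα0 : α ≠ 0 := by rcases hα with rfl | rfl <;> norm_num
  have hα' : α⁻¹ = α := by rcases hα with rfl | rfl <;> norm_num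
  have hv := hA.v_eq_vReg hq0 hq1 k r l hα0 h₁ h₂ h₃ h₄ hu
  have e1 := shiftPar_one_div_four_succ hq0 k l α x₁ x₄
  have e1' : α * q ^ (2 * (k - l + 1)) * (x₄ / x₁) = q ^ 2 * (u₄ / u₁) := by
    have := shiftPar_one_div_four_succ hq0 l k α x₄ x₁
    rw [this, ← h₁, ← h₄]
    unfold shiftPar
    simp only [div_eq_mul_inv, mul_inv, hα', one_mul]
    ring
  rw [h₁, h₄] at e1
  have a1 : α * q ^ (2 * l + 1) * (x₁ / s) = u₁ / s := by rw [← h₁, shiftPar]; ring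
  have a1' : α * q ^ (2 * l + 1) * (x₁ * s) = u₁ * s := by rw [← h₁, shiftPar]; ring
  have a2 : α * q ^ (2 * (l + r) + 1) * (x₂ * s) = u₂ * s := by rw [← h₂, shiftPar]; ring
  have a2' : α * q ^ (2 * (l + r) + 1) * (x₂ / s) = u₂ / s := by rw [← h₂, shiftPar]; ring
  have a3 : q ^ (2 * (k + r) + 1) * (x₃ * s) = u₃ * s := by rw [← h₃, shiftPar]; ring
  have a3' : q ^ (2 * (k + r) + 1) * (x₃ / s) = u₃ / s := by rw [← h₃, shiftPar]; ring
  have a4 : q ^ (2 * k + 1) * (x₄ * s) = u₄ * s := by rw [← h₄, shiftPar]; ring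
  have a4' : q ^ (2 * k + 1) * (x₄ / s) = u₄ / s := by rw [← h₄, shiftPar]; ring
  have z4 := zpow_two_mul_add_three_mul hq0 1 k (x₄ / s)
  rw [one_mul, one_mul] at z4
  rw [rFormula, rReg, z4, a1, a1', a2, a2', a3, a3', a4, a4', e1, e1', ← hv]
  simp only [qInf_cons, qInf_nil, theta_cons, theta_nil, mul_one, wSq, mul_assoc]
  generalize 1 + q ^ 2 * (u₄ / s) = w
  generalize 1 + u₃ / s = w₃
  generalize 1 + u₄ * s = w₄
  generalize 1 + u₁ / s = w₁
  generalize 1 - q ^ 2 = w₀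
  generalize √ _ = W
  generalize v q k r l 1 α x₁ x₂ x₃ x₄ s = V
  ring

end

/-- The second series in `vReg` carries the factor (Ap)_∞, so only the ₄φ₃ remains; this is the
function t when A is a negative power of p. -/
theorem vReg_of_qInf1_eq_zero {p : ℝ} (hp0 : 0 < p) (hp1 : p < 1) {A B C D E : ℝ} (hD0 : D ≠ 0)
    (hA : qInf1 p (A * p) = 0) (hD : ∀ n : ℕ, D * p ^ n ≠ 1) (hE : ∀ n : ℕ, E * p ^ n ≠ 1) :
    vReg p A B C D E = 1 / ((1 - 1 / D) * (1 - E)) *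
      phi [A * p, B * p, C * p, p] [D * p, E * p, p ^ 2] p p := by
  have e : ∀ {x : ℝ}, (∀ n : ℕ, x * p ^ n ≠ 1) → ∀ n : ℕ, x * p * p ^ n ≠ 1 := fun hx n => by
    have := hx (n + 1)
    rwa [pow_succ', ← mul_assoc] at this
  rw [phi_four_three_sq hp0 hp1 _ _ _ (e hD) (e hE), vReg, hA]
  have nD := qInf1_ne_zero hp0 hp1 (e hD)
  have nE := qInf1_ne_zero hp0 hp1 (e hE)
  have np := qInf1_self_ne_zero hp0 hp1
  have hD1 : D - 1 ≠ 0 := sub_ne_zero.2 (by simpa using hD 0)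
  have hD1' : 1 - D ≠ 0 := fun h => hD1 (by linarith)
  have hE1 : 1 - E ≠ 0 := sub_ne_zero.2 (by simpa using (hE 0).symm)
  have hpp : qInf1 p p = (1 - p) * qInf1 p (p ^ 2) := by rw [qInf1_succ hp0 hp1, pow_two]
  rw [hpp] at np ⊢
  rw [qInf1_succ hp0 hp1 D, qInf1_succ hp0 hp1 E]
  have np' := right_ne_zero_of_mul np
  have hp : 1 - p ≠ 0 := left_ne_zero_of_mul np
  have hs : 1 - 1 / D = -(1 - D) / D := by field_simp; ring
  rw [hs]
  field_simp
  ring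

/-! ### The function V and the terminating series -/

section

variable {q : ℝ} (hq0 : 0 < q) (hq1 : q < 1) (k r l : ℤ) {ε x₁ x₂ u₁ u₂ u₃ u₄ s : ℝ}

include hq0 in
theorem t_eq_phi (h₁ : shiftPar q ε l x₁ = u₁) (h₃ : shiftPar q 1 (k + r) x₂ = u₃) :
    t q k r l ε x₁ x₂ s = 1 / ((1 - 1 / (-(q ^ 2 / (u₃ * s)))) * (1 - -(u₁ / s))) *
      phi [q ^ (2 * (l - k)) * q ^ 2, ε * (q ^ (-2 * r) * (x₁ / x₂)) * q ^ 2, (s ^ 2)⁻¹ * q ^ 2,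
        q ^ 2] [-(q ^ 2 / (u₃ * s)) * q ^ 2, -(u₁ / s) * q ^ 2, (q ^ 2) ^ 2] (q ^ 2) (q ^ 2) := by
  have hq := hq0.ne'
  have g0 : q ^ (-2 * (k - l - 1)) = q ^ (2 * (l - k)) * q ^ 2 := by
    rw [show -2 * (k - l - 1) = 2 * (l - k) + 2 by ring, zpow_add₀ hq]; norm_cast
  have g2 : q ^ (2 - 2 * r) = q ^ (-2 * r) * q ^ 2 := by
    rw [show 2 - 2 * r = -2 * r + 2 by ring, zpow_add₀ hq]; norm_cast
  have g3 : q ^ (3 - 2 * (k + r)) = q ^ 2 / q ^ (2 * (k + r) + 1) * q ^ 2 := by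
    rw [div_mul_eq_mul_div, eq_div_iff (by positivity), ← zpow_add₀ hq]
    ring_nf; norm_cast
  have gm : q ^ (2 * (k + r) - 1) = q ^ (2 * (k + r) + 1) / q ^ 2 := by
    rw [eq_div_iff (by positivity), ← zpow_natCast q 2, ← zpow_add₀ hq]
    congr 1; push_cast; ring
  have g4 : q ^ 4 = (q ^ 2) ^ 2 := by ring
  have a1 : ε * q ^ (2 * l + 1) * (x₁ / s) = u₁ / s := by rw [← h₁, shiftPar]; ring
  have a3 : q ^ (2 * (k + r) + 1) * (x₂ * s) = u₃ * s := by rw [← h₃, shiftPar]; ring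
  have b1 : q ^ 2 / q ^ (2 * (k + r) + 1) * q ^ 2 / (x₂ * s) = q ^ 2 / (u₃ * s) * q ^ 2 := by
    rw [← a3]; simp only [div_eq_mul_inv, mul_inv]; ring
  have b2 : ε * (q ^ (-2 * r) * q ^ 2) * (x₁ / x₂) =
      ε * (q ^ (-2 * r) * (x₁ / x₂)) * q ^ 2 := by ring
  change 1 / _ * phi _ _ _ _ = _
  rw [g0, g2, g3, g4, gm, zpow_two_mul_add_three_mul hq0, a1, b1, b2, div_eq_inv_mul (q ^ 2) (s ^ 2),
    div_mul_eq_mul_div (q ^ (2 * (k + r) + 1)), a3]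
  simp only [mul_comm (q ^ 2) (u₁ / s), neg_mul]
  congr 4
  · rw [one_div, inv_neg, inv_div, neg_neg]
  · rw [neg_neg]

theorem tTerm_eq_zero (hq0 : 0 < q) (h : l < k) (n : ℕ) (hn : k - l ≤ n) (ε x₁ x₂ s : ℝ) :
    tTerm q k r l ε x₁ x₂ s n = 0 := by
  -- With m = k − l − 1 the numerator parameter is p⁻ᵐ, whose factor of index m vanishes; so (p⁻ᵐ)_n
  -- = 0 from n = m + 1 = k − l on.
  obtain ⟨m, hm⟩ := Int.eq_ofNat_of_zero_le (show 0 ≤ k - l - 1 by omega)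
  have h0 : qFac (q ^ 2) (q ^ (-2 * (k - l - 1))) n = 0 := by
    refine Finset.prod_eq_zero (i := m) (Finset.mem_range.2 (by omega)) ?_
    rw [hm, ← zpow_natCast, sq_zpow, ← zpow_add₀ hq0.ne']
    simp
  rw [tTerm, phiTerm, qFin, List.map_cons, List.prod_cons, qFin1_natCast, h0]
  simp

include hq0 hq1 in
-- Here u₁/u₄ = q^(2(l−k)). For k > l one series of `vReg` drops out. For k < l the inversion A ↦
-- A⁻¹, B ↦ B⁻¹ exchanges the roles of u₁ and u₃ and leads back to that case. For k = l, u₁ = u₄ and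
-- the comparison with v applies.
theorem V_eq_vReg (hε : ε = 1 ∨ ε = -1) (hx₁ : x₁ ≠ 0)
    (h₁ : shiftPar q ε l x₁ = u₁)
    (h₂ : shiftPar q ε (l + r) (ε * x₂) = u₂) (h₃ : shiftPar q 1 (k + r) x₂ = u₃)
    (h₄ : shiftPar q 1 k (ε * x₁) = u₄) (hA : Adm (q ^ 2) u₁ u₂ u₃ u₄ s)
    (hu : k = l → ∀ n : ℕ, u₁ * u₃ * (q ^ 2) ^ n ≠ 1) :
    V q k r l ε x₁ x₂ s =
      vReg (q ^ 2) (u₁ / u₄) (u₁ / u₂) (s ^ 2)⁻¹ (-(q ^ 2 / (u₃ * s))) (-(u₁ / s)) := by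
  have hp0 : 0 < q ^ 2 := by positivity
  have hp1 : q ^ 2 < 1 := pow_lt_one₀ hq0.le hq1 (by norm_num)
  have hs := hA.s_ne
  have hu₁ := hA.u₁_ne
  have hu₂ := hA.u₂_ne
  have hu₃ := hA.u₃_ne
  have hu₄ := hA.u₄_ne
  have hq := hq0.ne'
  have hε0 : ε ≠ 0 := by rcases hε with rfl | rfl <;> norm_num
  have hε' : ε⁻¹ = ε := by rcases hε with rfl | rfl <;> norm_num
  have hεε : ε * ε = 1 := by rcases hε with rfl | rfl <;> norm_num
  have m := fun {x : ℝ} (hx : ∀ n : ℤ, x ≠ (q ^ 2) ^ n) => mul_pow_ne_one_of_ne_zpow hp0 hx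
  have hAA : u₁ / u₄ = q ^ (2 * (l - k)) := by
    rw [← h₁, ← h₄, ← shiftPar_one_div_four hq0]
    field_simp
  have hBB : u₁ / u₂ = ε * (q ^ (-2 * r) * (x₁ / x₂)) := by
    rw [← h₁, ← h₂, ← shiftPar_one_div_two hq0 r l hε0]
    simp only [div_eq_mul_inv, mul_inv, hε']
    ring
  have vanish : ∀ m : ℤ, m < 0 → qInf1 (q ^ 2) (q ^ (2 * m) * q ^ 2) = 0 := fun m hm => by
    obtain ⟨n, hn⟩ := Int.eq_ofNat_of_zero_le (show 0 ≤ -m - 1 by omega)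
    refine qInf1_eq_zero hp0 hp1 n ?_
    rw [← zpow_natCast _ n, ← hn, ← sq_zpow, ← zpow_add_one₀ hp0.ne', ← zpow_add₀ hp0.ne']
    ring_nf; norm_num
  unfold V
  split_ifs with hlk hkl
  · rw [t_eq_phi hq0 k r l h₁ h₃, hAA, hBB, vReg_of_qInf1_eq_zero hp0 hp1 (by simp [hq, hu₃, hs])
      (vanish _ (by omega)) (m (hA.denom_ne hp0 hp1)) (m (hA.neg_u₁_div_ne hp0 hp1))]
  · have hρ := ne_zpow_of_theta1_ne_zero hp0 hp1 hA.theta_ρ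
    have hss := ne_zpow_of_theta1_ne_zero hp0 hp1 hA.theta_s
    have hu₁s : ∀ n : ℤ, -(u₁ * s) ≠ (q ^ 2) ^ n :=
      ne_zpow_of_theta1_ne_zero hp0 hp1 (left_ne_zero_of_mul hA.theta₁.ne')
    have f1 : (s ^ 2)⁻¹ * q ^ 2 / (-(u₁ / s)) = -(q ^ 2 / (u₁ * s)) := by field_simp
    have f2 := hA.numer₃_eq hp0
    have f3 : (s ^ 2)⁻¹ / (-(u₁ / s)) = (-(u₁ * s))⁻¹ := by field_simp
    -- The inversion lemma divides by 1 − A, so it is available only for k ≠ l.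
    have hA1 : u₁ / u₄ ≠ 1 := by
      rw [hAA, ← sq_zpow]
      intro h
      rw [zpow_eq_one_iff_right₀ hp0.le hp1.ne] at h
      omega
    rw [← vReg_inv hp0 hp1 (by simp [hq, hu₃, hs]) (by positivity) (by positivity) (by positivity)
      hA1 (by simpa using hρ 0) (fun h => hss 0 (by simpa using h)) hA.balanced
      (hA.denom_ne hp0 hp1) (hA.neg_u₁_div_ne hp0 hp1)
      (by rw [hA.numer₁_eq hp0]; exact m (hA.neg_u₂_mul_ne hp0 hp1))
      (by rw [hA.numer₂_eq hp0]; exact m (hA.neg_u₄_mul_ne hp0 hp1))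
      (fun n h => hA.neg_u₃_div_ne hp0 hp1 (n + 1) (by
        rw [← f2, mul_div_right_comm, h, zpow_add_one₀ hp0.ne']))
      (by rw [f3]; exact inv_ne_zpow hu₁s), f1, f2]
    have h₁' : shiftPar q ε (k + r) (ε * x₂) = u₃ := by
      rw [← h₃, shiftPar_mul, hεε]
    have h₃' : shiftPar q 1 (l + r + -r) (ε * x₁) = u₁ := by
      rw [← h₁, shiftPar_mul, one_mul, add_neg_cancel_right]
    have hA' : (u₁ / u₄)⁻¹ = q ^ (2 * (k + r - (l + r))) := by
      rw [hAA, ← zpow_neg]; congr 1; ring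
    have hB' : (u₁ / u₂)⁻¹ = ε * (q ^ (-2 * -r) * (ε * x₂ / (ε * x₁))) := by
      rw [hBB, mul_div_mul_left _ _ hε0, mul_inv, mul_inv, hε', inv_div, ← zpow_neg]
      ring_nf
    have hu₁d : ∀ n : ℤ, -(q ^ 2 / (u₁ * s)) ≠ (q ^ 2) ^ n := fun n => by
      have := mul_self_ne_zpow hp0 (inv_ne_zpow hu₁s) n
      rwa [inv_neg, mul_neg, ← div_eq_mul_inv] at this
    rw [t_eq_phi hq0 (l + r) (-r) (k + r) h₁' h₃', hA', hB',
      vReg_of_qInf1_eq_zero hp0 hp1 (by simp [hq, hu₁, hs])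
      (vanish _ (by omega)) (m hu₁d) (m (hA.neg_u₃_div_ne hp0 hp1))]
  · obtain rfl : k = l := by omega
    have a1 : ε * q ^ (2 * k + 1) * (x₁ / s) = u₁ / s := by rw [← h₁, shiftPar]; ring
    have a3 : q ^ (2 * (k + r) + 1) * (x₂ / s) = u₃ / s := by rw [← h₃, shiftPar]; ring
    have a4 : ε * q ^ (2 * k + 1) * (x₁ * s) = u₄ * s := by rw [← h₄, shiftPar]; ring
    have h14 : u₁ = u₄ := by rw [← h₁, ← h₄, shiftPar, shiftPar]; ring
    rw [← hA.v_eq_vReg hq0 hq1 k r k hε0 h₁ h₂ h₃ h₄ (hu rfl), v_sign k r k hε,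
      zpow_two_mul_add_three_mul hq0, a1, a3, a4, ← h14]
    ring

end

theorem sign_mul_of_pos {c x : ℝ} (hc : 0 < c) : Real.sign (c * x) = Real.sign x := by
  rcases lt_trichotomy x 0 with h | rfl | h
  · rw [Real.sign_of_neg h, Real.sign_of_neg (mul_neg_of_pos_of_neg hc h)]
  · simp
  · rw [Real.sign_of_pos h, Real.sign_of_pos (mul_pos hc h)]

theorem Adm.wSq_diag {p u₁ u₂ s : ℝ} (hA : Adm p u₁ u₂ u₂ u₁ s) : wSq p u₁ u₂ u₂ u₁ s = 1 := by
  have n₁ := left_ne_zero_of_mul hA.pos₁.ne'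
  have n₁' := right_ne_zero_of_mul hA.pos₁.ne'
  have n₂ := left_ne_zero_of_mul hA.pos₂.ne'
  have n₂' := right_ne_zero_of_mul hA.pos₂.ne'
  rw [wSq, div_eq_one_iff_eq (by positivity)]
  ring

/-! ### Specialization z = α = ε, x₄ = x₁, x₃ = x₂ -/

section

variable {q : ℝ} (hq0 : 0 < q) (hq1 : q < 1) (k r l : ℤ) {ε x₁ x₂ u₁ u₂ u₃ u₄ s : ℝ}

include hq0 hq1 in
-- The exponents m and n may differ: if one shift v of a avoids all powers of p, then so does a, and
-- every quotient formula based at a is valid.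
theorem qFin1_eq_div_shift {m n : ℤ} {a u v : ℝ} (hu : u = a * (q ^ 2) ^ m)
    (hv : v = a * (q ^ 2) ^ n) (h : ∀ i : ℤ, v ≠ (q ^ 2) ^ i) :
    qFin1 (q ^ 2) a m = qInf1 (q ^ 2) a / qInf1 (q ^ 2) u ∧ qInf1 (q ^ 2) a ≠ 0 := by
  have hp0 : 0 < q ^ 2 := by positivity
  have hp1 : q ^ 2 < 1 := pow_lt_one₀ hq0.le hq1 (by norm_num)
  have ha : ∀ i : ℤ, a ≠ (q ^ 2) ^ i := fun i hi => h (i + n) (by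
    rw [hv, hi, zpow_add₀ hp0.ne'])
  exact ⟨by rw [hu, qFin1_eq_div hp0 hp1 ha], qInf1_ne_zero hp0 hp1
    (mul_pow_ne_one_of_ne_zpow hp0 ha)⟩

include hq0 in
theorem shiftPar_mul_zpow (β : ℝ) (m : ℤ) (x : ℝ) :
    shiftPar q β m x = β * q * x * (q ^ 2) ^ m := by
  rw [sq_zpow, shiftPar, zpow_add_one₀ hq0.ne']; ring

include hq0 hq1 in
/-- The finite shifted factorials in the formula for `z = α` as quotients of infinite ones. -/
theorem Adm.qFin_special (h₁ : shiftPar q ε l x₁ = u₁)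
    (h₂ : shiftPar q ε (l + r) (ε * x₂) = u₂) (h₃ : shiftPar q 1 (k + r) x₂ = u₃)
    (h₄ : shiftPar q 1 k (ε * x₁) = u₄) (hε : ε = 1 ∨ ε = -1) (hA : Adm (q ^ 2) u₁ u₂ u₃ u₄ s) :
    ∃ a a' b b' : ℝ, a ≠ 0 ∧ a' ≠ 0 ∧ b ≠ 0 ∧ b' ≠ 0 ∧
      qFin (q ^ 2) [-(ε * q * (x₁ / s)), -(q ^ (2 * r + 1) * (x₂ * s))] k =
        a / qInf1 (q ^ 2) (-(u₄ / s)) * (b / qInf1 (q ^ 2) (-(u₃ * s))) ∧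
      qFin (q ^ 2) [-(ε * q * (x₁ / s)), -(q ^ (2 * r + 1) * (x₂ * s))] l =
        a / qInf1 (q ^ 2) (-(u₁ / s)) * (b / qInf1 (q ^ 2) (-(u₂ * s))) ∧
      qFin (q ^ 2) [-(ε * q * (x₁ * s)), -(q ^ (2 * r + 1) * (x₂ / s))] k =
        a' / qInf1 (q ^ 2) (-(u₄ * s)) * (b' / qInf1 (q ^ 2) (-(u₃ / s))) ∧
      qFin (q ^ 2) [-(ε * q * (x₁ * s)), -(q ^ (2 * r + 1) * (x₂ / s))] l =
        a' / qInf1 (q ^ 2) (-(u₁ * s)) * (b' / qInf1 (q ^ 2) (-(u₂ / s))) := by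
  have hp0 : 0 < q ^ 2 := by positivity
  have hp1 : q ^ 2 < 1 := pow_lt_one₀ hq0.le hq1 (by norm_num)
  have hεε : ε * ε = 1 := by rcases hε with rfl | rfl <;> norm_num
  have hqr : q ^ (2 * r + 1) = q * (q ^ 2) ^ r := by
    rw [sq_zpow, zpow_add_one₀ hq0.ne', mul_comm]
  rw [shiftPar_mul_zpow hq0] at h₁ h₄
  rw [shiftPar_mul, hεε, shiftPar_mul_zpow hq0, zpow_add₀ hp0.ne'] at h₂
  rw [shiftPar_mul_zpow hq0, zpow_add₀ hp0.ne'] at h₃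
  have hA1 := hA.neg_u₁_div_ne hp0 hp1
  have hA2 := hA.neg_u₂_mul_ne hp0 hp1
  have hA3 : ∀ n : ℤ, -(u₁ * s) ≠ (q ^ 2) ^ n :=
    ne_zpow_of_theta1_ne_zero hp0 hp1 (left_ne_zero_of_mul hA.theta₁.ne')
  have hA4 : ∀ n : ℤ, -(u₂ / s) ≠ (q ^ 2) ^ n :=
    ne_zpow_of_theta1_ne_zero hp0 hp1 (right_ne_zero_of_mul hA.theta₂.ne')
  have e1 : -(u₁ / s) = -(ε * q * (x₁ / s)) * (q ^ 2) ^ l := by rw [← h₁]; ring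
  have e1' : -(u₁ * s) = -(ε * q * (x₁ * s)) * (q ^ 2) ^ l := by rw [← h₁]; ring
  have e2 : -(u₂ * s) = -(q ^ (2 * r + 1) * (x₂ * s)) * (q ^ 2) ^ l := by rw [hqr, ← h₂]; ring
  have e2' : -(u₂ / s) = -(q ^ (2 * r + 1) * (x₂ / s)) * (q ^ 2) ^ l := by rw [hqr, ← h₂]; ring
  have e3 : -(u₃ * s) = -(q ^ (2 * r + 1) * (x₂ * s)) * (q ^ 2) ^ k := by rw [hqr, ← h₃]; ring
  have e3' : -(u₃ / s) = -(q ^ (2 * r + 1) * (x₂ / s)) * (q ^ 2) ^ k := by rw [hqr, ← h₃]; ring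
  have e4 : -(u₄ / s) = -(ε * q * (x₁ / s)) * (q ^ 2) ^ k := by rw [← h₄]; ring
  have e4' : -(u₄ * s) = -(ε * q * (x₁ * s)) * (q ^ 2) ^ k := by rw [← h₄]; ring
  have Q := fun {m n : ℤ} {a u v : ℝ} (hu : u = a * (q ^ 2) ^ m) (hv : v = a * (q ^ 2) ^ n)
    (h : ∀ i : ℤ, v ≠ (q ^ 2) ^ i) => qFin1_eq_div_shift hq0 hq1 hu hv h
  -- The witnesses are the infinite products at the unshifted bases. The pairs u₄, u₁ and u₃, u₂ are
  -- shifts by k and l of the same base, so the same four numbers serve for both indices.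
  refine ⟨_, _, _, _, (Q e1 e1 hA1).2, (Q e1' e1' hA3).2, (Q e2 e2 hA2).2, (Q e2' e2' hA4).2,
    ?_, ?_, ?_, ?_⟩ <;>
  simp only [qFin, List.map_cons, List.map_nil, List.prod_cons, List.prod_nil, mul_one]
  · rw [(Q e4 e1 hA1).1, (Q e3 e2 hA2).1]
  · rw [(Q e1 e1 hA1).1, (Q e2 e2 hA2).1]
  · rw [(Q e4' e1' hA3).1, (Q e3' e2' hA4).1]
  · rw [(Q e1' e1' hA3).1, (Q e2' e2' hA4).1]

include hq0 hq1 in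
-- The two arguments differ by a nonzero square divided by the positive pairs at u₁ and u₂.
theorem rootSign_eq_special (h₁ : shiftPar q ε l x₁ = u₁)
    (h₂ : shiftPar q ε (l + r) (ε * x₂) = u₂) (h₃ : shiftPar q 1 (k + r) x₂ = u₃)
    (h₄ : shiftPar q 1 k (ε * x₁) = u₄) (hε : ε = 1 ∨ ε = -1) (hA : Adm (q ^ 2) u₁ u₂ u₃ u₄ s) :
    rootSign q k r l ε x₁ (ε * x₂) x₂ (ε * x₁) s = rootSignSpecial q k r l ε x₁ x₂ s := by
  obtain ⟨a, a', b, b', ha, -, hb, -, hk, hl, -, -⟩ :=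
    hA.qFin_special hq0 hq1 k r l h₁ h₂ h₃ h₄ hε
  have hθ : -(ε * x₁ / s * q) = -(ε * q * (x₁ / s)) := by ring
  rw [rootSign_eq k r l h₁ h₂ h₃ h₄, rootSignSpecial, hk, hl, theta_cons, theta_nil, mul_one, hθ]
  have p₁ := hA.pos₁
  have p₂ := hA.pos₂
  have n₁ := left_ne_zero_of_mul p₁.ne'
  have n₁' := right_ne_zero_of_mul p₁.ne'
  have n₂ := left_ne_zero_of_mul p₂.ne'
  have n₂' := right_ne_zero_of_mul p₂.ne'
  have n₃ := left_ne_zero_of_mul hA.pos₃.ne'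
  have n₄ := right_ne_zero_of_mul hA.pos₄.ne'
  have hc : 0 < (a * b) ^ 2 / ((qInf1 (q ^ 2) (-(u₄ / s)) * qInf1 (q ^ 2) (-(u₃ * s))) ^ 2 *
      (qInf1 (q ^ 2) (-(u₁ * s)) * qInf1 (q ^ 2) (-(u₁ / s))) *
      (qInf1 (q ^ 2) (-(u₂ * s)) * qInf1 (q ^ 2) (-(u₂ / s)))) := by positivity
  rw [← sign_mul_of_pos hc]
  congr 1
  clear hc hk hl
  generalize qInf1 (q ^ 2) (-(u₁ * s)) = c₁ at *
  generalize qInf1 (q ^ 2) (-(u₁ / s)) = c₁' at *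
  generalize qInf1 (q ^ 2) (-(u₂ * s)) = c₂ at *
  generalize qInf1 (q ^ 2) (-(u₂ / s)) = c₂' at *
  generalize qInf1 (q ^ 2) (-(u₃ * s)) = c₃ at *
  generalize qInf1 (q ^ 2) (-(u₄ / s)) = c₄ at *
  field_simp

include hq0 hq1 in
theorem rReg_eq_special (hx₁ : x₁ ≠ 0) (hx₂ : x₂ ≠ 0) (h₁ : shiftPar q ε l x₁ = u₁)
    (h₂ : shiftPar q ε (l + r) (ε * x₂) = u₂) (h₃ : shiftPar q 1 (k + r) x₂ = u₃)
    (h₄ : shiftPar q 1 k (ε * x₁) = u₄) (hε : ε = 1 ∨ ε = -1) (hA : Adm (q ^ 2) u₁ u₂ u₃ u₄ s)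
    (hu : k = l → ∀ n : ℕ, u₁ * u₃ * (q ^ 2) ^ n ≠ 1) {α' : ℝ} (hα' : α' = 1 ∨ α' = -1) (Z : ℝ) :
    rReg q k r l ε α' Z x₁ (ε * x₂) x₂ (ε * x₁) u₁ u₂ u₃ u₄ s =
      rFormulaSpecial q k r l ε α' Z x₁ x₂ s := by
  have hp0 : 0 < q ^ 2 := by positivity
  have hp1 : q ^ 2 < 1 := pow_lt_one₀ hq0.le hq1 (by norm_num)
  have hq := hq0.ne'
  have hε0 : ε ≠ 0 := by rcases hε with rfl | rfl <;> norm_num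
  have hε' : ε⁻¹ = ε := by rcases hε with rfl | rfl <;> norm_num
  have hεε : ε * ε = 1 := by rcases hε with rfl | rfl <;> norm_num
  have hα0 : α'⁻¹ = α' := by rcases hα' with rfl | rfl <;> norm_num
  have hw : qFin (q ^ 2) [-(ε * q * (x₁ / s)), -(q ^ (2 * r + 1) * (x₂ * s))] k *
          qFin (q ^ 2) [-(ε * q * (x₁ * s)), -(q ^ (2 * r + 1) * (x₂ / s))] l /
        (qFin (q ^ 2) [-(ε * q * (x₁ * s)), -(q ^ (2 * r + 1) * (x₂ / s))] k *
          qFin (q ^ 2) [-(ε * q * (x₁ / s)), -(q ^ (2 * r + 1) * (x₂ * s))] l) =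
      wSq (q ^ 2) u₁ u₂ u₃ u₄ s := by
    obtain ⟨a, a', b, b', ha, ha', hb, hb', hk, hl, hk', hl'⟩ :=
      hA.qFin_special hq0 hq1 k r l h₁ h₂ h₃ h₄ hε
    rw [hk, hl, hk', hl', wSq]
    have n₁ := left_ne_zero_of_mul hA.pos₁.ne'
    have n₁' := right_ne_zero_of_mul hA.pos₁.ne'
    have n₂ := left_ne_zero_of_mul hA.pos₂.ne'
    have n₂' := right_ne_zero_of_mul hA.pos₂.ne'
    have n₃ := left_ne_zero_of_mul hA.pos₃.ne'
    have n₃' := right_ne_zero_of_mul hA.pos₃.ne'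
    have n₄ := left_ne_zero_of_mul hA.pos₄.ne'
    have n₄' := right_ne_zero_of_mul hA.pos₄.ne'
    field_simp
  -- For k ≠ l one of (q²u₁/u₄)_∞, (q²u₄/u₁)_∞ vanishes, since its parameter is a power of q² with
  -- exponent at most 0. For k = l both are (q²)_∞ and the root is 1. This is the origin of δ_{k,l}.
  have first : √ (wSq (q ^ 2) u₁ u₂ u₃ u₄ s) *
      (qInf1 (q ^ 2) (ε * q ^ 2 * (x₁ / x₂)) / qInf1 (q ^ 2) (q ^ 2) *
      ((-ε) ^ (l - k) * q ^ ((l - k) ^ 2) * (x₁ / (ε * x₁)) ^ (l - k) *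
        (qInf1 (q ^ 2) (q ^ 2 * (u₁ / u₄)) * qInf1 (q ^ 2) (q ^ 2 * (u₄ / u₁))))) =
      if k = l then qInf1 (q ^ 2) (ε * q ^ 2 * (x₁ / x₂)) * qInf1 (q ^ 2) (q ^ 2) else 0 := by
    have hz : u₁ = u₄ * (q ^ 2) ^ (l - k) := by
      rw [← h₁, ← h₄, shiftPar_mul_zpow hq0, shiftPar_mul_zpow hq0, zpow_sub₀ hp0.ne']
      field_simp
    have vanish : ∀ m : ℤ, m < 0 → qInf1 (q ^ 2) (q ^ 2 * (q ^ 2) ^ m) = 0 := fun m hm => by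
      obtain ⟨n, hn⟩ := Int.eq_ofNat_of_zero_le (show 0 ≤ -m - 1 by omega)
      refine qInf1_eq_zero hp0 hp1 n ?_
      rw [← zpow_natCast _ n, ← hn, mul_comm (q ^ 2), ← zpow_add_one₀ hp0.ne',
        ← zpow_add₀ hp0.ne']
      ring_nf; norm_num
    have hu₄ := hA.u₄_ne
    have e1 : u₁ / u₄ = (q ^ 2) ^ (l - k) := by rw [hz]; field_simp
    have e2 : u₄ / u₁ = (q ^ 2) ^ (k - l) := by
      rw [← inv_div, e1, ← zpow_neg, neg_sub]
    rw [e1, e2]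
    split_ifs with hkl
    · subst hkl
      have h14 : u₁ = u₄ := by rw [hz]; simp
      have h23 : u₂ = u₃ := by
        rw [← h₂, ← h₃, shiftPar_mul, hεε]
      subst h14 h23
      rw [hA.wSq_diag]
      have := qInf1_self_ne_zero hp0 hp1
      simp
      field_simp
    · rcases lt_or_gt_of_ne hkl with h | h
      · rw [vanish (k - l) (by omega)]; ring
      · rw [vanish (l - k) (by omega)]; ring
  have hV := V_eq_vReg hq0 hq1 k r l hε hx₁ h₁ h₂ h₃ h₄ hA hu
  have e12 : x₁ / (ε * x₂) = ε * (x₁ / x₂) := by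
    rw [div_mul_eq_div_div_swap, div_eq_mul_inv _ ε, hε', mul_comm]
  have eZ : Z / (ε * x₂) = ε * (Z / x₂) := by
    rw [div_mul_eq_div_div_swap, div_eq_mul_inv _ ε, hε', mul_comm]
  -- Reflection θ(q²/x) = θ(x) together with ε⁻¹ = ε and α'⁻¹ = α'.
  have t1 : theta1 (q ^ 2) (α' * (Z / (ε * x₂) / x₂)) =
      theta1 (q ^ 2) (ε * α' * q ^ 2 * (x₂ / (Z / x₂))) := by
    rw [← theta1_div_self hp0, eZ]
    congr 1
    simp only [div_eq_mul_inv, mul_inv, hε', hα0, inv_inv]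
    ring
  have t2 : -(ε * q * (ε * x₂ * s)) = -(q * (x₂ * s)) := by linear_combination -q * x₂ * s * hεε
  have t3 : -(α' * q * (Z / (ε * x₂) * s)) = -(ε * α' * q * (Z / x₂ * s)) := by rw [eZ]; ring
  have e4 : q ^ 2 * (x₁ / (ε * x₂)) = ε * q ^ 2 * (x₁ / x₂) := by rw [e12]; ring
  have e5 : q ^ (2 * r) * (ε * x₂ / x₁) = ε * q ^ (2 * r) * (x₂ / x₁) := by ring
  have e6 : q * (x₂ / s) * (x₁ / (ε * x₂)) = ε * (q * (x₁ / s)) := by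
    rw [e12]; field_simp
  rw [rReg, rFormulaSpecial, hw, hV, t1, t2, t3, e4, e5, add_comm l k]
  simp only [qInf_cons, qInf_nil, theta_cons, theta_nil, mul_one]
  have hif : (if k = l then q * (x₂ / s) * iota s *
      (theta1 (q ^ 2) (ε * α' * q ^ 2 * Z) * (theta1 (q ^ 2) (ε * α' * q ^ 2 * (x₂ / (Z / x₂))) *
        theta1 (q ^ 2) (s ^ 2))) *
        (qInf1 (q ^ 2) (ε * q ^ 2 * (x₁ / x₂)) * qInf1 (q ^ 2) (q ^ 2)) else 0) =
      q * (x₂ / s) * iota s *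
      (theta1 (q ^ 2) (ε * α' * q ^ 2 * Z) * (theta1 (q ^ 2) (ε * α' * q ^ 2 * (x₂ / (Z / x₂))) *
        theta1 (q ^ 2) (s ^ 2))) * (if k = l then
        qInf1 (q ^ 2) (ε * q ^ 2 * (x₁ / x₂)) * qInf1 (q ^ 2) (q ^ 2) else 0) := by
    split_ifs <;> ring
  rw [hif, ← first]
  generalize vReg (q ^ 2) (u₁ / u₄) (u₁ / u₂) (s ^ 2)⁻¹ (-(q ^ 2 / (u₃ * s))) (-(u₁ / s)) = W
  generalize √ (wSq (q ^ 2) u₁ u₂ u₃ u₄ s) = w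
  generalize theta1 (q ^ 2) (-(q * (x₂ * s))) = θ₁
  generalize theta1 (q ^ 2) (-(ε * α' * q * (Z / x₂ * s))) = θ₂
  generalize theta1 (q ^ 2) (-(q * (x₂ / s))) = θ₃
  generalize theta1 (q ^ 2) (-(ε * α' * q * (Z / x₂ / s))) = θ₄
  generalize qInf1 (q ^ 2) (ε * q ^ 2 * (x₁ / x₂)) = c₁
  generalize qInf1 (q ^ 2) (q ^ 2) = c₂
  generalize 1 - q ^ 2 = c₃
  linear_combination (iota s * (c₁ / c₂) * w * (q ^ (k + l) * W * (θ₁ * θ₂ * θ₃ * θ₄) *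
    ((1 - ε * q ^ (2 * r) * (x₂ / x₁)) * (1 - s ^ 2) / c₃))) * e6

end

end QIntertwiner

theorem proposition2 (q : ℝ) (hq0 : 0 < q) (hq1 : q < 1) (k r l : ℤ)
    (ε : ℝ) (hε : ε = 1 ∨ ε = -1) (α' : ℝ) (hα' : α' = 1 ∨ α' = -1)
    (Z : ℝ) (hZ : Z ≠ 0) (x₁ x₂ s : ℝ) (hx₁ : 0 < x₁) (hx₂ : 0 < x₂)
    (hs0 : s ≠ 0) (hs : ∀ n : ℤ, s ^ 2 ≠ q ^ (2 * n))
    (hR1 : ∀ n : ℤ, ε * (x₂ / x₁) ≠ q ^ (2 * n))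
    (hR2 : ∀ n : ℤ, ε * (x₂ / x₁) / s ^ 2 ≠ q ^ (2 * n))
    (hR3 : ∀ n : ℤ, 0 < n → ε * (x₂ / x₁) * s ^ 2 ≠ q ^ (2 * n)) :
    (∀ α x₃ x₄ : ℝ, (α = 1 ∨ α = -1) → 0 < x₃ → 0 < x₄ → x₂ * x₄ = x₁ * x₃ →
      RootsPos q x₁ (α * s) → RootsPos q x₂ (α * (ε * s)) →
      RootsPos q x₃ s → RootsPos q x₄ (ε * s) →
      (∀ n : ℕ, α * q ^ (2 * (k + l + r + 1 + n)) * (x₁ * x₃) ≠ 1) →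
      HasValue q k r l 1 α (α * α') Z x₁ (ε * x₂) x₃ (ε * x₄) s
        (ε ^ k * α ^ r * rootSign q k r l α x₁ (ε * x₂) x₃ (ε * x₄) s *
          rFormula q k r l α α' Z x₁ (ε * x₂) x₃ (ε * x₄) s) ∧
      HasValue q k r l ε α (α * α') Z x₁ x₂ x₃ x₄ s
        (ε ^ (k + r) *
          (ε ^ k * α ^ r * rootSign q k r l α x₁ (ε * x₂) x₃ (ε * x₄) s *
            rFormula q k r l α α' Z x₁ (ε * x₂) x₃ (ε * x₄) s))) ∧
    (RootsPos q x₁ (ε * s) → RootsPos q x₂ s →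
      (k = l → ∀ n : ℕ, ε * q ^ (2 * (2 * k + r + 1 + n)) * (x₁ * x₂) ≠ 1) →
      HasValue q k r l ε ε (ε * α') Z x₁ x₂ x₂ x₁ s
        (rootSignSpecial q k r l ε x₁ x₂ s * rFormulaSpecial q k r l ε α' Z x₁ x₂ s)) ∧
    (l < k → ∀ n : ℕ, k - l ≤ n → tTerm q k r l ε x₁ x₂ s n = 0) ∧
    (k < l → ∀ n : ℕ, l - k ≤ n →
      tTerm q (l + r) (-r) (k + r) ε (ε * x₂) (ε * x₁) s n = 0) := by
  have hε0 : ε ≠ 0 := by rcases hε with rfl | rfl <;> norm_num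
  have hεε : ε * ε = 1 := by rcases hε with rfl | rfl <;> norm_num
  have hY := qInf1_antidiag_ne_zero hq0 hq1 hε0 hx₁ hx₂ hs0 hR3
  have key : ∀ α x₃ x₄ : ℝ, (α = 1 ∨ α = -1) → 0 < x₃ → 0 < x₄ → x₂ * x₄ = x₁ * x₃ →
      Adm (q ^ 2) (shiftPar q α l x₁) (shiftPar q α (l + r) (ε * x₂)) (shiftPar q 1 (k + r) x₃)
        (shiftPar q 1 k (ε * x₄)) s →
      HasValue q k r l 1 α (α * α') Z x₁ (ε * x₂) x₃ (ε * x₄) s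
        (ε ^ k * α ^ r * rootSign q k r l α x₁ (ε * x₂) x₃ (ε * x₄) s *
          rReg q k r l α α' Z x₁ (ε * x₂) x₃ (ε * x₄) (shiftPar q α l x₁)
            (shiftPar q α (l + r) (ε * x₂)) (shiftPar q 1 (k + r) x₃)
            (shiftPar q 1 k (ε * x₄)) s) := fun α x₃ x₄ hα hx₃ hx₄ hx hA =>
    hasValue_rReg hq0 hq1 k r l hα hε hα' hZ hx₁.ne' (mul_ne_zero hε0 hx₂.ne') hx₃
      (by rwa [← mul_assoc, hεε, one_mul]) rfl rfl rfl rfl hA hY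
  have hsum : ∀ m : ℤ, q ^ (2 * (k + l + r + 1 + m)) =
      q ^ (2 * l + 1) * q ^ (2 * (k + r) + 1) * (q ^ 2) ^ m := fun m => by
    rw [sq_zpow, ← zpow_add₀ hq0.ne', ← zpow_add₀ hq0.ne']
    congr 1; ring
  refine ⟨fun α x₃ x₄ hα hx₃ hx₄ hx h₁ h₂ h₃ h₄ hφ => ?_, fun h₁ h₂ hφ => ?_,
    fun h n hn => tTerm_eq_zero k r l hq0 h n hn ε x₁ x₂ s,
    fun h n hn => tTerm_eq_zero (l + r) (-r) (k + r) hq0 (by omega) n (by omega) ε _ _ s⟩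
  · have hA := adm_shiftPar hq0 hq1 k r l hε hα hx₁ hx₂ hx₃ hx₄ hs0 hx hs hR1 hR2 h₁ h₂ h₃ h₄
    have hv := key α x₃ x₄ hα hx₃ hx₄ hx hA
    rw [← rFormula_eq_rReg hq0 hq1 k r l hA hα rfl rfl rfl rfl (fun n => ?_)] at hv
    · exact ⟨hv, hv.sign k r l hε⟩
    · convert hφ n using 1
      rw [hsum, zpow_natCast, shiftPar, shiftPar]
      ring
  · have hx : x₂ * x₁ = x₁ * x₂ := mul_comm _ _
    have hA := adm_shiftPar hq0 hq1 k r l hε hε hx₁ hx₂ hx₂ hx₁ hs0 hx hs hR1 hR2 h₁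
      (by rwa [← mul_assoc, hεε, one_mul]) h₂ h₁
    have hv := (key ε x₂ x₁ hε hx₂ hx₁ hx hA).sign k r l hε
    -- The signs combine to ε^(k+r)·ε^k·α^r = ε^(2(k+r)) = 1, because α = ε.
    rw [rReg_eq_special hq0 hq1 k r l hx₁.ne' hx₂.ne' rfl rfl rfl rfl hε hA (fun hkl n => ?_) hα',
      rootSign_eq_special hq0 hq1 k r l rfl rfl rfl rfl hε hA, ← mul_assoc, ← mul_assoc,
      ← zpow_add₀ hε0, ← zpow_add₀ hε0, ← two_mul, zpow_mul,
      show ε ^ (2 : ℤ) = 1 by rw [zpow_two, hεε], one_zpow, one_mul] at hv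
    · exact hv
    · convert hφ hkl n using 1
      rw [show (2 * k + r + 1 + n : ℤ) = k + l + r + 1 + n by omega, hsum, zpow_natCast,
        shiftPar, shiftPar]
      ring
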